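/- **Setting.** Let $\Gamma$ be a finite index subgroup of $\Gamma_1=\mathrm{SL}_2(\mathbb Z)$, let $k\ge 2$ be an integer, $w=k-2$, and let $\overline\Gamma,\overline\Gamma_1$ denote the images of $\Gamma,\Gamma_1$ modulo $\{\pm1\}$. Put $S=\left(\begin{smallmatrix}0&-1\\1&0\end{smallmatrix}\right)$, $T=\left(\begin{smallmatrix}1&1\\0&1\end{smallmatrix}\right)$, $U=TS$, $\epsilon=\left(\begin{smallmatrix}-1&0\\0&1\end{smallmatrix}\right)$, and $C_k=-(2i)^{k-1}$. For $f\in M_k(\Gamma)$ and $A\in\Gamma_1$ let $f|A$ be the weight $k$ slash action and $a_0(f|A)$ the constant term of the Fourier expansion of $f|A$. Families $P$ on $\Gamma\backslash\Gamma_1$ of functions of $z$ (or $X$) carry the action $(P|g)(A)=P(Ag^{-1})|_{-w}\,g$, where $(\varphi|_{-w}g)(z)=\varphi(gz)(cz+d)^w$ for $g=\left(\begin{smallmatrix}*&*\\c&d\end{smallmatrix}\right)\in\Gamma_1$, extended linearly to sums of elements of $\Gamma_1$. **Extended period polynomials.** Let $\widehat W_w^\Gamma$ be the space of maps $P$ from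 $\Gamma\backslash\Gamma_1$ to $\{\sum_{-1\le i\le w+1}a_iX^i : a_i\in\mathbb C\}$ with $P(-A)=(-1)^wP(A)$ and $P|(1+S)=P|(1+U+U^2)=0$. Every $\widehat P\in\widehat W_w^\Gamma$ has a unique decomposition $\widehat P=P+P^0|(1-S)$, where each $P(A)$ is a polynomial of degree at most $w$ and $P^0(A)=c_AX^{w+1}$ with $c_A\in\mathbb C$. For $f\in M_k(\Gamma)$ put $\tilde\rho_f=\tilde f|(1-S)$, where $$\tilde f(A)(z)=\int_z^{i\infty}\big[f|A(t)-a_0(f|A)\big](t-z)^w\,dt\qquad(\operatorname{Im} z>0).$$ **Extended pairing.** For polynomials of degree at most $w$ let $\langle\sum a_nX^n,\sum b_nX^n\rangle=\sum_{n=0}^w(-1)^{w-n}\binom wn^{-1}a_nb_{w-n}$, and for families $P,Q$ of such polynomials let $\langle\!\langle P,Q\rangle\!\rangle=\frac1{[\overline\Gamma_1:\overline\Gamma]}\sum_{A\in\overline\Gamma\backslash\overline\Gamma_1}\langle P(A),Q(A)\rangle$. For $\widehat P=P+P^0|(1-S)$ and $\widehat Q=Q+Q^0|(1-S)$ in $\widehat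 W_w^\Gamma$, with $P^0(A)=c_AX^{w+1}$ and $Q^0(A)=c'_AX^{w+1}$, put $$\{\widehat P,\widehat Q\}=\langle\!\langle P|(T-T^{-1}),Q\rangle\!\rangle+\langle\!\langle 2P^0|(T-T^{-1}),Q\rangle\!\rangle+\langle\!\langle P,2Q^0|(T^{-1}-T)\rangle\!\rangle+I_k(P^0,Q^0),$$ where $I_k=0$ if $k$ is even and $I_k(P^0,Q^0)=\frac{6(k-1)}{k[\overline\Gamma_1:\overline\Gamma]}\sum_{A\in\overline\Gamma\backslash\overline\Gamma_1}c_Ac'_A$ if $k$ is odd. **Extended Petersson product.** With $\mathcal F_Y=\{z=x+iy : |z|\ge1,\ |x|\le\frac12,\ 0<y<Y\}$, put for $f,g\in M_k(\Gamma)$ $$(f,g)=\frac1{[\overline\Gamma_1:\overline\Gamma]}\lim_{Y\to\infty}\sum_{A\in\overline\Gamma\backslash\overline\Gamma_1}\Big[\int_{\mathcal F_Y}f|A(z)\,\overline{g|A(z)}\,y^{w}\,dx\,dy-\frac{Y^{k-1}}{k-1}\,a_0(f|A)\,\overline{a_0(g|A)}\Big].$$ **Theorem.** Let $f,g\in M_k(\Gamma)$.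 The constant terms, the integrals and the limit above exist, $\tilde\rho_f$ and $\tilde\rho_g$ are (given by) elements of $\widehat W_w^\Gamma$, and, writing $\overline P$ for the family obtained from $P$ by complex conjugation of the coefficients: (a) $6\,C_k\,(f,g)=\{\tilde\rho_f,\overline{\tilde\rho_g}\}$. (b) $\{\tilde\rho_f,\tilde\rho_g\}=0$. (c) Assume moreover that $\Gamma$ is normalized by $\epsilon$, and for $P\in\widehat W_w^\Gamma$ let $P^{\pm}=\frac12(P\pm P|\epsilon)$, where $(P|\epsilon)(A)(X)=P(\epsilon A\epsilon)(-X)$. Then for all $\kappa_1,\kappa_2\in\{+,-\}$ with $\kappa_1\ne\kappa_2$ if $k$ is even and $\kappa_1=\kappa_2$ if $k$ is odd, $$3\,C_k\,(f,g)=\{\tilde\rho_f^{\kappa_1},\overline{\tilde\rho_g^{\kappa_2}}\}.$$ -/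

import Mathlib

open Filter Topology MeasureTheory UpperHalfPlane
open scoped MatrixGroups ModularForm Modular Polynomial LaurentPolynomial ComplexConjugate

noncomputable section

namespace HaberlandExt

/-! Maps on `Γ \ SL₂(ℤ)` are represented by maps `F` on `SL₂(ℤ)` with `F (γ * A) = F A` for
`γ ∈ Γ`. -/

/-- The preimage `Γ · {±1}` in `SL₂(ℤ)` of the projectivisation of `Γ`. Its right cosets are the
cosets of the projectivised groups, and its index is the index of the projectivised groups. -/
def projHull (Γ : Subgroup SL(2, ℤ)) : Subgroup SL(2, ℤ) :=
  Γ ⊔ Subgroup.zpowers (-1)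

/-- The average `[Γ̄₁ : Γ̄]⁻¹ ∑_{A ∈ Γ̄ \ Γ̄₁} F(A)`, over a system of representatives. -/
def cosetAvg (Γ : Subgroup SL(2, ℤ)) (F : SL(2, ℤ) → ℂ) : ℂ :=
  ((projHull Γ).index : ℂ)⁻¹ *
    ∑ᶠ q : Quotient (QuotientGroup.rightRel (projHull Γ)), F q.out

/-- The right action `(Φ | g)(A) = Φ(A g⁻¹) |ₘ g` of `g ∈ SL₂(ℤ)` on families of functions on `ℍ`
indexed by `SL₂(ℤ)`, in weight `m`. -/
def famSlash (m : ℤ) (g : SL(2, ℤ)) (Φ : SL(2, ℤ) → ℍ → ℂ) : SL(2, ℤ) → ℍ → ℂ :=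
  fun A => Φ (A * g⁻¹) ∣[m] g

/-- The constant term `a₀(f|A)` of the Fourier expansion of `f|A` (the value at `i∞`). -/
def constTerm (k : ℕ) (f : ℍ → ℂ) (A : SL(2, ℤ)) : ℂ :=
  valueAtInfty (f ∣[(k : ℤ)] A)

/-- The integrand of the Eichler integral on the vertical half line `t = z + i s`, `s > 0`
(where `t - z = i s` and `dt = i ds`). -/
def eichlerIntegrand (k : ℕ) (f : ℍ → ℂ) (A : SL(2, ℤ)) (z : ℍ) (s : ℝ) : ℂ :=
  ((f ∣[(k : ℤ)] A) (ofComplex ((z : ℂ) + s * Complex.I)) - constTerm k f A) *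
    ((s : ℂ) * Complex.I) ^ (k - 2) * Complex.I

/-- The Eichler integral `f̃(A)(z) = ∫_z^{i∞} [f|A(t) - a₀(f|A)] (t - z)^{k-2} dt`. -/
def eichler (k : ℕ) (f : ℍ → ℂ) (A : SL(2, ℤ)) (z : ℍ) : ℂ :=
  ∫ s in Set.Ioi (0 : ℝ), eichlerIntegrand k f A z s

/-- `f̃ | (1 - S)`, with the action in weight `-w = -(k-2)`. -/
def periodFun (k : ℕ) (f : ℍ → ℂ) : SL(2, ℤ) → ℍ → ℂ :=
  eichler k f - famSlash (-((k - 2 : ℕ) : ℤ)) ModularGroup.S (eichler k f)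

/-- The value of a Laurent polynomial at a point of the upper half plane. -/
def laurentEval (P : ℂ[T;T⁻¹]) (z : ℍ) : ℂ :=
  P.coeff.sum fun n a => a * (z : ℂ) ^ n

/-- The space of Laurent polynomials `∑_{-1 ≤ i ≤ w+1} aᵢ Xⁱ`. -/
def extV (w : ℕ) : Set ℂ[T;T⁻¹] :=
  {P | ∀ n : ℤ, P.coeff n ≠ 0 → -1 ≤ n ∧ n ≤ (w : ℤ) + 1}

/-- The space `Ŵ_w^Γ` of extended period polynomials: families `P` on `Γ \ SL₂(ℤ)` with values in
`extV w`, with `P(-A) = (-1)^w P(A)` and `P|(1 + S) = 0 = P|(1 + U + U²)`, `U = T S`. The two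
relations are identities of rational functions, expressed as identities of functions on `ℍ`. -/
structure IsExtPeriodPoly (Γ : Subgroup SL(2, ℤ)) (w : ℕ) (P : SL(2, ℤ) → ℂ[T;T⁻¹]) : Prop where
  mem_extV : ∀ A, P A ∈ extV w
  invariant : ∀ γ ∈ Γ, ∀ A, P (γ * A) = P A
  parity : ∀ A, P (-A) = (-1 : ℂ) ^ w • P A
  rel_S : (fun A => laurentEval (P A)) +
    famSlash (-(w : ℤ)) ModularGroup.S (fun A => laurentEval (P A)) = 0
  rel_U : (fun A => laurentEval (P A)) +
    famSlash (-(w : ℤ)) (ModularGroup.T * ModularGroup.S) (fun A => laurentEval (P A)) +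
    famSlash (-(w : ℤ)) ((ModularGroup.T * ModularGroup.S) ^ 2)
      (fun A => laurentEval (P A)) = 0

open Classical in
/-- The extended period polynomial `ρ̃_f = f̃ | (1 - S)`: the (unique) family of Laurent polynomials
in `extV (k-2)` whose values on `ℍ` are those of `f̃ | (1 - S)`. (The value `0` is a default, used
only if no such family exists.) -/
def extPeriodPoly (k : ℕ) (f : ℍ → ℂ) : SL(2, ℤ) → ℂ[T;T⁻¹] :=
  if h : ∃ P : SL(2, ℤ) → ℂ[T;T⁻¹],
      (∀ A, P A ∈ extV (k - 2)) ∧ ∀ A z, laurentEval (P A) z = periodFun k f A z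
  then h.choose else 0

/-- The `SL₂`-invariant pairing
`⟨∑ aₙ Xⁿ, ∑ bₙ Xⁿ⟩ = ∑ (-1)^{w-n} (w choose n)⁻¹ aₙ b_{w-n}` on polynomials of degree `≤ w`. -/
def polyPair (w : ℕ) (P Q : ℂ[X]) : ℂ :=
  ∑ n ∈ Finset.range (w + 1),
    (-1 : ℂ) ^ (w - n) * ((w.choose n : ℂ))⁻¹ * P.coeff n * Q.coeff (w - n)

/-- The pairing `⟪P, Q⟫ = [Γ̄₁ : Γ̄]⁻¹ ∑_{A ∈ Γ̄ \ Γ̄₁} ⟨P(A), Q(A)⟩`. -/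
def famPair (Γ : Subgroup SL(2, ℤ)) (w : ℕ) (P Q : SL(2, ℤ) → ℂ[X]) : ℂ :=
  cosetAvg Γ fun A => polyPair w (P A) (Q A)

/-- The action of `Tⁿ` on families of polynomials: `(P|Tⁿ)(A)(X) = P(A T⁻ⁿ)(X + n)`. Since
`j(Tⁿ, z) = 1` this does not depend on the weight. -/
def famTranslate (n : ℤ) (P : SL(2, ℤ) → ℂ[X]) : SL(2, ℤ) → ℂ[X] :=
  fun A => (P (A * ModularGroup.T ^ (-n))).comp (Polynomial.X + Polynomial.C (n : ℂ))

/-- The component `P` in the decomposition `P̂ = P + P⁰|(1 - S)` of `P̂ ∈ Ŵ_w^Γ`, with `P(A)` of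
degree `≤ w` and `P⁰(A) = c_A X^{w+1}`. As `P⁰|(1 - S)` only involves `X^{w+1}` and `X^{-1}`, it
consists of the terms of degree `0, …, w` of `P̂`. -/
def polyPart (w : ℕ) (P : SL(2, ℤ) → ℂ[T;T⁻¹]) : SL(2, ℤ) → ℂ[X] :=
  fun A => ∑ n ∈ Finset.range (w + 1), Polynomial.monomial n ((P A).coeff (n : ℤ))

/-- The coefficient `c_A` in the same decomposition: the coefficient of `X^{w+1}` in `P̂(A)`. -/
def topCoeff (w : ℕ) (P : SL(2, ℤ) → ℂ[T;T⁻¹]) (A : SL(2, ℤ)) : ℂ :=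
  (P A).coeff ((w : ℤ) + 1)

/-- The family `P⁰(A) = c_A X^{w+1}` in the same decomposition. -/
def topPart (w : ℕ) (P : SL(2, ℤ) → ℂ[T;T⁻¹]) : SL(2, ℤ) → ℂ[X] :=
  fun A => Polynomial.monomial (w + 1) (topCoeff w P A)

/-- The term `I_k(P⁰, Q⁰)`: zero for even `k`, and
`6 (k-1) / (k [Γ̄₁ : Γ̄]) ∑_{A ∈ Γ̄ \ Γ̄₁} c_A c'_A` for odd `k`. -/
def oddTerm (Γ : Subgroup SL(2, ℤ)) (k : ℕ) (P Q : SL(2, ℤ) → ℂ[T;T⁻¹]) : ℂ :=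
  if Even k then 0
  else 6 * ((k : ℂ) - 1) / k *
    cosetAvg Γ fun A => topCoeff (k - 2) P A * topCoeff (k - 2) Q A

/-- The extended pairing `{P̂, Q̂} = ⟪P|(T - T⁻¹), Q⟫ + ⟪2 P⁰|(T - T⁻¹), Q⟫
+ ⟪P, 2 Q⁰|(T⁻¹ - T)⟫ + I_k(P⁰, Q⁰)` on extended period polynomials, `w = k - 2`. -/
def extPair (Γ : Subgroup SL(2, ℤ)) (k : ℕ) (P Q : SL(2, ℤ) → ℂ[T;T⁻¹]) : ℂ :=
  famPair Γ (k - 2)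
      (famTranslate 1 (polyPart (k - 2) P) - famTranslate (-1) (polyPart (k - 2) P))
      (polyPart (k - 2) Q) +
    famPair Γ (k - 2)
      ((2 : ℂ) • (famTranslate 1 (topPart (k - 2) P) - famTranslate (-1) (topPart (k - 2) P)))
      (polyPart (k - 2) Q) +
    famPair Γ (k - 2) (polyPart (k - 2) P)
      ((2 : ℂ) • (famTranslate (-1) (topPart (k - 2) Q) - famTranslate 1 (topPart (k - 2) Q))) +
    oddTerm Γ k P Q

/-- Complex conjugation of the coefficients. -/
def conjFam (P : SL(2, ℤ) → ℂ[T;T⁻¹]) : SL(2, ℤ) → ℂ[T;T⁻¹] :=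
  fun A => (P A).map ((starRingEnd ℂ : ℂ →+* ℂ) : ℂ →+ ℂ)

/-- Conjugation `A ↦ ε A ε` by `ε = diag(-1, 1)`. -/
def epsConj (A : SL(2, ℤ)) : SL(2, ℤ) :=
  ⟨!![A 0 0, -A 0 1; -A 1 0, A 1 1], by
    have h := A.det_coe
    rw [Matrix.det_fin_two] at h
    rw [Matrix.det_fin_two_of]
    linarith⟩

/-- The action `(P|ε)(A)(X) = P(ε A ε)(-X)`. -/
def famEps (P : SL(2, ℤ) → ℂ[T;T⁻¹]) : SL(2, ℤ) → ℂ[T;T⁻¹] :=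
  fun A => (P (epsConj A)).coeff.sum fun n a => .single n ((-1 : ℂ) ^ n * a)

/-- The even part `P⁺ = (P + P|ε)/2` (for `κ = 1`) and the odd part `P⁻ = (P - P|ε)/2`
(for `κ = -1`). -/
def signPart (κ : ℤˣ) (P : SL(2, ℤ) → ℂ[T;T⁻¹]) : SL(2, ℤ) → ℂ[T;T⁻¹] :=
  (1 / 2 : ℂ) • (P + ((κ : ℤ) : ℂ) • famEps P)

/-- The standard fundamental domain `𝒟` truncated at height `Y`. -/
def truncDomain (Y : ℝ) : Set ℍ := {z | z ∈ 𝒟 ∧ z.im < Y}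

/-- The expression `[Γ̄₁ : Γ̄]⁻¹ ∑_A [∫_{𝒟_Y} f|A(z) conj(g|A(z)) y^k dx dy / y²
- Y^{k-1}/(k-1) a₀(f|A) conj(a₀(g|A))]`. The measure on `ℍ` is the invariant one, `dx dy / y²`. -/
def truncPetersson (Γ : Subgroup SL(2, ℤ)) (k : ℕ) (f g : ℍ → ℂ) (Y : ℝ) : ℂ :=
  cosetAvg Γ fun A =>
    (∫ z in truncDomain Y,
      (f ∣[(k : ℤ)] A) z * conj ((g ∣[(k : ℤ)] A) z) * (z.im : ℂ) ^ k) -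
    (Y : ℂ) ^ (k - 1) / ((k : ℂ) - 1) * constTerm k f A * conj (constTerm k g A)

/-- The extended (renormalized) Petersson product: the limit of `truncPetersson` as `Y → ∞`. -/
def extPetersson (Γ : Subgroup SL(2, ℤ)) (k : ℕ) (f g : ℍ → ℂ) : ℂ :=
  limUnder atTop (truncPetersson Γ k f g)

/-- The constant `C_k = -(2i)^{k-1}`. -/
def haberlandConst (k : ℕ) : ℂ := -(2 * Complex.I) ^ (k - 1)

end HaberlandExt

end

open HaberlandExt

/-! ### Linear algebra of the Haberland identity -/

section Algebra

/-! Put w = k - 2, ρ = e^{2πi/3} and η = ρ + 1 = -1/ρ. Everything is compared with coset averages of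
integrals over the arc from η to ρ at the bottom of the fundamental domain.

Algebraic half. Let G be the family of slashes of a modular form and let γ_z be the polynomial in X
given by the integral of G(t)(t - X)^w from i∞ to z, regularised by the constant term. Pairing with
(t - X)^w is evaluation at t, so the arc integral of P·G is ⟪P, γ_ρ⟫ - ⟪P, γ_η⟫. Since η is both
-1/ρ and ρ + 1, γ_η|S = γ_ρ + Q and γ_η|T = γ_ρ - N', where Q is the polynomial part of the period
polynomial of G and N' is its top term acted on by 1 - T. Suppose an extended polynomial with parts
P and c X^{w+1} has P|S = -P and a potential β with β|S = β|T + P + N, where N = c X^{w+1}|(1 - T).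
Then P|(1 + U + U²) is an explicit combination of translates of N (`cocycle_rel_U`), and invariance
of the pairing eliminates γ_η (`haberland_algebra`). The X^{w+1} and X^{-1} terms are handled by the
moment of order w + 1, and what remains of them is I_k. The result, `cosetAvg_arcInt_eq_coeffPair`,
says that three times the averaged arc integral of such a polynomial against G is its extended
pairing with the period polynomial of G.

Analytic half. Let E(z, x) be the regularised integral of F(t)(t - x)^w from i∞ to z. The period
function is E|(S - 1), whatever z is (`perFun_eq`). Taking x = z makes it a coboundary of the
holomorphic function E(z, z), which decays at i∞; its arc integral against G is -2 times that of
E(z, z)G, which vanishes by Cauchy's theorem and T-invariance. This is (b). Taking x = z̄ and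
conjugating gives -2 times the arc integral of the conjugate of E(z, z̄)·conj G. The ∂-derivative of
E(z, z̄)·conj G is F·conj G·(2iy)^w, so Stokes' formula on the truncated domain turns the arc
integral into the renormalised Petersson product: the vertical sides cancel in the average, and the
horizontal side tends to exactly the subtracted power of Y. This is (a). Only the formal properties
of the first argument enter the algebraic half, so they may be used for the conjugate of a period
polynomial as well (`IsPeriodData.conj`).

For (c), the family conj(G(εAε)(-z̄)) is again modular, and its period polynomial is, up to sign,
the ε-transform of the conjugate of that of G. So (b) kills the cross terms {P, Q|ε} and {P|ε, Q};
as {P|ε, Q|ε} = (-1)^{w+1}{P, Q}, the parts of allowed signs pair to half of (a). -/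

/-- The relation `x|(1 + U + U²) = …` for a cocycle that is trivialised up to translation. -/
theorem cocycle_rel_U {M : Type*} [AddCommGroup M] [Module ℂ M] (s t t' : M →ₗ[ℂ] M)
    (hss : ∀ x, s (s x) = x) (ht't : ∀ x, t' (t x) = x)
    (hbraid : ∀ x, s (t (s x)) = t' (s (t' x)))
    {P N β : M} (hP : s P = -P) (hβ : s β = t β + P + N) :
    P + s (t P) + t' (s P) = t' N + s N + t' (s (t' N)) := by
  have h1 : s (t β) = β + P - s N := by
    have := congrArg s hβ
    rw [hss, map_add, map_add, hP] at this
    linear_combination (norm := module) (-1 : ℂ) • this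
  have h2 : t' (s β) = β + t' P + t' N := by
    rw [hβ, map_add, map_add, ht't]
  have h3 : t β = s (β + P - s N) := by rw [← h1, hss]
  -- The word s t s t applied to β is computed twice: by using the relation for s (t β) two times,
  -- and by the braid relation, which reduces it to t' (s β). Comparing the two removes β.
  have h4 : s (t (s (t β))) = s (t β) + s (t P) - s (t (s N)) := by
    rw [h1, map_sub, map_add, map_sub, map_add, h1]
  have h5 : s (t (s (t β))) = t' (s β) := by rw [hbraid, ht't]
  rw [hbraid N] at h4
  rw [h5, h2, h1] at h4
  rw [hP, map_neg]
  linear_combination (norm := module) (-1 : ℂ) • h4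

/-- Invariance makes `s` self-adjoint and `t`, `t'` adjoint to each other. The three-term relation
for `P` is tested against `g` and `Q`, the one for `Q` against `N` after a translation; these
combine to the claim up to the asymmetry that `hNN` removes. -/
theorem haberland_algebra {M : Type*} [AddCommGroup M] [Module ℂ M]
    (B : M →ₗ[ℂ] M →ₗ[ℂ] ℂ) (s t t' : M →ₗ[ℂ] M)
    (hss : ∀ x, s (s x) = x) (htt' : ∀ x, t (t' x) = x) (ht't : ∀ x, t' (t x) = x)
    (hbraid : ∀ x, s (t (s x)) = t' (s (t' x)))
    (Bs : ∀ x y, B (s x) (s y) = B x y) (Bt : ∀ x y, B (t x) (t y) = B x y)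
    {P N β Q N' g : M} (hP : s P = -P) (hβ : s β = t β + P + N)
    (hQ : s Q = -Q) (hg : s g = t g + Q + N')
    (hNN : B N (t (s N')) = B N (s (t' N'))) :
    -6 * B P g - 3 * B P Q + 6 * B N (t g) + 3 * B N N' =
      B (t P - t' P) Q - 2 * B (N + t' N) Q + 2 * B P (N' + t' N') := by
  have As : ∀ x y, B (s x) y = B x (s y) := fun x y => by rw [← Bs x (s y), hss]
  have At : ∀ x y, B (t x) y = B x (t' y) := fun x y => by rw [← Bt x (t' y), htt']
  have At' : ∀ x y, B (t' x) y = B x (t y) := fun x y => by rw [← Bt (t' x) y, htt']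
  have UP := cocycle_rel_U s t t' hss ht't hbraid hP hβ
  have UQ := cocycle_rel_U s t t' hss ht't hbraid hQ hg
  have g1 : s (t g) = g + Q - s N' := by
    have := congrArg s hg
    rw [hss, map_add, map_add, hQ] at this
    linear_combination (norm := module) (-1 : ℂ) • this
  have sP : ∀ y, B P (s y) = - B P y := fun y => by
    rw [← As, hP]; simp
  have e1 := congrArg (fun x => B x g) UP
  have e2 := congrArg (fun x => B x Q) UP
  have e3 := congrArg (fun x => B N (t x)) UQ
  simp only [map_add, map_sub, LinearMap.add_apply, LinearMap.sub_apply, As, At, At', sP, hg, g1,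
    hQ, htt', map_neg] at e1 e2 e3 ⊢
  rw [ht't] at e1
  linear_combination -2 * e1 - e2 - e3 + hNN

end Algebra

/-! ### Averages over the cosets of the projectivised group -/

section Cosets

variable {Γ : Subgroup SL(2, ℤ)}

theorem projHull_invariant {F : SL(2, ℤ) → ℂ} (h1 : ∀ γ ∈ Γ, ∀ A, F (γ * A) = F A)
    (h2 : ∀ A, F (-A) = F A) {γ : SL(2, ℤ)} (hγ : γ ∈ projHull Γ) (A : SL(2, ℤ)) :
    F (γ * A) = F A := by
  rw [projHull, ← Subgroup.closure_eq Γ, Subgroup.zpowers_eq_closure, ← Subgroup.closure_union]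
    at hγ
  induction hγ using Subgroup.closure_induction generalizing A with
  | mem x hx =>
    rcases hx with hx | hx
    · exact h1 x hx A
    · rw [Set.mem_singleton_iff.mp hx, neg_mul, one_mul, h2]
  | one => rw [one_mul]
  | mul x y _ _ hx hy => rw [mul_assoc, hx, hy]
  | inv x _ hx => rw [← hx, mul_inv_cancel_left]

instance projHull_finiteIndex [Γ.FiniteIndex] : (projHull Γ).FiniteIndex :=
  Subgroup.finiteIndex_of_le (le_sup_left : Γ ≤ projHull Γ)

instance finite_rightCosets {G : Type*} [Group G] (H : Subgroup G) [H.FiniteIndex] :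
    Finite (Quotient (QuotientGroup.rightRel H)) :=
  Finite.of_equiv _ (QuotientGroup.quotientRightRelEquivQuotientLeftRel H).symm

/-- Functions on `Γ \ SL₂(ℤ)` that do not see the sign. -/
def CosetInv (Γ : Subgroup SL(2, ℤ)) (F : SL(2, ℤ) → ℂ) : Prop :=
  (∀ γ ∈ Γ, ∀ A, F (γ * A) = F A) ∧ ∀ A, F (-A) = F A

/-- Averages over cosets are invariant under permutations of the cosets. -/
theorem cosetAvg_comp {F : SL(2, ℤ) → ℂ} (hF : CosetInv Γ F) (σ : Equiv.Perm SL(2, ℤ))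
    (h : ∀ A B, B * A⁻¹ ∈ projHull Γ → σ B * (σ A)⁻¹ ∈ projHull Γ)
    (h' : ∀ A B, B * A⁻¹ ∈ projHull Γ → σ.symm B * (σ.symm A)⁻¹ ∈ projHull Γ) :
    cosetAvg Γ (fun A => F (σ A)) = cosetAvg Γ F := by
  have hrel : ∀ A B : SL(2, ℤ), QuotientGroup.rightRel (projHull Γ) A B → F A = F B := by
    intro A B hAB
    rw [QuotientGroup.rightRel_apply] at hAB
    simpa using (projHull_invariant hF.1 hF.2 hAB A).symm
  unfold cosetAvg
  congr 1
  have hr : ∀ A B : SL(2, ℤ), QuotientGroup.rightRel (projHull Γ) A B →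
      QuotientGroup.rightRel (projHull Γ) (σ A) (σ B) := by
    intro A B hAB
    rw [QuotientGroup.rightRel_apply] at hAB ⊢
    exact h A B hAB
  have hr' : ∀ A B : SL(2, ℤ), QuotientGroup.rightRel (projHull Γ) A B →
      QuotientGroup.rightRel (projHull Γ) (σ.symm A) (σ.symm B) := by
    intro A B hAB
    rw [QuotientGroup.rightRel_apply] at hAB ⊢
    exact h' A B hAB
  let e : Quotient (QuotientGroup.rightRel (projHull Γ)) ≃
      Quotient (QuotientGroup.rightRel (projHull Γ)) :=
    { toFun := Quotient.map σ hr
      invFun := Quotient.map σ.symm hr'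
      left_inv := by
        rintro ⟨A⟩
        exact congrArg (Quotient.mk _) (σ.symm_apply_apply A)
      right_inv := by
        rintro ⟨A⟩
        exact congrArg (Quotient.mk _) (σ.apply_symm_apply A) }
  refine finsum_eq_of_bijective e e.bijective fun q => ?_
  apply hrel
  apply Quotient.exact
  rw [Quotient.out_eq]
  change _ = Quotient.map σ hr q
  conv_rhs => rw [← Quotient.out_eq q]
  rfl

theorem cosetAvg_mul_right {F : SL(2, ℤ) → ℂ} (hF : CosetInv Γ F) (g : SL(2, ℤ)) :
    cosetAvg Γ (fun A => F (A * g)) = cosetAvg Γ F :=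
  cosetAvg_comp hF (Equiv.mulRight g) (fun A B h => by simpa [mul_assoc] using h)
    fun A B h => by simpa [mul_assoc] using h

theorem cosetAvg_mul_left (c : ℂ) (F : SL(2, ℤ) → ℂ) :
    cosetAvg Γ (fun A => c * F A) = c * cosetAvg Γ F := by
  unfold cosetAvg
  rw [← mul_finsum]
  ring

theorem cosetAvg_neg (F : SL(2, ℤ) → ℂ) :
    cosetAvg Γ (fun A => -F A) = -cosetAvg Γ F := by
  simpa using cosetAvg_mul_left (Γ := Γ) (-1) F

theorem cosetAvg_add [Γ.FiniteIndex] (F G : SL(2, ℤ) → ℂ) :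
    cosetAvg Γ (fun A => F A + G A) = cosetAvg Γ F + cosetAvg Γ G := by
  unfold cosetAvg
  rw [finsum_add_distrib (Set.toFinite _) (Set.toFinite _), mul_add]

theorem cosetAvg_sub [Γ.FiniteIndex] (F G : SL(2, ℤ) → ℂ) :
    cosetAvg Γ (fun A => F A - G A) = cosetAvg Γ F - cosetAvg Γ G := by
  simp only [sub_eq_add_neg, cosetAvg_add, cosetAvg_neg]

theorem conj_cosetAvg [Γ.FiniteIndex] (F : SL(2, ℤ) → ℂ) :
    conj (cosetAvg Γ F) = cosetAvg Γ fun A => conj (F A) := by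
  have := Fintype.ofFinite (Quotient (QuotientGroup.rightRel (projHull Γ)))
  unfold cosetAvg
  rw [finsum_eq_sum_of_fintype, finsum_eq_sum_of_fintype, map_mul, map_sum, map_inv₀,
    Complex.conj_natCast]

theorem tendsto_cosetAvg [Γ.FiniteIndex] {ι : Type*} {l : Filter ι} {F : ι → SL(2, ℤ) → ℂ} {G : SL(2, ℤ) → ℂ}
    (h : ∀ A, Tendsto (fun i => F i A) l (𝓝 (G A))) :
    Tendsto (fun i => cosetAvg Γ (F i)) l (𝓝 (cosetAvg Γ G)) := by
  have := Fintype.ofFinite (Quotient (QuotientGroup.rightRel (projHull Γ)))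
  unfold cosetAvg
  simp only [finsum_eq_sum_of_fintype]
  exact (tendsto_finsetSum _ fun q _ => h q.out).const_mul _

end Cosets

/-! ### The invariant pairing on polynomials of degree at most w -/

section PolyAction

open Polynomial

/-- `P ↦ X^w P(-1/X)` on polynomials of degree at most `w`. -/
noncomputable def polyS (w : ℕ) : ℂ[X] →ₗ[ℂ] ℂ[X] :=
  ∑ n ∈ Finset.range (w + 1), ((-1 : ℂ) ^ (w - n)) • (monomial n ∘ₗ lcoeff ℂ (w - n))

theorem polyS_apply (w : ℕ) (P : ℂ[X]) :
    polyS w P = ∑ n ∈ Finset.range (w + 1), monomial n ((-1 : ℂ) ^ (w - n) * P.coeff (w - n)) := by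
  simp [polyS, LinearMap.sum_apply, smul_monomial]

theorem coeff_polyS (w : ℕ) (P : ℂ[X]) (n : ℕ) :
    (polyS w P).coeff n = if n ≤ w then (-1 : ℂ) ^ (w - n) * P.coeff (w - n) else 0 := by
  simp [polyS_apply, coeff_monomial]

theorem natDegree_polyS (w : ℕ) (P : ℂ[X]) : (polyS w P).natDegree ≤ w := by
  rw [natDegree_le_iff_coeff_eq_zero]
  intro n hn
  rw [coeff_polyS, if_neg (not_le.mpr hn)]

theorem eval_polyS {w : ℕ} {P : ℂ[X]} (hP : P.natDegree ≤ w) {x : ℂ} (hx : x ≠ 0) :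
    (polyS w P).eval x = x ^ w * P.eval (-1 / x) := by
  rw [eval_eq_sum_range' (Nat.lt_succ_of_le hP), polyS_apply, eval_finsetSum, Finset.mul_sum,
    ← Finset.sum_range_reflect]
  refine Finset.sum_congr rfl fun n hn => ?_
  have hn' : n ≤ w := Nat.lt_succ_iff.mp (Finset.mem_range.mp hn)
  obtain ⟨m, rfl⟩ := Nat.exists_eq_add_of_le hn'
  have e1 : n + m + 1 - 1 - n = m := by omega
  have e2 : n + m - m = n := by omega
  rw [e1, e2, eval_monomial, div_pow, pow_add]
  field_simp

theorem polyS_polyS {w : ℕ} {P : ℂ[X]} (hP : P.natDegree ≤ w) :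
    polyS w (polyS w P) = (-1 : ℂ) ^ w • P := by
  ext n
  rw [coeff_polyS, coeff_smul, smul_eq_mul]
  split_ifs with h
  · rw [coeff_polyS, if_pos (Nat.sub_le _ _), Nat.sub_sub_self h, ← mul_assoc, ← pow_add,
      Nat.sub_add_cancel h]
  · rw [coeff_eq_zero_of_natDegree_lt (lt_of_le_of_lt hP (not_le.mp h)), mul_zero]

theorem polyPair_add_left (w : ℕ) (P P' Q : ℂ[X]) :
    polyPair w (P + P') Q = polyPair w P Q + polyPair w P' Q := by
  simp only [polyPair, coeff_add, ← Finset.sum_add_distrib]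
  exact Finset.sum_congr rfl fun _ _ => by ring

theorem polyPair_add_right (w : ℕ) (P Q Q' : ℂ[X]) :
    polyPair w P (Q + Q') = polyPair w P Q + polyPair w P Q' := by
  simp only [polyPair, coeff_add, ← Finset.sum_add_distrib]
  exact Finset.sum_congr rfl fun _ _ => by ring

theorem polyPair_smul_left (w : ℕ) (c : ℂ) (P Q : ℂ[X]) :
    polyPair w (c • P) Q = c * polyPair w P Q := by
  simp only [polyPair, coeff_smul, Finset.mul_sum, smul_eq_mul]
  exact Finset.sum_congr rfl fun _ _ => by ring

theorem polyPair_smul_right (w : ℕ) (c : ℂ) (P Q : ℂ[X]) :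
    polyPair w P (c • Q) = c * polyPair w P Q := by
  simp only [polyPair, coeff_smul, Finset.mul_sum, smul_eq_mul]
  exact Finset.sum_congr rfl fun _ _ => by ring

theorem polyPair_polyS (w : ℕ) (P Q : ℂ[X]) :
    polyPair w (polyS w P) (polyS w Q) = polyPair w P Q := by
  unfold polyPair
  rw [← Finset.sum_range_reflect]
  refine Finset.sum_congr rfl fun n hn => ?_
  have hn' : n ≤ w := Nat.lt_succ_iff.mp (Finset.mem_range.mp hn)
  obtain ⟨m, rfl⟩ := Nat.exists_eq_add_of_le hn'
  have e1 : n + m + 1 - 1 - n = m := by omega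
  have e2 : n + m - m = n := by omega
  have e3 : n + m - n = m := by omega
  have hc : (n + m).choose m = (n + m).choose n := by
    rw [Nat.choose_symm_of_eq_add]; omega
  have hm : (-1 : ℂ) ^ n * (-1 : ℂ) ^ n = 1 := by rw [← mul_pow]; simp
  simp only [e1, e2, e3, coeff_polyS, if_pos (Nat.le_add_left m n), if_pos (Nat.le_add_right n m),
    hc]
  linear_combination ((-1 : ℂ) ^ m * ((n + m).choose n : ℂ)⁻¹ * P.coeff n * Q.coeff m) * hm

theorem C_sub_X_pow (w : ℕ) (t : ℂ) :
    (C t - X : ℂ[X]) ^ w =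
      ∑ n ∈ Finset.range (w + 1), (t ^ (w - n)) • (((-1 : ℂ) ^ n * (w.choose n : ℂ)) • X ^ n) := by
  rw [sub_eq_add_neg, add_comm, add_pow]
  refine Finset.sum_congr rfl fun n _ => ?_
  rw [smul_smul, smul_eq_C_mul, neg_pow]
  simp only [C_mul, C_pow, C_neg, C_1, map_natCast]
  ring

theorem coeff_C_sub_X_pow (w : ℕ) (t : ℂ) {n : ℕ} (hn : n ≤ w) :
    ((C t - X : ℂ[X]) ^ w).coeff n = t ^ (w - n) * ((-1 : ℂ) ^ n * (w.choose n : ℂ)) := by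
  rw [C_sub_X_pow, finsetSum_coeff, Finset.sum_eq_single_of_mem n
    (Finset.mem_range.mpr (Nat.lt_succ_of_le hn))]
  · simp
  · intro m _ hm
    simp [coeff_X_pow, hm.symm]

/-- The reproducing property of the pairing: the binomials in (t - X)^w cancel the inverse binomials
in its definition. Translation invariance and the link with Eichler integrals both rest on it. -/
theorem polyPair_C_sub_X_pow {w : ℕ} {P : ℂ[X]} (hP : P.natDegree ≤ w) (t : ℂ) :
    polyPair w P ((C t - X) ^ w) = P.eval t := by
  rw [eval_eq_sum_range' (Nat.lt_succ_of_le hP)]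
  refine Finset.sum_congr rfl fun n hn => ?_
  have hn' : n ≤ w := Nat.lt_succ_iff.mp (Finset.mem_range.mp hn)
  have hc : (w.choose n : ℂ) ≠ 0 := Nat.cast_ne_zero.mpr (Nat.choose_pos hn').ne'
  have hm : (-1 : ℂ) ^ (w - n) * (-1 : ℂ) ^ (w - n) = 1 := by rw [← mul_pow]; simp
  rw [coeff_C_sub_X_pow w t (Nat.sub_le _ _), Nat.choose_symm hn', Nat.sub_sub_self hn']
  field_simp
  linear_combination (P.coeff n * t ^ n) * hm

theorem polyPair_sum_right {ι : Type*} (w : ℕ) (P : ℂ[X]) (u : Finset ι) (Q : ι → ℂ[X]) :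
    polyPair w P (∑ i ∈ u, Q i) = ∑ i ∈ u, polyPair w P (Q i) := by
  classical
  induction u using Finset.induction_on with
  | empty => simp [polyPair]
  | insert a u ha ih => rw [Finset.sum_insert ha, polyPair_add_right, ih, Finset.sum_insert ha]

/-- Translation carries the kernel (t - X)^w to the kernel at t - c, so the two pairings agree on
all kernels. The coefficients of powers of t then give agreement on every monomial X^n with n ≤ w.
-/
theorem polyPair_comp_X_add {w : ℕ} {P Q : ℂ[X]} (hP : P.natDegree ≤ w) (hQ : Q.natDegree ≤ w)
    (c : ℂ) : polyPair w (P.comp (X + C c)) (Q.comp (X + C c)) = polyPair w P Q := by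
  set D : ℕ → ℂ := fun j =>
    polyPair w (P.comp (X + C c)) ((X ^ j).comp (X + C c)) - polyPair w P (X ^ j) with hD
  have hP' : (P.comp (X + C c)).natDegree ≤ w := by
    rw [natDegree_comp, natDegree_X_add_C, mul_one]; exact hP
  have key : ∀ t : ℂ, ∑ n ∈ Finset.range (w + 1),
      t ^ (w - n) * ((-1 : ℂ) ^ n * (w.choose n : ℂ) * D n) = 0 := by
    intro t
    have h1 := polyPair_C_sub_X_pow hP t
    have h2 := polyPair_C_sub_X_pow hP' (t - c)
    have h3 : (C (t - c) - X : ℂ[X]) ^ w = ((C t - X) ^ w).comp (X + C c) := by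
      simp only [pow_comp, sub_comp, C_comp, X_comp, C_sub]
      ring
    have h4 : eval (t - c) (P.comp (X + C c)) = eval t P := by simp [eval_comp]
    rw [h3, h4, ← h1, C_sub_X_pow, Polynomial.sum_comp, polyPair_sum_right, polyPair_sum_right,
      ← sub_eq_zero, ← Finset.sum_sub_distrib] at h2
    rw [← h2]
    refine Finset.sum_congr rfl fun n _ => ?_
    simp only [smul_comp, polyPair_smul_right, hD]
    ring
  have hD0 : ∀ n, n ≤ w → D n = 0 := by
    -- The identity `key` holds for every t, hence as a polynomial identity in t; each coefficient
    -- is a nonzero binomial times the defect `D n`.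
    have hpoly : (∑ n ∈ Finset.range (w + 1),
        monomial (w - n) ((-1 : ℂ) ^ n * (w.choose n : ℂ) * D n)) = (0 : ℂ[X]) := by
      refine Polynomial.funext fun t => ?_
      rw [eval_finsetSum, eval_zero, ← key t]
      exact Finset.sum_congr rfl fun n _ => by rw [eval_monomial]; ring
    intro n hn
    have := congrArg (fun p => coeff p (w - n)) hpoly
    simp only [finsetSum_coeff, coeff_zero] at this
    rw [Finset.sum_eq_single_of_mem n (Finset.mem_range.mpr (Nat.lt_succ_of_le hn))] at this
    · rw [coeff_monomial, if_pos rfl] at this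
      have hc : (w.choose n : ℂ) ≠ 0 := Nat.cast_ne_zero.mpr (Nat.choose_pos hn).ne'
      simpa [hc] using this
    · intro m hm hmn
      have hm' : m ≤ w := Nat.lt_succ_iff.mp (Finset.mem_range.mp hm)
      rw [coeff_monomial, if_neg (by omega)]
  rw [Q.as_sum_range' (w + 1) (Nat.lt_succ_of_le hQ), Polynomial.sum_comp, polyPair_sum_right,
    polyPair_sum_right]
  refine Finset.sum_congr rfl fun n hn => ?_
  have := hD0 n (Nat.lt_succ_iff.mp (Finset.mem_range.mp hn))
  rw [← C_mul_X_pow_eq_monomial, ← smul_eq_C_mul, smul_comp, polyPair_smul_right,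
    polyPair_smul_right]
  rw [hD] at this
  rw [sub_eq_zero.mp this]

end PolyAction

/-! ### Group action and pairing on families of polynomials -/

noncomputable section PolyFamilies

open Polynomial

/-- Families on `Γ \ SL₂(ℤ)` of polynomials of degree at most `w`, of parity `w`. -/
def polyFam (Γ : Subgroup SL(2, ℤ)) (w : ℕ) : Submodule ℂ (SL(2, ℤ) → ℂ[X]) where
  carrier := {P | (∀ A, (P A).natDegree ≤ w) ∧ (∀ γ ∈ Γ, ∀ A, P (γ * A) = P A) ∧
    ∀ A, P (-A) = (-1 : ℂ) ^ w • P A}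
  add_mem' := by
    rintro P Q ⟨h1, h2, h3⟩ ⟨h1', h2', h3'⟩
    refine ⟨fun A => natDegree_add_le_of_degree_le (h1 A) (h1' A), fun γ hγ A => ?_, fun A => ?_⟩
    · simp only [Pi.add_apply, h2 γ hγ, h2' γ hγ]
    · simp only [Pi.add_apply, h3, h3', smul_add]
  zero_mem' := by simp
  smul_mem' := by
    rintro c P ⟨h1, h2, h3⟩
    refine ⟨fun A => (natDegree_smul_le c _).trans (h1 A), fun γ hγ A => ?_, fun A => ?_⟩
    · simp only [Pi.smul_apply, h2 γ hγ]
    · rw [Pi.smul_apply, Pi.smul_apply, h3, smul_comm]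

/-- The action of `S` on families of polynomials, in weight `-w`. -/
def famS (w : ℕ) : (SL(2, ℤ) → ℂ[X]) →ₗ[ℂ] (SL(2, ℤ) → ℂ[X]) where
  toFun P A := polyS w (P (A * ModularGroup.S⁻¹))
  map_add' P Q := by ext1 A; simp
  map_smul' c P := by ext1 A; simp

/-- The action of `Tⁿ` on families of polynomials. -/
def famT (n : ℤ) : (SL(2, ℤ) → ℂ[X]) →ₗ[ℂ] (SL(2, ℤ) → ℂ[X]) where
  toFun P := famTranslate n P
  map_add' P Q := by ext1 A; simp [famTranslate]
  map_smul' c P := by ext1 A; simp [famTranslate]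

theorem famS_apply (w : ℕ) (P : SL(2, ℤ) → ℂ[X]) (A : SL(2, ℤ)) :
    famS w P A = polyS w (P (A * ModularGroup.S⁻¹)) := rfl

theorem famT_apply (n : ℤ) (P : SL(2, ℤ) → ℂ[X]) (A : SL(2, ℤ)) :
    famT n P A = (P (A * ModularGroup.T ^ (-n))).comp (X + C (n : ℂ)) := rfl

variable {Γ : Subgroup SL(2, ℤ)} {w : ℕ}

theorem famS_mem {P : SL(2, ℤ) → ℂ[X]} (hP : P ∈ polyFam Γ w) : famS w P ∈ polyFam Γ w := by
  obtain ⟨h1, h2, h3⟩ := hP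
  refine ⟨fun A => natDegree_polyS w _, fun γ hγ A => ?_, fun A => ?_⟩
  · rw [famS_apply, famS_apply, mul_assoc, h2 γ hγ]
  · rw [famS_apply, famS_apply, neg_mul, h3, map_smul]

theorem natDegree_comp_X_add_C_le {P : ℂ[X]} {n : ℕ} (hP : P.natDegree ≤ n) (c : ℂ) :
    (P.comp (X + C c)).natDegree ≤ n := by
  rw [natDegree_comp, natDegree_X_add_C, mul_one]; exact hP

theorem famT_mem (n : ℤ) {P : SL(2, ℤ) → ℂ[X]} (hP : P ∈ polyFam Γ w) :
    famT n P ∈ polyFam Γ w := by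
  obtain ⟨h1, h2, h3⟩ := hP
  refine ⟨fun A => natDegree_comp_X_add_C_le (h1 _) _, fun γ hγ A => ?_, fun A => ?_⟩
  · rw [famT_apply, famT_apply, mul_assoc, h2 γ hγ]
  · rw [famT_apply, famT_apply, neg_mul, h3, smul_comp]

/-- As S² = -1, the parity of the family cancels the sign (-1)^w that the polynomial operation picks
up when applied twice. -/
theorem famS_famS {P : SL(2, ℤ) → ℂ[X]} (hP : P ∈ polyFam Γ w) : famS w (famS w P) = P := by
  obtain ⟨h1, h2, h3⟩ := hP
  ext1 A
  have hS : A * ModularGroup.S⁻¹ * ModularGroup.S⁻¹ = -A := by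
    have : ModularGroup.S⁻¹ * ModularGroup.S⁻¹ = (-1 : SL(2, ℤ)) := by decide
    rw [mul_assoc, this, mul_neg, mul_one]
  rw [famS_apply, famS_apply, polyS_polyS (h1 _), hS, h3, smul_smul, ← mul_pow]
  simp

theorem famT_famT_neg (n : ℤ) (P : SL(2, ℤ) → ℂ[X]) : famT n (famT (-n) P) = P := by
  ext1 A
  rw [famT_apply, famT_apply, mul_assoc, ← zpow_add, comp_assoc]
  simp

/-- This is S T S = T⁻¹ S T⁻¹ in SL₂(ℤ). The rational substitutions make sense for x different from
0 and 1, which is enough for polynomials. -/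
theorem famT_famS_famT {P : SL(2, ℤ) → ℂ[X]} (hP : P ∈ polyFam Γ w) :
    famS w (famT 1 (famS w P)) = famT (-1) (famS w (famT (-1) P)) := by
  obtain ⟨h1, -, -⟩ := hP
  ext1 A
  refine Polynomial.eq_of_infinite_eval_eq _ _ (Set.Infinite.mono (s := {x : ℂ | x ≠ 0 ∧ x ≠ 1})
    ?_ (Set.Infinite.mono (s := (({0, 1} : Finset ℂ) : Set ℂ)ᶜ) ?_
      (Finset.finite_toSet _).infinite_compl))
  · rintro x ⟨hx0, hx1⟩
    have hx1' : x - 1 ≠ 0 := sub_ne_zero.mpr hx1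
    have hm : A * ModularGroup.S⁻¹ * ModularGroup.T ^ (-1 : ℤ) * ModularGroup.S⁻¹ =
        A * ModularGroup.T ^ (- -1 : ℤ) * ModularGroup.S⁻¹ * ModularGroup.T ^ (- -1 : ℤ) := by
      have : ModularGroup.S⁻¹ * ModularGroup.T ^ (-1 : ℤ) * ModularGroup.S⁻¹ =
        ModularGroup.T ^ (- -1 : ℤ) * ModularGroup.S⁻¹ * ModularGroup.T ^ (- -1 : ℤ) := by decide
      simpa [mul_assoc] using congrArg (A * ·) this
    have hx2 : -1 / x + 1 ≠ 0 := by
      rw [neg_div, neg_add_eq_sub, one_sub_div hx0]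
      exact div_ne_zero hx1' hx0
    simp only [Set.mem_ofPred_eq, famS_apply, famT_apply]
    rw [eval_polyS (natDegree_comp_X_add_C_le (natDegree_polyS _ _) _) hx0, eval_comp, eval_comp]
    simp only [eval_add, eval_X, eval_C, Int.cast_one, Int.cast_neg]
    rw [eval_polyS (h1 _) hx2, ← sub_eq_add_neg, eval_polyS (natDegree_comp_X_add_C_le (h1 _) _)
      hx1', eval_comp, ← mul_assoc, ← mul_pow, hm]
    congr 1
    · congr 1
      field_simp
      ring
    · simp only [eval_add, eval_X, eval_C]
      congr 1
      have hx3 : -1 / x + 1 = (x - 1) / x := by field_simp; ring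
      rw [hx3]
      field_simp
      ring
  · intro x hx
    simpa using hx

/-- The pairing of families as a bilinear map. -/
def famBilin (Γ : Subgroup SL(2, ℤ)) [Γ.FiniteIndex] (w : ℕ) :
    (SL(2, ℤ) → ℂ[X]) →ₗ[ℂ] (SL(2, ℤ) → ℂ[X]) →ₗ[ℂ] ℂ :=
  LinearMap.mk₂ ℂ (famPair Γ w)
    (fun P P' Q => by
      simp only [famPair, Pi.add_apply, polyPair_add_left, cosetAvg_add])
    (fun c P Q => by
      simp only [famPair, Pi.smul_apply, polyPair_smul_left, cosetAvg_mul_left, smul_eq_mul])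
    (fun P Q Q' => by
      simp only [famPair, Pi.add_apply, polyPair_add_right, cosetAvg_add])
    (fun c P Q => by
      simp only [famPair, Pi.smul_apply, polyPair_smul_right, cosetAvg_mul_left, smul_eq_mul])

theorem cosetInv_polyPair {P Q : SL(2, ℤ) → ℂ[X]} (hP : P ∈ polyFam Γ w)
    (hQ : Q ∈ polyFam Γ w) : CosetInv Γ fun A => polyPair w (P A) (Q A) := by
  refine ⟨fun γ hγ A => ?_, fun A => ?_⟩
  · simp only [hP.2.1 γ hγ, hQ.2.1 γ hγ]
  · simp only [hP.2.2, hQ.2.2, polyPair_smul_left, polyPair_smul_right, ← mul_assoc, ← mul_pow]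
    simp

theorem famPair_famS {P Q : SL(2, ℤ) → ℂ[X]} (hP : P ∈ polyFam Γ w) (hQ : Q ∈ polyFam Γ w) :
    famPair Γ w (famS w P) (famS w Q) = famPair Γ w P Q := by
  simp only [famPair, famS_apply, polyPair_polyS]
  exact cosetAvg_mul_right (cosetInv_polyPair hP hQ) _

theorem famPair_famT (n : ℤ) {P Q : SL(2, ℤ) → ℂ[X]} (hP : P ∈ polyFam Γ w)
    (hQ : Q ∈ polyFam Γ w) :
    famPair Γ w (famT n P) (famT n Q) = famPair Γ w P Q := by
  simp only [famPair, famT_apply]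
  rw [← cosetAvg_mul_right (cosetInv_polyPair hP hQ) (ModularGroup.T ^ (-n))]
  congr 1
  ext1 A
  exact polyPair_comp_X_add (hP.1 _) (hQ.1 _) _

/-- The operators satisfy the group relations only under the degree and parity conditions, so the
abstract identity is applied on the submodule `polyFam`. -/
theorem famPair_identity [Γ.FiniteIndex] {P N β Q N' g : SL(2, ℤ) → ℂ[X]}
    (mP : P ∈ polyFam Γ w) (mN : N ∈ polyFam Γ w) (mβ : β ∈ polyFam Γ w)
    (mQ : Q ∈ polyFam Γ w) (mN' : N' ∈ polyFam Γ w) (mg : g ∈ polyFam Γ w)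
    (hP : famS w P = -P) (hβ : famS w β = famT 1 β + P + N)
    (hQ : famS w Q = -Q) (hg : famS w g = famT 1 g + Q + N')
    (hNN : famPair Γ w N (famT 1 (famS w N')) = famPair Γ w N (famS w (famT (-1) N'))) :
    -6 * famPair Γ w P g - 3 * famPair Γ w P Q + 6 * famPair Γ w N (famT 1 g)
        + 3 * famPair Γ w N N' =
      famPair Γ w (famT 1 P - famT (-1) P) Q - 2 * famPair Γ w (N + famT (-1) N) Q +
        2 * famPair Γ w P (N' + famT (-1) N') := by
  let s := (famS w).restrict (p := polyFam Γ w) (q := polyFam Γ w) fun _ h => famS_mem h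
  let t := (famT 1).restrict (p := polyFam Γ w) (q := polyFam Γ w) fun _ h => famT_mem _ h
  let t' := (famT (-1)).restrict (p := polyFam Γ w) (q := polyFam Γ w) fun _ h => famT_mem _ h
  let B := (famBilin Γ w).domRestrict₁₂ (polyFam Γ w) (polyFam Γ w)
  refine haberland_algebra B s t t' (fun x => Subtype.ext (famS_famS x.2))
    (fun x => Subtype.ext (famT_famT_neg 1 _))
    (fun x => Subtype.ext (famT_famT_neg (-1) x.1))
    (fun x => Subtype.ext (famT_famS_famT x.2)) (fun x y => famPair_famS x.2 y.2)
    (fun x y => famPair_famT 1 x.2 y.2) (P := ⟨P, mP⟩) (N := ⟨N, mN⟩) (β := ⟨β, mβ⟩)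
    (Q := ⟨Q, mQ⟩) (N' := ⟨N', mN'⟩) (g := ⟨g, mg⟩)
    (Subtype.ext hP) (Subtype.ext hβ) (Subtype.ext hQ) (Subtype.ext hg) hNN

/-- The polynomial `(X + 1)^{w+1} - X^{w+1}`. -/
def diffPoly (w : ℕ) : ℂ[X] := (X + C 1) ^ (w + 1) - X ^ (w + 1)

theorem coeff_diffPoly (n : ℕ) :
    (diffPoly w).coeff n = if n ≤ w then ((w + 1).choose n : ℂ) else 0 := by
  rw [diffPoly, coeff_sub, coeff_X_add_C_pow, coeff_X_pow, one_pow, one_mul]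
  split_ifs with h1 h2 h2
  · omega
  · subst h1; simp
  · simp
  · rw [Nat.choose_eq_zero_of_lt (by omega)]; simp

theorem natDegree_diffPoly : (diffPoly w).natDegree ≤ w := by
  rw [natDegree_le_iff_coeff_eq_zero]
  intro n hn
  rw [coeff_diffPoly, if_neg (not_le.mpr hn)]

/-- The product of the two coefficients divided by binom(w, n) is (w+1)/(w+2) times binom(w+2, n+1).
What remains is the alternating binomial sum of order w + 2 without its two end terms. This number
is the source of I_k. -/
theorem polyPair_diffPoly :
    polyPair w (diffPoly w) (diffPoly w) =
      ((w : ℂ) + 1) / (w + 2) * ((-1 : ℂ) ^ w + 1) := by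
  have h2 : (w : ℂ) + 2 ≠ 0 := by exact_mod_cast (Nat.succ_ne_zero (w + 1))
  have key : ∀ n ∈ Finset.range (w + 1),
      (-1 : ℂ) ^ (w - n) * ((w.choose n : ℂ))⁻¹ * (diffPoly w).coeff n *
        (diffPoly w).coeff (w - n) =
      -((w : ℂ) + 1) / (w + 2) * (-1) ^ w * ((-1 : ℂ) ^ (n + 1) * ((w + 2).choose (n + 1) : ℂ)) := by
    intro n hn
    have hn' : n ≤ w := Nat.lt_succ_iff.mp (Finset.mem_range.mp hn)
    rw [coeff_diffPoly, coeff_diffPoly, if_pos hn', if_pos (Nat.sub_le _ _)]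
    have hc : (w.choose n : ℂ) ≠ 0 := Nat.cast_ne_zero.mpr (Nat.choose_pos hn').ne'
    have e0 : (w + 1).choose (w - n) = (w + 1).choose (n + 1) := by
      rw [Nat.choose_symm_of_eq_add]; omega
    have e1 : ((w : ℂ) + 1) * w.choose n = (w + 1).choose (n + 1) * ((n : ℂ) + 1) := by
      exact_mod_cast Nat.add_one_mul_choose_eq w n
    have e2 : ((w : ℂ) + 2) * (w + 1).choose n = (w + 2).choose (n + 1) * ((n : ℂ) + 1) := by
      have := Nat.add_one_mul_choose_eq (w + 1) n
      push_cast [← Nat.cast_inj (R := ℂ)] at this ⊢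
      linear_combination this
    have hn1 : (n : ℂ) + 1 ≠ 0 := by exact_mod_cast Nat.succ_ne_zero n
    have e3 : (-1 : ℂ) ^ (w - n) = (-1) ^ w * (-1) ^ n := by
      obtain ⟨m, rfl⟩ := Nat.exists_eq_add_of_le hn'
      have hm : (-1 : ℂ) ^ n * (-1 : ℂ) ^ n = 1 := by rw [← mul_pow]; simp
      rw [Nat.add_sub_cancel_left, pow_add]
      linear_combination -((-1 : ℂ) ^ m) * hm
    rw [e0, e3, pow_succ]
    field_simp
    apply mul_right_cancel₀ hn1
    linear_combination (-(((w + 1).choose n : ℂ)) * (w + 2)) * e1 + (((w : ℂ) + 1) * w.choose n) * e2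
  rw [polyPair, Finset.sum_congr rfl key, ← Finset.mul_sum]
  have h0 : ∑ m ∈ Finset.range (w + 2 + 1), (-1 : ℂ) ^ m * ((w + 2).choose m : ℂ) = 0 := by
    have := Int.alternating_sum_range_choose_of_ne (n := w + 2) (by omega)
    exact_mod_cast this
  rw [Finset.sum_range_succ, Finset.sum_range_succ'] at h0
  have hm : (-1 : ℂ) ^ w * (-1 : ℂ) ^ w = 1 := by rw [← mul_pow]; simp
  have h1 : ∑ m ∈ Finset.range (w + 1), (-1 : ℂ) ^ (m + 1) * ((w + 2).choose (m + 1) : ℂ) =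
      -1 - (-1) ^ w := by
    simp only [Nat.choose_zero_right, Nat.choose_self, pow_zero] at h0
    push_cast at h0
    linear_combination h0
  rw [h1]
  linear_combination (((w : ℂ) + 1) / (w + 2)) * hm

theorem comp_neg_X_coeff (P : ℂ[X]) (n : ℕ) :
    (P.comp (-X)).coeff n = (-1) ^ n * P.coeff n := by
  have : (-X : ℂ[X]) = C (-1) * X := by simp
  rw [this, comp_C_mul_X_coeff, mul_comm]

theorem polyPair_neg_X (P Q : ℂ[X]) :
    polyPair w (P.comp (-X)) (Q.comp (-X)) = (-1) ^ w * polyPair w P Q := by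
  simp only [polyPair, Finset.mul_sum, comp_neg_X_coeff]
  refine Finset.sum_congr rfl fun n hn => ?_
  have hn' : n ≤ w := Nat.lt_succ_iff.mp (Finset.mem_range.mp hn)
  obtain ⟨m, rfl⟩ := Nat.exists_eq_add_of_le hn'
  rw [Nat.add_sub_cancel_left, pow_add]
  ring

theorem polyS_comp_neg_X (P : ℂ[X]) :
    polyS w (P.comp (-X)) = (-1 : ℂ) ^ w • (polyS w P).comp (-X) := by
  ext n
  rw [coeff_smul, comp_neg_X_coeff, coeff_polyS, coeff_polyS]
  split_ifs with h
  · obtain ⟨m, rfl⟩ := Nat.exists_eq_add_of_le h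
    have hm : (-1 : ℂ) ^ n * (-1 : ℂ) ^ n = 1 := by rw [← mul_pow]; simp
    rw [comp_neg_X_coeff, Nat.add_sub_cancel_left, pow_add, smul_eq_mul]
    linear_combination (-(-1 : ℂ) ^ m * (-1) ^ m * P.coeff m) * hm
  · simp

theorem diffPoly_comp_sub_one :
    (diffPoly w).comp (X + C (-1)) = (-1 : ℂ) ^ w • (diffPoly w).comp (-X) := by
  have h : (-X + C 1 : ℂ[X]) = -(X + C (-1)) := by simp only [C_neg]; ring
  have hm : (-1 : ℂ[X]) ^ w * (-1 : ℂ[X]) ^ w = 1 := by rw [← mul_pow]; simp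
  simp only [diffPoly, sub_comp, pow_comp, add_comp, X_comp, C_comp, smul_eq_C_mul, h]
  simp only [C_pow, C_neg, C_1]
  rw [neg_pow (X + -1 : ℂ[X]), neg_pow (X : ℂ[X]), pow_succ (-1 : ℂ[X])]
  linear_combination (-X ^ (w + 1) + (X + -1) ^ (w + 1)) * hm

/-- Shifting the difference polynomial by -1 equals (-1)^w times its reflection X ↦ -X. Moving the
translation to the left factor and reflecting both factors exchanges the two sides. -/
theorem polyPair_diffPoly_swap :
    polyPair w (diffPoly w) ((polyS w (diffPoly w)).comp (X + C 1)) =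
      polyPair w (diffPoly w) (polyS w ((diffPoly w).comp (X + C (-1)))) := by
  rw [← polyPair_comp_X_add (natDegree_diffPoly (w := w))
    (natDegree_comp_X_add_C_le (natDegree_polyS _ _) _) (-1), comp_assoc, diffPoly_comp_sub_one,
    map_smul, polyS_comp_neg_X, polyPair_smul_left, polyPair_smul_right, polyPair_smul_right,
    ← polyPair_neg_X, comp_assoc]
  simp [← mul_assoc, ← mul_pow]

/-- The coefficients of the components `c_A X^{w+1}` of an extended period polynomial: functions on
`Γ \ SL₂(ℤ) / ⟨T⟩` of parity `w`. -/
structure IsTopCoeff (Γ : Subgroup SL(2, ℤ)) (w : ℕ) (c : SL(2, ℤ) → ℂ) : Prop where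
  inv : ∀ γ ∈ Γ, ∀ A, c (γ * A) = c A
  neg : ∀ A, c (-A) = (-1) ^ w * c A
  mul_T : ∀ A, c (A * ModularGroup.T) = c A

theorem IsTopCoeff.mul_T_inv {c : SL(2, ℤ) → ℂ} (hc : IsTopCoeff Γ w c) (A : SL(2, ℤ)) :
    c (A * ModularGroup.T⁻¹) = c A := by
  rw [← hc.mul_T (A * _), inv_mul_cancel_right]

/-- The family `c_A X^{w+1} | (1 - T)`. -/
def diffFam (w : ℕ) (c : SL(2, ℤ) → ℂ) : SL(2, ℤ) → ℂ[X] := fun A => -c A • diffPoly w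

theorem diffFam_mem {c : SL(2, ℤ) → ℂ} (hc : IsTopCoeff Γ w c) : diffFam w c ∈ polyFam Γ w := by
  refine ⟨fun A => (natDegree_smul_le _ _).trans natDegree_diffPoly, fun γ hγ A => ?_, fun A => ?_⟩
  · simp only [diffFam, hc.inv γ hγ]
  · simp only [diffFam, hc.neg, smul_smul, mul_neg]

theorem famPair_diffFam {c c' : SL(2, ℤ) → ℂ} :
    famPair Γ w (diffFam w c) (diffFam w c') =
      ((w : ℂ) + 1) / (w + 2) * ((-1 : ℂ) ^ w + 1) * cosetAvg Γ fun A => c A * c' A := by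
  rw [famPair, ← cosetAvg_mul_left]
  congr 1
  ext1 A
  rw [diffFam, diffFam, polyPair_smul_left, polyPair_smul_right, polyPair_diffPoly]
  ring

/-- Supplies the hypothesis `hNN` of the algebraic identity. As the coefficients are T-invariant,
replacing A by A T in the average lines up the cosets, and the polynomial symmetry applies termwise.
-/
theorem famPair_diffFam_swap {c c' : SL(2, ℤ) → ℂ}
    (hc : IsTopCoeff Γ w c) (hc' : IsTopCoeff Γ w c') :
    famPair Γ w (diffFam w c) (famT 1 (famS w (diffFam w c'))) =
      famPair Γ w (diffFam w c) (famS w (famT (-1) (diffFam w c'))) := by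
  have hinv : CosetInv Γ fun A => polyPair w (diffFam w c A) (famT 1 (famS w (diffFam w c')) A) :=
    cosetInv_polyPair (diffFam_mem hc) (famT_mem _ (famS_mem (diffFam_mem hc')))
  -- On the left the coset argument is A T⁻¹ S⁻¹ and on the right A S⁻¹ T; after this shift,
  -- T-invariance makes the coefficients equal.
  rw [famPair, famPair, ← cosetAvg_mul_right hinv ModularGroup.T]
  congr 1
  ext1 A
  have h1 : A * ModularGroup.T * ModularGroup.T ^ (-1 : ℤ) = A := by simp
  have h2 : A * ModularGroup.S⁻¹ * ModularGroup.T ^ (- -1 : ℤ) =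
    A * ModularGroup.S⁻¹ * ModularGroup.T := by simp
  simp only [famS_apply, famT_apply, diffFam, h1, h2, hc.mul_T, hc'.mul_T, map_smul, smul_comp,
    polyPair_smul_left, polyPair_smul_right]
  have := polyPair_diffPoly_swap (w := w)
  simp only [Int.cast_one, Int.cast_neg] at this ⊢
  rw [this]

end PolyFamilies

/-! ### Primitives on the upper half plane, decay at i∞, and arc integrals -/

noncomputable section UpperHalfPlaneAnalysis


/-- The upper half plane as a subset of `ℂ`. -/
def upperHalf : Set ℂ := {z | 0 < z.im}

theorem isOpen_upperHalf : IsOpen upperHalf := isOpen_lt continuous_const Complex.continuous_im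

theorem convex_upperHalf : Convex ℝ upperHalf := convex_halfSpace_im_gt 0

theorem I_mem_upperHalf : Complex.I ∈ upperHalf := by simp [upperHalf]

theorem ne_zero_of_mem_upperHalf {z : ℂ} (hz : z ∈ upperHalf) : z ≠ 0 := by
  rintro rfl
  simp [upperHalf] at hz

theorem add_mul_I_mem_upperHalf {z : ℂ} (hz : z ∈ upperHalf) {s : ℝ} (hs : 0 ≤ s) :
    z + s * Complex.I ∈ upperHalf := by
  simp only [upperHalf, Set.mem_ofPred_eq, Complex.add_im, Complex.mul_im, Complex.ofReal_re, Complex.I_im, Complex.ofReal_im, Complex.I_re] at hz ⊢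
  linarith

theorem add_one_mem_upperHalf {z : ℂ} (hz : z ∈ upperHalf) : z + 1 ∈ upperHalf := by
  simpa [upperHalf] using hz

theorem neg_one_div_mem_upperHalf {z : ℂ} (hz : z ∈ upperHalf) : -1 / z ∈ upperHalf := by
  have h0 := ne_zero_of_mem_upperHalf hz
  have h1 : 0 < Complex.normSq z := Complex.normSq_pos.mpr h0
  have h2 : (-1 / z).im = z.im / Complex.normSq z := by
    rw [neg_div, Complex.neg_im, one_div, Complex.inv_im]; ring
  simp only [upperHalf, Set.mem_ofPred_eq, h2] at hz ⊢
  positivity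

/-- The Cayley transform u ↦ i(1 + u)/(1 - u) pulls h dz back to a holomorphic form on the unit
disc, where primitives exist. A primitive there is composed with the inverse transform. -/
theorem exists_primitive {h : ℂ → ℂ} (hh : DifferentiableOn ℂ h upperHalf) :
    ∃ K : ℂ → ℂ, ∀ z ∈ upperHalf, HasDerivAt K (h z) z := by
  have hne : ∀ u ∈ Metric.ball (0 : ℂ) 1, 1 - u ≠ 0 := by
    intro u hu h0
    rw [mem_ball_zero_iff, ← sub_eq_zero.mp h0] at hu
    simp at hu
  have hmem : ∀ u ∈ Metric.ball (0 : ℂ) 1, Complex.I * (1 + u) / (1 - u) ∈ upperHalf := by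
    intro u hu
    have h0 := hne u hu
    have h1 : 0 < Complex.normSq (1 - u) := Complex.normSq_pos.mpr h0
    have h2 : Complex.normSq u < 1 := by
      rw [mem_ball_zero_iff] at hu
      rw [Complex.normSq_eq_norm_sq]
      have := norm_nonneg u
      nlinarith
    have h3 : (Complex.I * (1 + u) / (1 - u)).im = (1 - Complex.normSq u) / Complex.normSq (1 - u) := by
      rw [Complex.div_im]
      simp only [Complex.mul_im, Complex.mul_re, Complex.I_re, Complex.I_im, Complex.add_re, Complex.add_im, Complex.one_re, Complex.one_im, Complex.sub_re, Complex.sub_im,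
        Complex.normSq_apply]
      ring
    simp only [upperHalf, Set.mem_ofPred_eq, h3]
    exact div_pos (by linarith) h1
  have hd : DifferentiableOn ℂ (fun u => h (Complex.I * (1 + u) / (1 - u)) * (2 * Complex.I / (1 - u) ^ 2))
      (Metric.ball 0 1) := by
    refine DifferentiableOn.mul (hh.comp ?_ hmem) ?_
    · exact DifferentiableOn.div (by fun_prop) (by fun_prop) hne
    · exact DifferentiableOn.div (by fun_prop) (by fun_prop) fun u hu => pow_ne_zero 2 (hne u hu)
  obtain ⟨K, hK⟩ := hd.isExactOn_ball
  refine ⟨fun z => K ((z - Complex.I) / (z + Complex.I)), fun z hz => ?_⟩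
  have hzI : z + Complex.I ≠ 0 := by
    intro h0
    have := congrArg Complex.im h0
    simp only [upperHalf, Set.mem_ofPred_eq] at hz
    simp at this
    linarith
  have hu : (z - Complex.I) / (z + Complex.I) ∈ Metric.ball (0 : ℂ) 1 := by
    rw [mem_ball_zero_iff, norm_div, div_lt_one (norm_pos_iff.mpr hzI), ← sq_lt_sq₀
      (norm_nonneg _) (norm_nonneg _), ← Complex.normSq_eq_norm_sq, ← Complex.normSq_eq_norm_sq]
    simp only [upperHalf, Set.mem_ofPred_eq] at hz
    simp only [Complex.normSq_apply, Complex.sub_re, Complex.sub_im, Complex.add_re, Complex.add_im, Complex.I_re, Complex.I_im]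
    nlinarith
  have e1 : 1 - (z - Complex.I) / (z + Complex.I) = 2 * Complex.I / (z + Complex.I) := by field_simp; ring
  have e2 : Complex.I * (1 + (z - Complex.I) / (z + Complex.I)) / (2 * Complex.I / (z + Complex.I)) = z := by
    have := Complex.I_ne_zero
    field_simp
    ring
  have h1 := hK _ hu
  have h2 : HasDerivAt (fun z : ℂ => (z - Complex.I) / (z + Complex.I)) (2 * Complex.I / (z + Complex.I) ^ 2) z := by
    have := ((hasDerivAt_id z).sub_const Complex.I).div ((hasDerivAt_id z).add_const Complex.I) hzI
    refine this.congr_deriv ?_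
    simp only [id]
    congr 1
    ring
  have := h1.comp z h2
  refine this.congr_deriv ?_
  simp only
  rw [e1, e2]
  have hI := Complex.I_ne_zero
  field_simp

/-- Exponential decay at `i∞`, on vertical strips. -/
def ExpDecay (h : ℂ → ℂ) : Prop :=
  ∀ M : ℝ, ∃ c > 0, ∃ C ≥ 0, ∃ B ≥ 1, ∀ z : ℂ, |z.re| ≤ M → B ≤ z.im →
    ‖h z‖ ≤ C * Real.exp (-c * z.im)

/-- On a vertical strip |z| grows linearly in the height, which half of the exponential rate
absorbs. -/
theorem ExpDecay.mul_id {h : ℂ → ℂ} (hh : ExpDecay h) : ExpDecay fun z => h z * z := by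
  intro M
  obtain ⟨c, hc, C, hC, B, hB, hb⟩ := hh |M|
  refine ⟨c / 2, by positivity, C * (|M| + 2 / c), by positivity, B, hB, fun z hz hBz => ?_⟩
  have h1 := hb z (hz.trans (le_abs_self M)) hBz
  have hy : 0 ≤ z.im := by linarith
  have h2 : ‖z‖ ≤ |M| + z.im := by
    refine (Complex.norm_le_abs_re_add_abs_im z).trans ?_
    rw [abs_of_nonneg hy]
    linarith [le_abs_self M]
  have h3 : z.im ≤ 2 / c * Real.exp (c / 2 * z.im) := by
    have := Real.add_one_le_exp (c / 2 * z.im)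
    have h4 : z.im = 2 / c * (c / 2 * z.im) := by field_simp
    calc z.im = 2 / c * (c / 2 * z.im) := h4
      _ ≤ _ := by gcongr; linarith
  have h4 : (1 : ℝ) ≤ Real.exp (c / 2 * z.im) := Real.one_le_exp (by positivity)
  have h5 : Real.exp (-c * z.im) * Real.exp (c / 2 * z.im) = Real.exp (-(c / 2) * z.im) := by
    rw [← Real.exp_add]; ring_nf
  rw [norm_mul]
  calc ‖h z‖ * ‖z‖ ≤ (C * Real.exp (-c * z.im)) * (|M| + z.im) := by gcongr
    _ ≤ (C * Real.exp (-c * z.im)) *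
        (|M| * Real.exp (c / 2 * z.im) + 2 / c * Real.exp (c / 2 * z.im)) := by
      gcongr
      nlinarith [abs_nonneg M]
    _ = _ := by rw [← h5]; ring

theorem ExpDecay.mul_pow {h : ℂ → ℂ} (hh : ExpDecay h) (n : ℕ) :
    ExpDecay fun z => h z * z ^ n := by
  induction n with
  | zero => simpa using hh
  | succ n ih => simpa [pow_succ, mul_assoc] using ih.mul_id

theorem ExpDecay.add {h₁ h₂ : ℂ → ℂ} (hh₁ : ExpDecay h₁) (hh₂ : ExpDecay h₂) :
    ExpDecay fun z => h₁ z + h₂ z := by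
  intro M
  obtain ⟨c, hc, C, hC, B, hB, hb⟩ := hh₁ M
  obtain ⟨c', hc', C', hC', B', hB', hb'⟩ := hh₂ M
  refine ⟨min c c', lt_min hc hc', C + C', by positivity, max B B', le_max_of_le_left hB,
    fun z hz hBz => ?_⟩
  have hy : 0 ≤ z.im := by linarith [le_max_left B B']
  have h1 := hb z hz ((le_max_left _ _).trans hBz)
  have h2 := hb' z hz ((le_max_right _ _).trans hBz)
  have h3 : Real.exp (-c * z.im) ≤ Real.exp (-(min c c') * z.im) :=
    Real.exp_le_exp.mpr (by nlinarith [min_le_left c c'])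
  have h4 : Real.exp (-c' * z.im) ≤ Real.exp (-(min c c') * z.im) :=
    Real.exp_le_exp.mpr (by nlinarith [min_le_right c c'])
  calc ‖h₁ z + h₂ z‖ ≤ ‖h₁ z‖ + ‖h₂ z‖ := norm_add_le _ _
    _ ≤ C * Real.exp (-c * z.im) + C' * Real.exp (-c' * z.im) := add_le_add h1 h2
    _ ≤ C * Real.exp (-(min c c') * z.im) + C' * Real.exp (-(min c c') * z.im) := by gcongr
    _ = _ := by ring

theorem ExpDecay.const_mul {h : ℂ → ℂ} (hh : ExpDecay h) (a : ℂ) : ExpDecay fun z => a * h z := by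
  intro M
  obtain ⟨c, hc, C, hC, B, hB, hb⟩ := hh M
  refine ⟨c, hc, ‖a‖ * C, by positivity, B, hB, fun z hz hBz => ?_⟩
  rw [norm_mul, mul_assoc]
  gcongr
  exact hb z hz hBz

theorem ExpDecay.tendsto {h : ℂ → ℂ} (hh : ExpDecay h) (x : ℝ) :
    Tendsto (fun y : ℝ => h (x + y * Complex.I)) atTop (𝓝 0) := by
  obtain ⟨c, hc, C, hC, B, hB, hb⟩ := hh |x|
  refine squeeze_zero_norm' (a := fun y : ℝ => C * Real.exp (-c * y)) ?_ ?_
  · filter_upwards [eventually_ge_atTop B] with y hy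
    simpa using hb (x + y * Complex.I) (by simp) (by simpa using hy)
  · have : Tendsto (fun y : ℝ => Real.exp (-c * y)) atTop (𝓝 0) :=
      Real.tendsto_exp_atBot.comp (tendsto_id.const_mul_atTop_of_neg (neg_lt_zero.mpr hc))
    simpa using this.const_mul C

theorem continuousOn_vertical {h : ℂ → ℂ} (hh : ContinuousOn h upperHalf) {z : ℂ}
    (hz : z ∈ upperHalf) : ContinuousOn (fun s : ℝ => h (z + s * Complex.I)) (Set.Ici 0) :=
  hh.comp (by fun_prop) fun _ hs => add_mul_I_mem_upperHalf hz hs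

theorem integrableOn_vertical {h : ℂ → ℂ} (hh : ContinuousOn h upperHalf) (hd : ExpDecay h) {z : ℂ}
    (hz : z ∈ upperHalf) : IntegrableOn (fun s : ℝ => h (z + s * Complex.I)) (Set.Ioi 0) := by
  obtain ⟨c, hc, C, hC, B, hB, hb⟩ := hd |z.re|
  have hcont := continuousOn_vertical hh hz
  refine (integrable_norm_iff ?_).mp ?_
  · exact (hcont.mono Set.Ioi_subset_Ici_self).aestronglyMeasurable measurableSet_Ioi
  · refine integrable_of_isBigO_exp_neg hc hcont.norm ?_
    refine Asymptotics.IsBigO.of_bound C ?_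
    filter_upwards [eventually_ge_atTop B] with s hs
    have hz' : 0 < z.im := hz
    have h1 := hb (z + s * Complex.I) (by simp) (by simp; linarith)
    rw [norm_norm, Real.norm_of_nonneg (Real.exp_pos _).le]
    refine h1.trans ?_
    have h2 : (z + s * Complex.I).im = z.im + s := by simp
    rw [h2]
    gcongr C * Real.exp ?_
    nlinarith

/-- The primitive `-∫_z^{i∞} h(t) dt` of `h`. -/
def vInt (h : ℂ → ℂ) (z : ℂ) : ℂ := -∫ s : ℝ in Set.Ioi 0, h (z + s * Complex.I) * Complex.I

theorem vInt_expDecay {h : ℂ → ℂ} (hd : ExpDecay h) : ExpDecay (vInt h) := by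
  intro M
  obtain ⟨c, hc, C, hC, B, hB, hb⟩ := hd M
  refine ⟨c, hc, C / c, by positivity, B, hB, fun z hz hBz => ?_⟩
  rw [vInt, norm_neg]
  have hint : IntegrableOn (fun s : ℝ => C * Real.exp (-c * z.im) * Real.exp (-c * s))
      (Set.Ioi 0) volume := (integrableOn_exp_mul_Ioi (neg_lt_zero.mpr hc) 0).const_mul _
  have h1 : ∀ᵐ s : ℝ ∂volume.restrict (Set.Ioi 0), ‖h (z + s * Complex.I) * Complex.I‖ ≤
      C * Real.exp (-c * z.im) * Real.exp (-c * s) := by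
    refine (ae_restrict_iff' measurableSet_Ioi).mpr (Eventually.of_forall fun s hs => ?_)
    have hs' : (0 : ℝ) < s := hs
    have := hb (z + s * Complex.I) (by simpa using hz) (by simp; linarith)
    rw [norm_mul, Complex.norm_I, mul_one, mul_assoc, ← Real.exp_add]
    refine this.trans (le_of_eq ?_)
    simp only [Complex.add_im, Complex.mul_im, Complex.ofReal_re, Complex.I_im, Complex.ofReal_im, Complex.I_re]
    ring_nf
  refine (norm_integral_le_of_norm_le hint h1).trans (le_of_eq ?_)
  rw [integral_const_mul, integral_exp_mul_Ioi (neg_lt_zero.mpr hc)]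
  simp
  field_simp

/-- Any primitive K has a limit along each vertical line, by the fundamental theorem of calculus,
and this limit does not depend on the line. So the improper integral differs from K by a constant.
-/
theorem hasDerivAt_vInt {h : ℂ → ℂ} (hh : DifferentiableOn ℂ h upperHalf) (hd : ExpDecay h) {z : ℂ}
    (hz : z ∈ upperHalf) : HasDerivAt (vInt h) (h z) z := by
  obtain ⟨K, hK⟩ := exists_primitive hh
  have hlim : ∀ z ∈ upperHalf, Tendsto (fun S : ℝ => K (z + S * Complex.I)) atTop (𝓝 (K z - vInt h z)) := by
    intro z hz
    have hi := (integrableOn_vertical hh.continuousOn hd hz).mul_const Complex.I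
    have h1 := intervalIntegral_tendsto_integral_Ioi 0 hi tendsto_id
    have h2 : ∀ᶠ S : ℝ in atTop, (∫ s in (0 : ℝ)..S, h (z + s * Complex.I) * Complex.I) + K z = K (z + S * Complex.I) := by
      filter_upwards [eventually_ge_atTop 0] with S hS
      have hd1 : ∀ s ∈ Set.uIcc 0 S, HasDerivAt (fun s : ℝ => K (z + s * Complex.I)) (h (z + s * Complex.I) * Complex.I)
          s := by
        intro s hs
        rw [Set.uIcc_of_le hS] at hs
        have h3 := hK _ (add_mul_I_mem_upperHalf hz hs.1)
        have h4 : HasDerivAt (fun s : ℝ => z + s * Complex.I) Complex.I s := by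
          simpa using ((hasDerivAt_id s).ofReal_comp.mul_const Complex.I).const_add z
        exact h3.comp s h4
      rw [intervalIntegral.integral_eq_sub_of_hasDerivAt hd1]
      · simp
      · apply ContinuousOn.intervalIntegrable
        refine ((continuousOn_vertical hh.continuousOn hz).mul continuousOn_const).mono ?_
        rw [Set.uIcc_of_le hS]
        exact Set.Icc_subset_Ici_self
    have h3 := (h1.add_const (K z)).congr' h2
    simpa [vInt, add_comm] using h3
  have hconst : ∀ z ∈ upperHalf, K z - vInt h z = K Complex.I - vInt h Complex.I := by
    intro z hz
    refine tendsto_nhds_unique (hlim z hz) ?_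
    have h0 : Tendsto (fun S : ℝ => K (z + S * Complex.I) - K (Complex.I + S * Complex.I)) atTop (𝓝 0) := by
      obtain ⟨c, hc, C, hC, B, hB, hb⟩ := hd |z.re|
      have hz' : 0 < z.im := hz
      refine squeeze_zero_norm' (a := fun S : ℝ => C * Real.exp (-c * S) * ‖z - Complex.I‖) ?_ ?_
      · filter_upwards [eventually_ge_atTop B] with S hS
        -- The mean value inequality on this convex half strip, where the derivative is
        -- exponentially small, bounds the difference of K at two points of equal shift S.
        have hconv : Convex ℝ {u : ℂ | |u.re| ≤ |z.re| ∧ S ≤ u.im} := by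
          have : {u : ℂ | |u.re| ≤ |z.re| ∧ S ≤ u.im} =
              ({u : ℂ | u.re ≤ |z.re|} ∩ {u : ℂ | -|z.re| ≤ u.re}) ∩ {u : ℂ | S ≤ u.im} := by
            ext u
            simp only [Set.mem_ofPred_eq, Set.mem_inter_iff, abs_le]
            tauto
          rw [this]
          exact ((convex_halfSpace_re_le _).inter (convex_halfSpace_re_ge _)).inter
            (convex_halfSpace_im_ge _)
        have := hconv.norm_image_sub_le_of_norm_hasDerivWithin_le (f := K) (f' := h)
          (C := C * Real.exp (-c * S)) (x := Complex.I + S * Complex.I) (y := z + S * Complex.I)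
          (fun u hu => (hK u (lt_of_lt_of_le (by linarith) hu.2)).hasDerivWithinAt)
          (fun u hu => (hb u hu.1 (hS.trans hu.2)).trans (by
            gcongr C * Real.exp ?_
            nlinarith [hu.2]))
          (by simp) (by simp; linarith)
        simpa using this
      · have : Tendsto (fun y : ℝ => Real.exp (-c * y)) atTop (𝓝 0) :=
          Real.tendsto_exp_atBot.comp (tendsto_id.const_mul_atTop_of_neg (neg_lt_zero.mpr hc))
        simpa using (this.const_mul C).mul_const ‖z - Complex.I‖
    simpa using h0.add (hlim Complex.I I_mem_upperHalf)
  have heq : vInt h =ᶠ[𝓝 z] fun u => K u - (K Complex.I - vInt h Complex.I) := by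
    filter_upwards [isOpen_upperHalf.mem_nhds hz] with u hu
    rw [← hconst u hu]
    ring
  exact ((hK z hz).sub_const _).congr_of_eventuallyEq heq

theorem eq_of_hasDerivAt_eq {h K₁ K₂ : ℂ → ℂ} (h1 : ∀ z ∈ upperHalf, HasDerivAt K₁ (h z) z)
    (h2 : ∀ z ∈ upperHalf, HasDerivAt K₂ (h z) z) {z z' : ℂ} (hz : z ∈ upperHalf)
    (hz' : z' ∈ upperHalf) : K₁ z - K₂ z = K₁ z' - K₂ z' := by
  have hd : ∀ u ∈ upperHalf, HasDerivWithinAt (fun u => K₁ u - K₂ u) 0 upperHalf u := fun u hu => by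
    rw [← sub_self (h u)]
    exact ((h1 u hu).sub (h2 u hu)).hasDerivWithinAt
  have := convex_upperHalf.norm_image_sub_le_of_norm_hasDerivWithin_le (C := 0) hd (by simp) hz' hz
  simpa [sub_eq_zero] using this

/-- The left endpoint `e^{2πi/3}` of the arc bounding the fundamental domain. -/
def rhoPt : ℂ := Complex.exp ((2 * Real.pi / 3 : ℝ) * Complex.I)

/-- The right endpoint `e^{πi/3}` of the arc. -/
def etaPt : ℂ := Complex.exp ((Real.pi / 3 : ℝ) * Complex.I)

theorem arc_mem_upperHalf {θ : ℝ} (h1 : Real.pi / 3 ≤ θ) (h2 : θ ≤ 2 * Real.pi / 3) :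
    Complex.exp (θ * Complex.I) ∈ upperHalf := by
  have := Real.pi_pos
  simp only [upperHalf, Set.mem_ofPred_eq, Complex.exp_ofReal_mul_I_im]
  exact Real.sin_pos_of_pos_of_lt_pi (by linarith) (by linarith)

theorem rhoPt_mem : rhoPt ∈ upperHalf :=
  arc_mem_upperHalf (by have := Real.pi_pos; linarith) le_rfl

theorem etaPt_mem : etaPt ∈ upperHalf :=
  arc_mem_upperHalf le_rfl (by have := Real.pi_pos; linarith)

theorem etaPt_eq : etaPt = 1 / 2 + (Real.sqrt 3 / 2 : ℝ) * Complex.I := by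
  apply Complex.ext
  · rw [etaPt, Complex.exp_ofReal_mul_I_re, Real.cos_pi_div_three]
    simp
  · rw [etaPt, Complex.exp_ofReal_mul_I_im, Real.sin_pi_div_three]
    simp

theorem rhoPt_eq : rhoPt = -(1 / 2) + (Real.sqrt 3 / 2 : ℝ) * Complex.I := by
  have h : (2 * Real.pi / 3 : ℝ) = Real.pi - Real.pi / 3 := by ring
  apply Complex.ext
  · rw [rhoPt, Complex.exp_ofReal_mul_I_re, h, Real.cos_pi_sub, Real.cos_pi_div_three]
    simp
  · rw [rhoPt, Complex.exp_ofReal_mul_I_im, h, Real.sin_pi_sub, Real.sin_pi_div_three]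
    simp

theorem rhoPt_add_one : rhoPt + 1 = etaPt := by
  rw [rhoPt_eq, etaPt_eq]; ring

theorem neg_one_div_exp (θ : ℝ) : -1 / Complex.exp (θ * Complex.I) = Complex.exp ((Real.pi - θ : ℝ) * Complex.I) := by
  rw [Complex.ofReal_sub, sub_mul, Complex.exp_sub, Complex.exp_pi_mul_I]

theorem neg_one_div_etaPt : -1 / etaPt = rhoPt := by
  rw [etaPt, neg_one_div_exp, rhoPt]
  congr 3
  ring

/-- The integral over the arc from `e^{πi/3}` to `e^{2πi/3}`. -/
def arcInt (φ : ℂ → ℂ) : ℂ :=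
  ∫ θ in (Real.pi / 3)..(2 * Real.pi / 3), φ (Complex.exp (θ * Complex.I)) * (Complex.I * Complex.exp (θ * Complex.I))

theorem arcInt_congr {φ ψ : ℂ → ℂ} (h : ∀ z ∈ upperHalf, φ z = ψ z) : arcInt φ = arcInt ψ := by
  refine intervalIntegral.integral_congr fun θ hθ => ?_
  rw [Set.uIcc_of_le (by have := Real.pi_pos; linarith)] at hθ
  simp only [h _ (arc_mem_upperHalf hθ.1 hθ.2)]

theorem intervalIntegrable_arc {φ : ℂ → ℂ} (h : ContinuousOn φ upperHalf) :
    IntervalIntegrable (fun θ : ℝ => φ (Complex.exp (θ * Complex.I)) * (Complex.I * Complex.exp (θ * Complex.I))) volume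
      (Real.pi / 3) (2 * Real.pi / 3) := by
  apply ContinuousOn.intervalIntegrable
  rw [Set.uIcc_of_le (by have := Real.pi_pos; linarith)]
  exact (h.comp (by fun_prop) fun θ hθ => arc_mem_upperHalf hθ.1 hθ.2).mul (by fun_prop)

theorem arcInt_add {φ ψ : ℂ → ℂ} (h : ContinuousOn φ upperHalf) (h' : ContinuousOn ψ upperHalf) :
    arcInt (fun z => φ z + ψ z) = arcInt φ + arcInt ψ := by
  rw [arcInt, arcInt, arcInt, ← intervalIntegral.integral_add (intervalIntegrable_arc h)
    (intervalIntegrable_arc h')]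
  simp only [add_mul]

theorem arcInt_const_mul (c : ℂ) (φ : ℂ → ℂ) : arcInt (fun z => c * φ z) = c * arcInt φ := by
  simp only [arcInt, mul_assoc, intervalIntegral.integral_const_mul]

theorem arcInt_eq_sub {h K : ℂ → ℂ} (hh : ContinuousOn h upperHalf)
    (hK : ∀ z ∈ upperHalf, HasDerivAt K (h z) z) : arcInt h = K rhoPt - K etaPt := by
  have hd1 : ∀ θ ∈ Set.uIcc (Real.pi / 3) (2 * Real.pi / 3),
      HasDerivAt (fun θ : ℝ => K (Complex.exp (θ * Complex.I))) (h (Complex.exp (θ * Complex.I)) * (Complex.I * Complex.exp (θ * Complex.I))) θ := by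
    intro θ hθ
    rw [Set.uIcc_of_le (by have := Real.pi_pos; linarith)] at hθ
    have h3 := hK _ (arc_mem_upperHalf hθ.1 hθ.2)
    have h4 : HasDerivAt (fun θ : ℝ => Complex.exp (θ * Complex.I)) (Complex.I * Complex.exp (θ * Complex.I)) θ := by
      have := ((hasDerivAt_id θ).ofReal_comp.mul_const Complex.I).cexp
      simpa [mul_comm] using this
    exact h3.comp θ h4
  rw [arcInt, intervalIntegral.integral_eq_sub_of_hasDerivAt hd1 (intervalIntegrable_arc hh)]
  rfl

/-- The effect of `z ↦ -1/z`, which reverses the arc. -/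
theorem arcInt_neg_one_div (φ : ℂ → ℂ) :
    arcInt (fun z => φ (-1 / z) * z⁻¹ ^ 2) = -arcInt φ := by
  have h := intervalIntegral.integral_comp_sub_left
    (a := Real.pi / 3) (b := 2 * Real.pi / 3)
    (fun θ : ℝ => φ (Complex.exp (θ * Complex.I)) * (Complex.I * Complex.exp (θ * Complex.I))) Real.pi
  have e1 : Real.pi - 2 * Real.pi / 3 = Real.pi / 3 := by ring
  have e2 : Real.pi - Real.pi / 3 = 2 * Real.pi / 3 := by ring
  rw [e1, e2] at h
  rw [arcInt, arcInt, ← h, ← intervalIntegral.integral_neg]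
  congr 1
  ext1 θ
  have h0 := Complex.exp_ne_zero (θ * Complex.I)
  rw [← neg_one_div_exp]
  field_simp

end UpperHalfPlaneAnalysis

/-! ### Regularised moments and Eichler integrals of one function -/

noncomputable section EichlerPrimitives

open Polynomial

variable {f : ℂ → ℂ} {a : ℂ}

theorem differentiableOn_mul_eval (hf : DifferentiableOn ℂ f upperHalf) (p : ℂ[X]) :
    DifferentiableOn ℂ (fun t => (f t - a) * p.eval t) upperHalf :=
  (hf.sub_const a).mul p.differentiable.differentiableOn

theorem ExpDecay.mul_eval {h : ℂ → ℂ} (hd : ExpDecay h) (p : ℂ[X]) :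
    ExpDecay fun t => h t * p.eval t := by
  induction p using Polynomial.induction_on' with
  | add p q hp hq => simpa only [eval_add, mul_add] using hp.add hq
  | monomial n c =>
    have := (hd.mul_pow n).const_mul c
    simp only [eval_monomial]
    convert this using 2
    ring

/-- The primitive of `(f - a) p` that vanishes at `i∞`. -/
def polyPrim (f : ℂ → ℂ) (a : ℂ) (p : ℂ[X]) : ℂ → ℂ := vInt fun t => (f t - a) * p.eval t

theorem hasDerivAt_polyPrim (hf : DifferentiableOn ℂ f upperHalf)
    (hd : ExpDecay fun t => f t - a) (p : ℂ[X]) {z : ℂ} (hz : z ∈ upperHalf) :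
    HasDerivAt (polyPrim f a p) ((f z - a) * p.eval z) z :=
  hasDerivAt_vInt (differentiableOn_mul_eval hf p) (hd.mul_eval p) hz

theorem polyPrim_add (hf : DifferentiableOn ℂ f upperHalf)
    (hd : ExpDecay fun t => f t - a) (p q : ℂ[X]) {z : ℂ} (hz : z ∈ upperHalf) :
    polyPrim f a (p + q) z = polyPrim f a p z + polyPrim f a q z := by
  have hi : ∀ p : ℂ[X], IntegrableOn (fun s : ℝ => (f (z + s * Complex.I) - a) *
      p.eval (z + s * Complex.I) * Complex.I) (Set.Ioi 0) := fun p =>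
    (integrableOn_vertical (differentiableOn_mul_eval hf p).continuousOn (hd.mul_eval p)
      hz).mul_const _
  rw [polyPrim, polyPrim, polyPrim, vInt, vInt, vInt, ← neg_add, ← integral_add (hi p) (hi q)]
  simp only [eval_add, mul_add, add_mul]

theorem polyPrim_smul (c : ℂ) (p : ℂ[X]) (z : ℂ) :
    polyPrim f a (c • p) z = c * polyPrim f a p z := by
  rw [polyPrim, polyPrim, vInt, vInt, mul_neg, ← integral_const_mul]
  congr 2
  ext1 s
  simp only [eval_smul, smul_eq_mul]
  ring

theorem polyPrim_sub (hf : DifferentiableOn ℂ f upperHalf)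
    (hd : ExpDecay fun t => f t - a) (p q : ℂ[X]) {z : ℂ} (hz : z ∈ upperHalf) :
    polyPrim f a (p - q) z = polyPrim f a p z - polyPrim f a q z := by
  have : p - q = p + (-1 : ℂ) • q := by simp [sub_eq_add_neg]
  rw [this, polyPrim_add hf hd _ _ hz, polyPrim_smul]
  ring

theorem polyPrim_sum (hf : DifferentiableOn ℂ f upperHalf)
    (hd : ExpDecay fun t => f t - a) {ι : Type*} (u : Finset ι) (p : ι → ℂ[X]) {z : ℂ}
    (hz : z ∈ upperHalf) :
    polyPrim f a (∑ i ∈ u, p i) z = ∑ i ∈ u, polyPrim f a (p i) z := by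
  classical
  induction u using Finset.induction_on with
  | empty => simp [polyPrim, vInt]
  | insert i u hi ih => rw [Finset.sum_insert hi, polyPrim_add hf hd _ _ hz, ih,
      Finset.sum_insert hi]

theorem polyPrim_expDecay (hd : ExpDecay fun t => f t - a) (p : ℂ[X]) :
    ExpDecay (polyPrim f a p) := vInt_expDecay (hd.mul_eval p)

theorem polyPrim_congr {f g : ℂ → ℂ} (h : ∀ t ∈ upperHalf, f t = g t) (p : ℂ[X]) {z : ℂ}
    (hz : z ∈ upperHalf) : polyPrim f a p z = polyPrim g a p z := by
  rw [polyPrim, polyPrim, vInt, vInt]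
  congr 1
  refine setIntegral_congr_fun measurableSet_Ioi fun s hs => ?_
  simp only [h _ (add_mul_I_mem_upperHalf hz (le_of_lt hs))]

theorem polyPrim_add_one (p : ℂ[X]) (z : ℂ) :
    polyPrim f a p (z + 1) = polyPrim (fun t => f (t + 1)) a (p.comp (X + C 1)) z := by
  simp only [polyPrim, vInt, eval_comp, eval_add, eval_X, eval_C, add_right_comm]

/-- A primitive of `f(z) zⁿ`, regularised at `i∞`. -/
def momPrim (f : ℂ → ℂ) (a : ℂ) (n : ℕ) (z : ℂ) : ℂ :=
  polyPrim f a (X ^ n) z + a * z ^ (n + 1) / (n + 1)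

theorem hasDerivAt_momPrim (hf : DifferentiableOn ℂ f upperHalf)
    (hd : ExpDecay fun t => f t - a) (n : ℕ) {z : ℂ} (hz : z ∈ upperHalf) :
    HasDerivAt (momPrim f a n) (f z * z ^ n) z := by
  have h1 := hasDerivAt_polyPrim hf hd (X ^ n) hz
  have h2 := ((hasDerivAt_pow (n + 1) z).const_mul a).div_const ((n : ℂ) + 1)
  have h3 : (n : ℂ) + 1 ≠ 0 := by exact_mod_cast Nat.succ_ne_zero n
  refine (h1.add h2).congr_deriv ?_
  simp only [eval_pow, eval_X, Nat.add_sub_cancel, Nat.cast_add, Nat.cast_one]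
  field_simp
  ring

/-- The regularised integral `∫_{i∞}^z f(t) (t - X)^w dt`. -/
def eichPrim (w : ℕ) (f : ℂ → ℂ) (a z x : ℂ) : ℂ :=
  polyPrim f a ((X - C x) ^ w) z + a * (z - x) ^ (w + 1) / (w + 1)

theorem hasDerivAt_eichPrim (w : ℕ) (hf : DifferentiableOn ℂ f upperHalf)
    (hd : ExpDecay fun t => f t - a) (x : ℂ) {z : ℂ} (hz : z ∈ upperHalf) :
    HasDerivAt (fun z => eichPrim w f a z x) (f z * (z - x) ^ w) z := by
  have h1 := hasDerivAt_polyPrim hf hd ((X - C x) ^ w) hz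
  have h2 := ((((hasDerivAt_id z).sub_const x).pow (w + 1)).const_mul a).div_const ((w : ℂ) + 1)
  have h3 : (w : ℂ) + 1 ≠ 0 := by exact_mod_cast Nat.succ_ne_zero w
  refine (h1.add h2).congr_deriv ?_
  simp only [eval_pow, eval_X, eval_sub, eval_C, Nat.add_sub_cancel, Nat.cast_add, Nat.cast_one,
    id]
  field_simp
  ring

/-- The coefficient `(-1)^w a / (w + 1)` of `X^{w+1}`. -/
def topC (w : ℕ) (a : ℂ) : ℂ := (-1) ^ w * a / (w + 1)

/-- The polynomial `∫^z f(t) (t - X)^w dt` in `X`, regularised at `i∞`. -/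
def eichPoly (w : ℕ) (f : ℂ → ℂ) (a z : ℂ) : ℂ[X] :=
  ∑ n ∈ Finset.range (w + 1), monomial n ((w.choose n : ℂ) * (-1) ^ n * momPrim f a (w - n) z)

theorem coeff_eichPoly (w : ℕ) (z : ℂ) (n : ℕ) :
    (eichPoly w f a z).coeff n =
      if n ≤ w then (w.choose n : ℂ) * (-1) ^ n * momPrim f a (w - n) z else 0 := by
  simp [eichPoly, coeff_monomial]

theorem natDegree_eichPoly (w : ℕ) (z : ℂ) : (eichPoly w f a z).natDegree ≤ w := by
  rw [natDegree_le_iff_coeff_eq_zero]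
  intro n hn
  rw [coeff_eichPoly, if_neg (not_le.mpr hn)]

theorem sum_choose_mul_div (w : ℕ) (z x : ℂ) :
    ∑ n ∈ Finset.range (w + 1), (w.choose n : ℂ) * (-x) ^ n * (z ^ (w - n + 1) /
      (((w - n : ℕ) : ℂ) + 1)) = ((z - x) ^ (w + 1) - (-x) ^ (w + 1)) / (w + 1) := by
  have h3 : (w : ℂ) + 1 ≠ 0 := by exact_mod_cast Nat.succ_ne_zero w
  rw [eq_div_iff h3, Finset.sum_mul, sub_eq_add_neg z, add_comm z, add_pow,
    Finset.sum_range_succ _ (w + 1)]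
  simp only [Nat.sub_self, pow_zero, mul_one, Nat.choose_self, Nat.cast_one, add_sub_cancel_right]
  refine Finset.sum_congr rfl fun n hn => ?_
  have hn' : n ≤ w := Nat.lt_succ_iff.mp (Finset.mem_range.mp hn)
  have e := Nat.choose_mul_succ_eq w n
  obtain ⟨m, rfl⟩ := Nat.exists_eq_add_of_le hn'
  have e1 : n + m + 1 - n = m + 1 := by omega
  have hm : (m : ℂ) + 1 ≠ 0 := by exact_mod_cast Nat.succ_ne_zero m
  rw [e1] at e ⊢
  rw [Nat.add_sub_cancel_left]
  have e' : ((n + m).choose n : ℂ) * ((n + m : ℕ) + 1) = (n + m + 1).choose n * ((m : ℂ) + 1) := by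
    exact_mod_cast e
  field_simp
  linear_combination ((-x) ^ n * z ^ (m + 1)) * e'

/-- Coefficientwise, the constant term a is integrated from 0, whereas `eichPrim` integrates it from
x. The discrepancy is a times the integral of (t - x)^w from 0 to x, a multiple of x^{w+1}: this
produces the top term of the extended period polynomial. -/
theorem eval_eichPoly (w : ℕ) (hf : DifferentiableOn ℂ f upperHalf)
    (hd : ExpDecay fun t => f t - a) (x : ℂ) {z : ℂ} (hz : z ∈ upperHalf) :
    (eichPoly w f a z).eval x = eichPrim w f a z x + topC w a * x ^ (w + 1) := by
  have h1 : ((X - C x : ℂ[X]) ^ w) = ∑ n ∈ Finset.range (w + 1),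
      ((w.choose n : ℂ) * (-x) ^ n) • X ^ (w - n) := by
    rw [sub_eq_add_neg, add_comm, add_pow]
    refine Finset.sum_congr rfl fun n _ => ?_
    rw [smul_eq_C_mul]
    simp only [C_mul, C_pow, C_neg, map_natCast]
    ring
  rw [eichPrim, h1, polyPrim_sum hf hd _ _ hz, eichPoly, eval_finsetSum]
  have h2 : ∀ n ∈ Finset.range (w + 1), eval x (monomial n ((w.choose n : ℂ) * (-1) ^ n *
      momPrim f a (w - n) z)) = polyPrim f a (((w.choose n : ℂ) * (-x) ^ n) • X ^ (w - n)) z +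
      a * ((w.choose n : ℂ) * (-x) ^ n * (z ^ (w - n + 1) / (((w - n : ℕ) : ℂ) + 1))) := by
    intro n _
    rw [eval_monomial, polyPrim_smul, momPrim, neg_pow x]
    ring
  rw [Finset.sum_congr rfl h2, Finset.sum_add_distrib, ← Finset.mul_sum, sum_choose_mul_div, topC,
    neg_pow x, pow_succ (-1 : ℂ)]
  ring

/-- The reproducing kernel inside the integral: pairing p with the integral of f(t)(t - X)^w gives
the regularised integral of f p, so it is a primitive of f p in z. -/
theorem polyPair_eichPoly (w : ℕ) (p : ℂ[X]) (z : ℂ) :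
    polyPair w p (eichPoly w f a z) =
      ∑ n ∈ Finset.range (w + 1), p.coeff n * momPrim f a n z := by
  refine Finset.sum_congr rfl fun n hn => ?_
  have hn' : n ≤ w := Nat.lt_succ_iff.mp (Finset.mem_range.mp hn)
  have hc : (w.choose n : ℂ) ≠ 0 := Nat.cast_ne_zero.mpr (Nat.choose_pos hn').ne'
  have hm : (-1 : ℂ) ^ (w - n) * (-1 : ℂ) ^ (w - n) = 1 := by rw [← mul_pow]; simp
  rw [coeff_eichPoly, if_pos (Nat.sub_le _ _), Nat.choose_symm hn', Nat.sub_sub_self hn']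
  field_simp
  linear_combination (p.coeff n * momPrim f a n z) * hm

theorem hasDerivAt_polyPair_eichPoly {w : ℕ} (hf : DifferentiableOn ℂ f upperHalf)
    (hd : ExpDecay fun t => f t - a) {p : ℂ[X]} (hp : p.natDegree ≤ w) {z : ℂ}
    (hz : z ∈ upperHalf) :
    HasDerivAt (fun z => polyPair w p (eichPoly w f a z)) (p.eval z * f z) z := by
  simp only [polyPair_eichPoly]
  have := HasDerivAt.fun_sum (u := Finset.range (w + 1)) fun n _ =>
    (hasDerivAt_momPrim hf hd n hz).const_mul (p.coeff n)
  refine this.congr_deriv ?_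
  rw [eval_eq_sum_range' (Nat.lt_succ_of_le hp), Finset.sum_mul]
  exact Finset.sum_congr rfl fun n _ => by ring

theorem arcInt_eval_mul {w : ℕ} (hf : DifferentiableOn ℂ f upperHalf)
    (hd : ExpDecay fun t => f t - a) {p : ℂ[X]} (hp : p.natDegree ≤ w) :
    arcInt (fun z => p.eval z * f z) =
      polyPair w p (eichPoly w f a rhoPt) - polyPair w p (eichPoly w f a etaPt) :=
  arcInt_eq_sub (p.continuous.continuousOn.mul hf.continuousOn) fun _ hz =>
    hasDerivAt_polyPair_eichPoly hf hd hp hz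

/-- The moment of order w + 1 lies beyond the reach of the pairing, but its translation defect
involves only (X+1)^{w+1} - X^{w+1}, which has degree at most w. The extra a/(w+2) arises because
integrating that polynomial from 0 loses the constant term of (z+1)^{w+2} - z^{w+2}. -/
theorem momPrim_add_one_sub (w : ℕ) {f₁ : ℂ → ℂ} (hf : DifferentiableOn ℂ f₁ upperHalf)
    (hd : ExpDecay fun t => f₁ t - a) (hff : ∀ t ∈ upperHalf, f₁ t = f (t + 1)) {z : ℂ}
    (hz : z ∈ upperHalf) :
    momPrim f a (w + 1) (z + 1) - momPrim f₁ a (w + 1) z =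
      polyPair w (diffPoly w) (eichPoly w f₁ a z) + a / (w + 2) := by
  have h2 : (w : ℂ) + 2 ≠ 0 := by exact_mod_cast (Nat.succ_ne_zero (w + 1))
  have e1 : polyPrim f a (X ^ (w + 1)) (z + 1) = polyPrim f₁ a ((X + C 1) ^ (w + 1)) z := by
    rw [polyPrim_add_one, pow_comp, X_comp]
    exact (polyPrim_congr hff _ hz).symm
  have e2 : diffPoly w = ∑ n ∈ Finset.range (w + 1), ((diffPoly w).coeff n) • X ^ n := by
    conv_lhs => rw [(diffPoly w).as_sum_range' (w + 1) (Nat.lt_succ_of_le natDegree_diffPoly)]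
    exact Finset.sum_congr rfl fun n _ => by rw [smul_X_eq_monomial]
  have e3 : polyPrim f₁ a ((X + C 1) ^ (w + 1)) z - polyPrim f₁ a (X ^ (w + 1)) z =
      ∑ n ∈ Finset.range (w + 1), (diffPoly w).coeff n * polyPrim f₁ a (X ^ n) z := by
    rw [← polyPrim_sub hf hd _ _ hz, ← diffPoly]
    conv_lhs => rw [e2]
    rw [polyPrim_sum hf hd _ _ hz]
    exact Finset.sum_congr rfl fun n _ => by rw [polyPrim_smul]
  have e4 : ∑ n ∈ Finset.range (w + 1), (diffPoly w).coeff n * (z ^ (n + 1) / ((n : ℂ) + 1)) =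
      ((z + 1) ^ (w + 2) - z ^ (w + 2) - 1) / (w + 2) := by
    rw [eq_div_iff h2, Finset.sum_mul, add_pow, Finset.sum_range_succ _ (w + 2),
      Finset.sum_range_succ' _ (w + 1)]
    simp only [one_pow, mul_one, Nat.choose_self, Nat.cast_one, pow_zero, Nat.choose_zero_right]
    rw [show ∀ x : ℂ, x + 1 + z ^ (w + 2) - z ^ (w + 2) - 1 = x by intro x; ring]
    refine Finset.sum_congr rfl fun n hn => ?_
    have hn' : n ≤ w := Nat.lt_succ_iff.mp (Finset.mem_range.mp hn)
    rw [coeff_diffPoly, if_pos hn']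
    have hn1 : (n : ℂ) + 1 ≠ 0 := by exact_mod_cast Nat.succ_ne_zero n
    have e2 : ((w : ℂ) + 2) * (w + 1).choose n = (w + 2).choose (n + 1) * ((n : ℂ) + 1) := by
      have := Nat.add_one_mul_choose_eq (w + 1) n
      push_cast [← Nat.cast_inj (R := ℂ)] at this ⊢
      linear_combination this
    field_simp
    linear_combination (z ^ (n + 1)) * e2
  rw [polyPair_eichPoly]
  simp only [momPrim, mul_add, Finset.sum_add_distrib]
  rw [e1, ← e3]
  have e5 : ∑ n ∈ Finset.range (w + 1), (diffPoly w).coeff n * (a * z ^ (n + 1) / ((n : ℂ) + 1)) =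
      a * (((z + 1) ^ (w + 2) - z ^ (w + 2) - 1) / (w + 2)) := by
    rw [← e4, Finset.mul_sum]
    exact Finset.sum_congr rfl fun n _ => by ring
  rw [e5]
  push_cast
  rw [show (w : ℂ) + 1 + 1 = w + 2 by ring]
  field_simp
  ring

end EichlerPrimitives

/-! ### Modular families and their extended period polynomials -/

noncomputable section ModularFamilies

open Polynomial

/-- The family `A ↦ f|A` of a modular form of weight `w + 2` with constant terms `a A`, as
functions on the upper half plane in `ℂ`. -/
structure IsModFam (Γ : Subgroup SL(2, ℤ)) (w : ℕ) (F : SL(2, ℤ) → ℂ → ℂ) (a : SL(2, ℤ) → ℂ) :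
    Prop where
  diff : ∀ A, DifferentiableOn ℂ (F A) upperHalf
  inv : ∀ γ ∈ Γ, ∀ A, F (γ * A) = F A
  neg : ∀ A z, F (-A) z = (-1) ^ w * F A z
  mul_T : ∀ A, ∀ z ∈ upperHalf, F (A * ModularGroup.T) z = F A (z + 1)
  mul_S : ∀ A, ∀ z ∈ upperHalf, F (A * ModularGroup.S) z * z ^ (w + 2) = F A (-1 / z)
  decay : ∀ A, ExpDecay fun z => F A z - a A

namespace IsModFam

variable {Γ : Subgroup SL(2, ℤ)} {w : ℕ} {F : SL(2, ℤ) → ℂ → ℂ} {a : SL(2, ℤ) → ℂ}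

theorem tendsto (h : IsModFam Γ w F a) (A : SL(2, ℤ)) (x : ℝ) :
    Tendsto (fun y : ℝ => F A (x + y * Complex.I)) atTop (𝓝 (a A)) := by
  simpa using ((h.decay A).tendsto x).add_const (a A)

theorem a_inv (h : IsModFam Γ w F a) : ∀ γ ∈ Γ, ∀ A, a (γ * A) = a A := by
  intro γ hγ A
  have h1 := h.tendsto (γ * A) 0
  rw [h.inv γ hγ] at h1
  exact tendsto_nhds_unique h1 (h.tendsto A 0)

theorem a_neg (h : IsModFam Γ w F a) (A : SL(2, ℤ)) : a (-A) = (-1) ^ w * a A := by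
  have h1 := h.tendsto (-A) 0
  simp only [h.neg] at h1
  exact tendsto_nhds_unique h1 ((h.tendsto A 0).const_mul _)

/-- The constant term is the limit along every vertical line; the lines Re z = 0 and Re z = 1 are
exchanged by T. -/
theorem a_mul_T (h : IsModFam Γ w F a) (A : SL(2, ℤ)) : a (A * ModularGroup.T) = a A := by
  refine tendsto_nhds_unique ((h.tendsto (A * ModularGroup.T) 0).congr' ?_) (h.tendsto A 1)
  filter_upwards [eventually_gt_atTop 0] with y hy
  rw [h.mul_T A _ (by simpa [upperHalf] using hy)]
  congr 1
  push_cast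
  ring

theorem isTopCoeff (h : IsModFam Γ w F a) : IsTopCoeff Γ w fun A => topC w (a A) where
  inv γ hγ A := by rw [h.a_inv γ hγ]
  neg A := by rw [h.a_neg, topC, topC]; ring
  mul_T A := by rw [h.a_mul_T]

end IsModFam

/-- The family of polynomials `eichPoly`. -/
def eichFam (w : ℕ) (F : SL(2, ℤ) → ℂ → ℂ) (a : SL(2, ℤ) → ℂ) (z : ℂ) : SL(2, ℤ) → ℂ[X] :=
  fun A => eichPoly w (F A) (a A) z

/-- The polynomial part of the extended period polynomial. -/
def perPoly (w : ℕ) (F : SL(2, ℤ) → ℂ → ℂ) (a : SL(2, ℤ) → ℂ) : SL(2, ℤ) → ℂ[X] :=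
  famS w (eichFam w F a Complex.I) - eichFam w F a Complex.I

/-- The values of the extended period polynomial. -/
def perFun (w : ℕ) (F : SL(2, ℤ) → ℂ → ℂ) (a : SL(2, ℤ) → ℂ) (A : SL(2, ℤ)) (x : ℂ) : ℂ :=
  (perPoly w F a A).eval x + topC w (a A) * x ^ (w + 1) +
    (-1) ^ w * topC w (a (A * ModularGroup.S⁻¹)) * x⁻¹

namespace IsModFam

variable {Γ : Subgroup SL(2, ℤ)} {w : ℕ} {F : SL(2, ℤ) → ℂ → ℂ} {a : SL(2, ℤ) → ℂ}

theorem polyPrim_neg (h : IsModFam Γ w F a) (A : SL(2, ℤ)) (p : ℂ[X]) (z : ℂ) :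
    polyPrim (F (-A)) (a (-A)) p z = (-1) ^ w * polyPrim (F A) (a A) p z := by
  rw [polyPrim, polyPrim, vInt, vInt, mul_neg, ← integral_const_mul]
  congr 2
  ext1 s
  rw [h.neg, h.a_neg]
  ring

theorem eichFam_mem (h : IsModFam Γ w F a) (z : ℂ) : eichFam w F a z ∈ polyFam Γ w := by
  refine ⟨fun A => natDegree_eichPoly w z, fun γ hγ A => ?_, fun A => ?_⟩
  · rw [eichFam, eichFam, h.inv γ hγ, h.a_inv γ hγ]
  · have h1 : ∀ n, momPrim (F (-A)) (a (-A)) n z = (-1) ^ w * momPrim (F A) (a A) n z := by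
      intro n
      rw [momPrim, momPrim, h.polyPrim_neg, h.a_neg]
      ring
    ext n
    rw [eichFam, eichFam, coeff_smul, coeff_eichPoly, coeff_eichPoly, smul_eq_mul]
    split_ifs
    · rw [h1]; ring
    · simp

theorem perPoly_mem (h : IsModFam Γ w F a) : perPoly w F a ∈ polyFam Γ w :=
  sub_mem (famS_mem (h.eichFam_mem _)) (h.eichFam_mem _)

theorem mul_S_inv (h : IsModFam Γ w F a) (A : SL(2, ℤ)) {z : ℂ} (hz : z ∈ upperHalf) :
    F (A * ModularGroup.S⁻¹) (-1 / z) = F A z * z ^ (w + 2) := by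
  rw [← h.mul_S _ z hz, inv_mul_cancel_right]

/-- By modularity under S, both terms have the same z-derivative F(z)(z - x)^w, so their difference
is constant in z. -/
theorem eichPrim_S_const (h : IsModFam Γ w F a) (A : SL(2, ℤ)) {x : ℂ} (hx : x ≠ 0) {z z' : ℂ}
    (hz : z ∈ upperHalf) (hz' : z' ∈ upperHalf) :
    x ^ w * eichPrim w (F (A * ModularGroup.S⁻¹)) (a (A * ModularGroup.S⁻¹)) (-1 / z) (-1 / x) -
        eichPrim w (F A) (a A) z x =
      x ^ w * eichPrim w (F (A * ModularGroup.S⁻¹)) (a (A * ModularGroup.S⁻¹)) (-1 / z') (-1 / x) -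
        eichPrim w (F A) (a A) z' x := by
  refine eq_of_hasDerivAt_eq (h := fun z => F A z * (z - x) ^ w)
    (K₁ := fun z => x ^ w * eichPrim w (F (A * ModularGroup.S⁻¹)) (a (A * ModularGroup.S⁻¹))
      (-1 / z) (-1 / x)) (K₂ := fun z => eichPrim w (F A) (a A) z x) (fun z hz => ?_)
    (fun z hz => hasDerivAt_eichPrim w (h.diff A) (h.decay A) x hz) hz hz'
  have h0 := ne_zero_of_mem_upperHalf hz
  have h1 := hasDerivAt_eichPrim w (h.diff (A * ModularGroup.S⁻¹)) (h.decay _) (-1 / x)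
    (neg_one_div_mem_upperHalf hz)
  have h2 : HasDerivAt (fun z : ℂ => -1 / z) (z ^ 2)⁻¹ z := by
    have := (hasDerivAt_inv h0).neg
    simp only [neg_neg] at this
    refine this.congr_of_eventuallyEq (Eventually.of_forall fun u => ?_)
    simp [neg_div]
  refine ((h1.comp z h2).const_mul (x ^ w)).congr_deriv ?_
  have h3 : -1 / z - -1 / x = (z - x) / (z * x) := by field_simp; ring
  rw [h.mul_S_inv A hz, h3, div_pow, mul_pow]
  field_simp
  ring

theorem eval_famS_eichFam (h : IsModFam Γ w F a) (A : SL(2, ℤ)) {z x : ℂ} (hz : z ∈ upperHalf)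
    (hx : x ≠ 0) : (famS w (eichFam w F a (-1 / z)) A).eval x =
      x ^ w * eichPrim w (F (A * ModularGroup.S⁻¹)) (a (A * ModularGroup.S⁻¹)) (-1 / z) (-1 / x) -
        (-1) ^ w * topC w (a (A * ModularGroup.S⁻¹)) * x⁻¹ := by
  rw [famS_apply, eichFam, eval_polyS (natDegree_eichPoly _ _) hx,
    eval_eichPoly w (h.diff _) (h.decay _) _ (neg_one_div_mem_upperHalf hz), div_pow, pow_succ x,
    pow_succ (-1 : ℂ)]
  field_simp
  ring

theorem eval_eichFam (h : IsModFam Γ w F a) (A : SL(2, ℤ)) {z : ℂ} (x : ℂ) (hz : z ∈ upperHalf) :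
    (eichFam w F a z A).eval x = eichPrim w (F A) (a A) z x + topC w (a A) * x ^ (w + 1) :=
  eval_eichPoly w (h.diff _) (h.decay _) _ hz

theorem neg_one_div_I : -1 / Complex.I = Complex.I := by
  rw [div_eq_iff Complex.I_ne_zero, Complex.I_mul_I]

/-- The definition uses the fixed point i of S as base point; here the base point z becomes free.
Later choices are x = z for the holomorphic vanishing and x = z̄ for the Petersson product. -/
theorem perFun_eq (h : IsModFam Γ w F a) (A : SL(2, ℤ)) {z x : ℂ} (hz : z ∈ upperHalf)
    (hx : x ≠ 0) : perFun w F a A x =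
      x ^ w * eichPrim w (F (A * ModularGroup.S⁻¹)) (a (A * ModularGroup.S⁻¹)) (-1 / z) (-1 / x) -
        eichPrim w (F A) (a A) z x := by
  rw [h.eichPrim_S_const A hx hz I_mem_upperHalf]
  have h1 := h.eval_famS_eichFam A I_mem_upperHalf hx
  rw [neg_one_div_I] at h1 ⊢
  rw [perFun, perPoly, Pi.sub_apply, eval_sub, h1, h.eval_eichFam A x I_mem_upperHalf]
  ring

theorem famS_eichFam (h : IsModFam Γ w F a) {z : ℂ} (hz : z ∈ upperHalf) :
    famS w (eichFam w F a (-1 / z)) = eichFam w F a z + perPoly w F a := by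
  ext1 A
  refine Polynomial.eq_of_infinite_eval_eq _ _ (Set.Infinite.mono (s := ({0} : Set ℂ)ᶜ)
    ?_ (Set.finite_singleton _).infinite_compl)
  intro x hx
  have hx : x ≠ 0 := hx
  have h1 := h.perFun_eq A hz hx
  simp only [Set.mem_ofPred_eq]
  rw [h.eval_famS_eichFam A hz hx, Pi.add_apply, eval_add, h.eval_eichFam A x hz]
  rw [perFun] at h1
  linear_combination -h1

theorem famS_perPoly (h : IsModFam Γ w F a) : famS w (perPoly w F a) = -perPoly w F a := by
  rw [perPoly, map_sub, famS_famS (h.eichFam_mem _), neg_sub]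

theorem eichPrim_add_one (h : IsModFam Γ w F a) (A : SL(2, ℤ)) {z : ℂ} (x : ℂ)
    (hz : z ∈ upperHalf) : eichPrim w (F (A * ModularGroup.T⁻¹)) (a (A * ModularGroup.T⁻¹))
      (z + 1) (x + 1) = eichPrim w (F A) (a A) z x := by
  have h1 : a (A * ModularGroup.T⁻¹) = a A := by
    rw [← h.a_mul_T (A * _), inv_mul_cancel_right]
  rw [eichPrim, eichPrim, h1, polyPrim_add_one,
    polyPrim_congr (g := F A) (fun t ht => ?_) _ hz]
  · have h2 : ((X - C (x + 1)) ^ w).comp (X + C 1) = (X - C x) ^ w := by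
      simp only [pow_comp, sub_comp, X_comp, C_add, add_comp, C_comp]
      ring
    rw [h2]
    ring
  · rw [← h.mul_T _ t ht, inv_mul_cancel_right]

/-- The regularised integral E(z, x) is exactly T-invariant. The defect comes solely from the top
term c x^{w+1}, which E and the polynomial differ by. -/
theorem famT_eichFam (h : IsModFam Γ w F a) {z : ℂ} (hz : z ∈ upperHalf) :
    famT 1 (eichFam w F a (z + 1)) =
      eichFam w F a z - diffFam w (fun A => topC w (a A)) := by
  ext1 A
  refine Polynomial.funext fun x => ?_
  have h1 : a (A * ModularGroup.T⁻¹) = a A := by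
    rw [← h.a_mul_T (A * _), inv_mul_cancel_right]
  have h2 : A * ModularGroup.T ^ (-1 : ℤ) = A * ModularGroup.T⁻¹ := by simp
  rw [famT_apply, h2, eval_comp, Pi.sub_apply, eval_sub, h.eval_eichFam A x hz]
  simp only [eval_add, eval_X, eval_C, Int.cast_one]
  rw [h.eval_eichFam _ _ (add_one_mem_upperHalf hz), h.eichPrim_add_one A x hz, h1, diffFam,
    eval_smul, diffPoly]
  simp only [eval_sub, eval_add, eval_X, eval_C, eval_pow, smul_eq_mul]
  ring

/-- The corner η is the image of ρ both under z ↦ -1/z and under z ↦ z + 1; eliminating the value at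
ρ leaves a relation for η alone. This is the potential required by the algebraic identity. -/
theorem famS_eichFam_etaPt (h : IsModFam Γ w F a) :
    famS w (eichFam w F a etaPt) =
      famT 1 (eichFam w F a etaPt) + perPoly w F a + diffFam w (fun A => topC w (a A)) := by
  have h1 : -1 / rhoPt = etaPt := by
    rw [← neg_one_div_etaPt]
    field_simp
  have h2 := h.famS_eichFam rhoPt_mem
  have h3 := h.famT_eichFam rhoPt_mem
  rw [h1] at h2
  rw [rhoPt_add_one] at h3
  rw [h2, h3]
  abel

end IsModFam

/-- The extended period polynomial of a modular family. -/
def perLaurent (w : ℕ) (F : SL(2, ℤ) → ℂ → ℂ) (a : SL(2, ℤ) → ℂ) : SL(2, ℤ) → ℂ[T;T⁻¹] :=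
  fun A => ∑ n ∈ Finset.range (w + 1), .single (n : ℤ) ((perPoly w F a A).coeff n) +
    .single ((w : ℤ) + 1) (topC w (a A)) +
    .single (-1) ((-1) ^ w * topC w (a (A * ModularGroup.S⁻¹)))

theorem coeff_perLaurent (w : ℕ) (F : SL(2, ℤ) → ℂ → ℂ) (a : SL(2, ℤ) → ℂ) (A : SL(2, ℤ)) (m : ℤ) :
    (perLaurent w F a A).coeff m =
      (∑ n ∈ Finset.range (w + 1), if (n : ℤ) = m then (perPoly w F a A).coeff n else 0) +
      (if (w : ℤ) + 1 = m then topC w (a A) else 0) +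
      (if -1 = m then (-1) ^ w * topC w (a (A * ModularGroup.S⁻¹)) else 0) := by
  simp only [perLaurent, AddMonoidAlgebra.coeff_add, AddMonoidAlgebra.coeff_sum,
    AddMonoidAlgebra.coeff_single, Finsupp.add_apply, Finsupp.finsetSum_apply,
    Finsupp.single_apply]

theorem laurentEval_add (P Q : ℂ[T;T⁻¹]) (z : ℍ) :
    laurentEval (P + Q) z = laurentEval P z + laurentEval Q z := by
  rw [laurentEval, laurentEval, laurentEval, AddMonoidAlgebra.coeff_add,
    Finsupp.sum_add_index' (by simp) (by intros; ring)]

theorem laurentEval_single (n : ℤ) (c : ℂ) (z : ℍ) :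
    laurentEval (.single n c) z = c * (z : ℂ) ^ n := by
  rw [laurentEval, AddMonoidAlgebra.coeff_single, Finsupp.sum_single_index (zero_mul _)]

theorem laurentEval_sum {ι : Type*} (u : Finset ι) (P : ι → ℂ[T;T⁻¹]) (z : ℍ) :
    laurentEval (∑ i ∈ u, P i) z = ∑ i ∈ u, laurentEval (P i) z := by
  classical
  induction u using Finset.induction_on with
  | empty => simp [laurentEval]
  | insert i u hi ih => rw [Finset.sum_insert hi, laurentEval_add, ih, Finset.sum_insert hi]

theorem natDegree_perPoly (w : ℕ) (F : SL(2, ℤ) → ℂ → ℂ) (a : SL(2, ℤ) → ℂ) (A : SL(2, ℤ)) :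
    (perPoly w F a A).natDegree ≤ w := by
  refine (natDegree_sub_le _ _).trans (max_le (natDegree_polyS _ _) (natDegree_eichPoly _ _))

theorem laurentEval_perLaurent (w : ℕ) (F : SL(2, ℤ) → ℂ → ℂ) (a : SL(2, ℤ) → ℂ) (A : SL(2, ℤ))
    (z : ℍ) : laurentEval (perLaurent w F a A) z = perFun w F a A z := by
  rw [perLaurent, laurentEval_add, laurentEval_add, laurentEval_sum, perFun,
    eval_eq_sum_range' (Nat.lt_succ_of_le (natDegree_perPoly w F a A))]
  simp only [laurentEval_single, zpow_natCast, zpow_neg_one]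
  congr 2

theorem polyPart_perLaurent (w : ℕ) (F : SL(2, ℤ) → ℂ → ℂ) (a : SL(2, ℤ) → ℂ) :
    polyPart w (perLaurent w F a) = perPoly w F a := by
  ext A n
  simp only [polyPart, finsetSum_coeff, coeff_monomial, coeff_perLaurent, Nat.cast_inj]
  rw [Finset.sum_ite_eq']
  by_cases hn : n ∈ Finset.range (w + 1)
  · have := Finset.mem_range.mp hn
    rw [if_pos hn, Finset.sum_ite_eq', if_pos hn, if_neg (by omega), if_neg (by omega), add_zero,
      add_zero]
  · rw [if_neg hn, coeff_eq_zero_of_natDegree_lt]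
    exact lt_of_le_of_lt (natDegree_perPoly w F a A) (by simpa using hn)

theorem topCoeff_perLaurent (w : ℕ) (F : SL(2, ℤ) → ℂ → ℂ) (a : SL(2, ℤ) → ℂ) (A : SL(2, ℤ)) :
    topCoeff w (perLaurent w F a) A = topC w (a A) := by
  rw [topCoeff, coeff_perLaurent, if_pos rfl, if_neg (by omega), Finset.sum_eq_zero]
  · ring
  · intro n hn
    have := Finset.mem_range.mp hn
    rw [if_neg (by omega)]

theorem perLaurent_mem_extV (w : ℕ) (F : SL(2, ℤ) → ℂ → ℂ) (a : SL(2, ℤ) → ℂ) (A : SL(2, ℤ)) :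
    perLaurent w F a A ∈ extV w := by
  intro m hm
  by_contra hc
  apply hm
  rw [coeff_perLaurent, if_neg (by omega), if_neg (by omega), Finset.sum_eq_zero]
  · ring
  · intro n hn
    have := Finset.mem_range.mp hn
    rw [if_neg (by omega)]

/-- Multiplication by z clears the pole, leaving polynomials of degree at most w + 2 that agree at
infinitely many points. This identifies the polynomial picked by choice in `extPeriodPoly`. -/
theorem eq_of_laurentEval_eq {w : ℕ} {P Q : ℂ[T;T⁻¹]} (hP : P ∈ extV w) (hQ : Q ∈ extV w)
    (h : ∀ z : ℍ, laurentEval P z = laurentEval Q z) : P = Q := by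
  have key : ∀ P ∈ extV w, ∀ z : ℍ, (z : ℂ) * laurentEval P z =
      (∑ n ∈ Finset.range (w + 3), monomial n (P.coeff ((n : ℤ) - 1))).eval (z : ℂ) := by
    intro P hP z
    have hz : (z : ℂ) ≠ 0 := z.ne_zero
    rw [laurentEval, Finsupp.sum_of_support_subset (s := (Finset.range (w + 3)).image
      fun n : ℕ => (n : ℤ) - 1), Finset.sum_image, Finset.mul_sum, eval_finsetSum]
    · refine Finset.sum_congr rfl fun n _ => ?_
      rw [eval_monomial, zpow_sub_one₀ hz, zpow_natCast]
      field_simp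
    · intro m _ n _ hmn
      simpa using hmn
    · intro m hm
      have := hP m (Finsupp.mem_support_iff.mp hm)
      refine Finset.mem_image.mpr ⟨(m + 1).toNat, Finset.mem_range.mpr (by omega), by omega⟩
    · simp
  have hpoly : (∑ n ∈ Finset.range (w + 3), monomial n (P.coeff ((n : ℤ) - 1))) =
      ∑ n ∈ Finset.range (w + 3), monomial n (Q.coeff ((n : ℤ) - 1)) := by
    refine Polynomial.eq_of_infinite_eval_eq _ _ (Set.Infinite.mono
      (s := Set.range fun z : ℍ => (z : ℂ)) ?_ ?_)
    · rintro _ ⟨z, rfl⟩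
      change eval (z : ℂ) _ = eval (z : ℂ) _
      rw [← key P hP, ← key Q hQ, h]
    · refine Set.infinite_of_injective_forall_mem (f := fun n : ℕ => ((n : ℂ) + 1) * Complex.I)
        ?_ fun n => ⟨⟨((n : ℂ) + 1) * Complex.I, ?_⟩, rfl⟩
      · intro m n hmn
        simpa [Complex.I_ne_zero] using hmn
      · simp
        positivity
  ext m
  by_cases hm : -1 ≤ m ∧ m ≤ (w : ℤ) + 1
  · have := congrArg (fun p => Polynomial.coeff p (m + 1).toNat) hpoly
    simp only [finsetSum_coeff, coeff_monomial] at this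
    rw [Finset.sum_ite_eq', Finset.sum_ite_eq', if_pos (Finset.mem_range.mpr (by omega)),
      if_pos (Finset.mem_range.mpr (by omega))] at this
    have e : ((m + 1).toNat : ℤ) - 1 = m := by omega
    rwa [e] at this
  · have h1 : P.coeff m = 0 := by
      by_contra hc; exact hm (hP m hc)
    have h2 : Q.coeff m = 0 := by
      by_contra hc; exact hm (hQ m hc)
    rw [h1, h2]

end ModularFamilies

/-! ### From modular forms to modular families -/

noncomputable section FromModularForm

open scoped Manifold

/-- The family `A ↦ f|A` on `ℂ`. -/
def slashFam (k : ℕ) (f : ℍ → ℂ) (A : SL(2, ℤ)) (z : ℂ) : ℂ := (f ∣[(k : ℤ)] A) (ofComplex z)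

theorem slashFam_coe (k : ℕ) (f : ℍ → ℂ) (A : SL(2, ℤ)) (z : ℍ) :
    slashFam k f A z = (f ∣[(k : ℤ)] A) z := by
  rw [slashFam, ofComplex_apply]

theorem coe_T_smul (z : ℍ) : ((ModularGroup.T • z : ℍ) : ℂ) = z + 1 := by
  rw [modular_T_smul, coe_vadd]
  push_cast
  ring

theorem coe_S_smul (z : ℍ) : ((ModularGroup.S • z : ℍ) : ℂ) = -1 / z := by
  rw [modular_S_smul]
  change (-(z : ℂ))⁻¹ = _
  rw [inv_neg, neg_div, one_div]

theorem slash_T_apply (m : ℤ) (f : ℍ → ℂ) (z : ℍ) :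
    (f ∣[m] ModularGroup.T) z = f (ModularGroup.T • z) := by
  rw [ModularForm.SL_slash_apply, ModularGroup.denom_apply]
  simp [ModularGroup.T]

theorem slash_S_apply (m : ℤ) (f : ℍ → ℂ) (z : ℍ) :
    (f ∣[m] ModularGroup.S) z = f (ModularGroup.S • z) * (z : ℂ) ^ (-m) := by
  rw [ModularForm.SL_slash_apply, ModularGroup.denom_apply]
  simp [ModularGroup.S]

theorem slash_neg_one_apply (m : ℤ) (f : ℍ → ℂ) (z : ℍ) :
    (f ∣[m] (-1 : SL(2, ℤ))) z = (-1) ^ (-m) * f z := by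
  rw [ModularForm.SL_slash_apply, mul_comm]
  congr 2
  · simp [denom]
  · simp

theorem mem_upperHalf (z : ℍ) : (z : ℂ) ∈ upperHalf := z.im_pos

variable {Γ : Subgroup SL(2, ℤ)} {w : ℕ}

theorem slash_eq_of_mem {k : ℤ} (f : ModularForm (Γ : Subgroup (GL (Fin 2) ℝ)) k)
    {γ : SL(2, ℤ)} (hγ : γ ∈ Γ) : ⇑f ∣[k] γ = f :=
  f.slash_action_eq' _ (Subgroup.mem_map_of_mem _ hγ)

theorem mdiff_slash {k : ℤ} (f : ModularForm (Γ : Subgroup (GL (Fin 2) ℝ)) k) (A : SL(2, ℤ)) :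
    MDiff (⇑f ∣[k] A) :=
  (ModularFormClass.holo f).slash k (A : GL (Fin 2) ℝ)

theorem IsModFam.perLaurent_inv {F : SL(2, ℤ) → ℂ → ℂ} {a : SL(2, ℤ) → ℂ}
    (h : IsModFam Γ w F a) {γ : SL(2, ℤ)} (hγ : γ ∈ Γ) (A : SL(2, ℤ)) :
    perLaurent w F a (γ * A) = perLaurent w F a A := by
  simp only [perLaurent, h.perPoly_mem.2.1 γ hγ, h.a_inv γ hγ, mul_assoc]

theorem IsModFam.perLaurent_neg {F : SL(2, ℤ) → ℂ → ℂ} {a : SL(2, ℤ) → ℂ}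
    (h : IsModFam Γ w F a) (A : SL(2, ℤ)) :
    perLaurent w F a (-A) = (-1 : ℂ) ^ w • perLaurent w F a A := by
  have h1 := h.perPoly_mem.2.2 A
  have h2 : ∀ A, topC w (a (-A)) = (-1) ^ w * topC w (a A) := h.isTopCoeff.neg
  simp only [perLaurent, h1, neg_mul, h2, smul_add, Finset.smul_sum, AddMonoidAlgebra.smul_single,
    smul_eq_mul, Polynomial.coeff_smul]

variable [Γ.FiniteIndex]

theorem isBoundedAtImInfty_slash {k : ℤ} (f : ModularForm (Γ : Subgroup (GL (Fin 2) ℝ)) k)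
    (A : SL(2, ℤ)) : IsBoundedAtImInfty (⇑f ∣[k] A) := by
  have hc : IsCusp ((A : GL (Fin 2) ℝ) • OnePoint.infty) (Γ : Subgroup (GL (Fin 2) ℝ)) := by
    rw [Subgroup.IsArithmetic.isCusp_iff_isCusp_SL2Z]
    exact isCusp_SL2Z_iff'.mpr ⟨A, rfl⟩
  exact f.bdd_at_cusps' hc _ rfl

theorem slash_T_pow_apply (m : ℤ) (f : ℍ → ℂ) (n : ℕ) (z : ℍ) :
    (f ∣[m] (ModularGroup.T ^ n)) z = f ((n : ℝ) +ᵥ z) := by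
  induction n generalizing z with
  | zero => simp [SlashAction.slash_one]
  | succ n ih =>
    rw [pow_succ, SlashAction.slash_mul, slash_T_apply, ih]
    congr 1
    ext1
    rw [coe_vadd, coe_vadd, coe_T_smul]
    push_cast
    ring

/-- By finite index, some positive power of A T A⁻¹ lies in Γ, and its exponent is a period of f|A.
-/
theorem exists_periodic_slash {k : ℤ} (f : ModularForm (Γ : Subgroup (GL (Fin 2) ℝ)) k)
    (A : SL(2, ℤ)) : ∃ N : ℕ, 0 < N ∧ Function.Periodic ((⇑f ∣[k] A) ∘ ofComplex) (N : ℝ) := by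
  obtain ⟨N, hN, hmem⟩ := Subgroup.exists_pow_mem_of_index_ne_zero
    (Subgroup.FiniteIndex.index_ne_zero (H := Γ)) (A * ModularGroup.T * A⁻¹)
  refine ⟨N, hN, fun z => ?_⟩
  have h1 : (⇑f ∣[k] A) ∣[k] (ModularGroup.T ^ N) = ⇑f ∣[k] A := by
    rw [conj_pow] at hmem
    have h2 := slash_eq_of_mem f hmem.2
    conv_rhs => rw [← h2]
    rw [← SlashAction.slash_mul, ← SlashAction.slash_mul, inv_mul_cancel_right]
  simp only [Function.comp_apply]
  by_cases hz : 0 < z.im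
  · have h2 := congrFun h1 (ofComplex z)
    rw [slash_T_pow_apply] at h2
    rw [← h2]
    refine congrArg (⇑f ∣[k] A) (UpperHalfPlane.ext ?_)
    rw [coe_vadd, ofComplex_apply_of_im_pos hz, ofComplex_apply_of_im_pos (by simpa using hz)]
    push_cast
    ring
  · rw [ofComplex_apply_of_im_nonpos (not_lt.mp hz),
      ofComplex_apply_of_im_nonpos (by simpa using hz)]

theorem expDecay_slashFam {k : ℕ} (f : ModularForm (Γ : Subgroup (GL (Fin 2) ℝ)) (k : ℤ))
    (A : SL(2, ℤ)) : ExpDecay fun z => slashFam k f A z - constTerm k f A := by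
  obtain ⟨N, hN, hper⟩ := exists_periodic_slash f A
  have h := exp_decay_sub_atImInfty (by exact_mod_cast hN) hper (mdiff_slash f A)
    (isBoundedAtImInfty_slash f A)
  obtain ⟨C, hC⟩ := h.bound
  obtain ⟨B, hB⟩ := atImInfty_mem _ |>.mp hC
  intro M
  have hN' : (0 : ℝ) < N := by exact_mod_cast hN
  refine ⟨2 * Real.pi / N, by positivity, |C|, abs_nonneg _, max B 1, le_max_right _ _,
    fun z _ hz => ?_⟩
  have hz0 : 0 < z.im := lt_of_lt_of_le one_pos ((le_max_right _ _).trans hz)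
  have := hB ⟨z, hz0⟩ ((le_max_left _ _).trans hz)
  rw [Set.mem_ofPred_eq] at this
  simp only [slashFam, ofComplex_apply_of_im_pos hz0]
  refine this.trans ?_
  rw [Real.norm_of_nonneg (Real.exp_pos _).le]
  have e : -(2 * Real.pi / N) * z.im = -2 * Real.pi * (UpperHalfPlane.im ⟨z, hz0⟩) / N := by
    change _ = -2 * Real.pi * z.im / N
    ring
  rw [e]
  gcongr
  exact le_abs_self C

theorem tendsto_constTerm {k : ℕ} (f : ModularForm (Γ : Subgroup (GL (Fin 2) ℝ)) (k : ℤ))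
    (A : SL(2, ℤ)) : Tendsto (⇑f ∣[(k : ℤ)] A) atImInfty (𝓝 (constTerm k f A)) := by
  obtain ⟨N, hN, hper⟩ := exists_periodic_slash f A
  have hN' : (0 : ℝ) < N := by exact_mod_cast hN
  have ha := analyticAt_cuspFunction_zero hN' hper (mdiff_slash f A) (isBoundedAtImInfty_slash f A)
  have hv := cuspFunction_apply_zero hN' ha hper
  have := ha.continuousAt.tendsto.comp (qParam_tendsto_atImInfty hN')
  rw [hv] at this
  refine this.congr fun τ => ?_
  simpa using eq_cuspFunction τ hN'.ne' hper

theorem isModFam_slashFam (f : ModularForm (Γ : Subgroup (GL (Fin 2) ℝ)) ((w + 2 : ℕ) : ℤ)) :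
    IsModFam Γ w (slashFam (w + 2) f) (constTerm (w + 2) f) where
  diff A := mdifferentiable_iff.mp (mdiff_slash f A)
  inv γ hγ A := by
    ext1 z
    rw [slashFam, slashFam, SlashAction.slash_mul, slash_eq_of_mem f hγ]
  neg A z := by
    rw [slashFam, slashFam, ← mul_neg_one, SlashAction.slash_mul, slash_neg_one_apply]
    congr 1
    rw [zpow_neg, zpow_natCast, pow_add]
    simp [← inv_pow]
  mul_T A z hz := by
    rw [slashFam, slashFam, SlashAction.slash_mul, slash_T_apply]
    refine congrArg _ (UpperHalfPlane.ext ?_)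
    rw [coe_T_smul, ofComplex_apply_of_im_pos hz,
      ofComplex_apply_of_im_pos (add_one_mem_upperHalf hz)]
  mul_S A z hz := by
    have h0 := ne_zero_of_mem_upperHalf hz
    rw [slashFam, slashFam, SlashAction.slash_mul, slash_S_apply, ofComplex_apply_of_im_pos hz,
      mul_assoc]
    have e1 : ofComplex (-1 / z) = ModularGroup.S • (⟨z, hz⟩ : ℍ) := by
      ext1
      rw [coe_S_smul, ofComplex_apply_of_im_pos (neg_one_div_mem_upperHalf hz)]
    rw [e1, zpow_neg, zpow_natCast]
    change _ * ((z ^ (w + 2))⁻¹ * z ^ (w + 2)) = _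
    rw [inv_mul_cancel₀ (pow_ne_zero _ h0), mul_one]
  decay A := expDecay_slashFam f A

/-! ### The Eichler integral and the extended period polynomial -/

theorem eichlerIntegrand_eq (f : ℍ → ℂ) (A : SL(2, ℤ)) (z : ℍ) (s : ℝ) :
    eichlerIntegrand (w + 2) f A z s =
      (slashFam (w + 2) f A ((z : ℂ) + s * Complex.I) - constTerm (w + 2) f A) *
        ((Polynomial.X - Polynomial.C (z : ℂ)) ^ w).eval ((z : ℂ) + s * Complex.I) * Complex.I := by
  simp [eichlerIntegrand, slashFam]

theorem integrableOn_eichlerIntegrand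
    (f : ModularForm (Γ : Subgroup (GL (Fin 2) ℝ)) ((w + 2 : ℕ) : ℤ)) (A : SL(2, ℤ)) (z : ℍ) :
    IntegrableOn (eichlerIntegrand (w + 2) f A z) (Set.Ioi 0) := by
  have h := isModFam_slashFam f
  have := (integrableOn_vertical (differentiableOn_mul_eval (a := constTerm (w + 2) f A) (h.diff A)
    ((Polynomial.X - Polynomial.C (z : ℂ)) ^ w)).continuousOn ((h.decay A).mul_eval _)
    (mem_upperHalf z)).mul_const Complex.I
  refine this.congr (Eventually.of_forall fun s => ?_)
  exact (eichlerIntegrand_eq _ A z s).symm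

theorem eichler_eq (f : ℍ → ℂ) (A : SL(2, ℤ)) (z : ℍ) :
    eichler (w + 2) f A z =
      -eichPrim w (slashFam (w + 2) f A) (constTerm (w + 2) f A) z z := by
  rw [eichler, eichPrim, polyPrim, vInt]
  simp only [eichlerIntegrand_eq, sub_self]
  simp

theorem famSlash_mul (m : ℤ) (g h : SL(2, ℤ)) (Φ : SL(2, ℤ) → ℍ → ℂ) :
    famSlash m (g * h) Φ = famSlash m h (famSlash m g Φ) := by
  ext1 A
  simp only [famSlash, SlashAction.slash_mul, mul_inv_rev, mul_assoc]

theorem famSlash_sub (m : ℤ) (g : SL(2, ℤ)) (Φ Ψ : SL(2, ℤ) → ℍ → ℂ) :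
    famSlash m g (Φ - Ψ) = famSlash m g Φ - famSlash m g Ψ := by
  ext A z
  simp [famSlash, ModularForm.SL_slash_apply, sub_mul]

theorem famSlash_S_apply (Φ : SL(2, ℤ) → ℍ → ℂ) (A : SL(2, ℤ)) (z : ℍ) :
    famSlash (-(w : ℤ)) ModularGroup.S Φ A z =
      Φ (A * ModularGroup.S⁻¹) (ModularGroup.S • z) * (z : ℂ) ^ w := by
  rw [famSlash, slash_S_apply, neg_neg, zpow_natCast]

theorem famSlash_T_eichler (f : ModularForm (Γ : Subgroup (GL (Fin 2) ℝ)) ((w + 2 : ℕ) : ℤ)) :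
    famSlash (-(w : ℤ)) ModularGroup.T (eichler (w + 2) f) = eichler (w + 2) f := by
  ext A z
  rw [famSlash, slash_T_apply, eichler_eq, eichler_eq, coe_T_smul,
    (isModFam_slashFam f).eichPrim_add_one A _ (mem_upperHalf z)]

theorem famSlash_neg_one_eichler
    (f : ModularForm (Γ : Subgroup (GL (Fin 2) ℝ)) ((w + 2 : ℕ) : ℤ)) :
    famSlash (-(w : ℤ)) (-1) (eichler (w + 2) f) = eichler (w + 2) f := by
  have h := isModFam_slashFam f
  ext A z
  have h1 : A * (-1 : SL(2, ℤ))⁻¹ = -A := by simp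
  have h2 : eichler (w + 2) f (-A) z = (-1) ^ w * eichler (w + 2) f A z := by
    rw [eichler, eichler, ← integral_const_mul]
    congr 1
    ext1 s
    rw [eichlerIntegrand_eq, eichlerIntegrand_eq, h.neg, h.a_neg]
    ring
  rw [famSlash, h1, slash_neg_one_apply, h2, neg_neg, zpow_natCast, ← mul_assoc, ← mul_pow]
  simp

theorem periodFun_eq (f : ModularForm (Γ : Subgroup (GL (Fin 2) ℝ)) ((w + 2 : ℕ) : ℤ))
    (A : SL(2, ℤ)) (z : ℍ) :
    periodFun (w + 2) f A z =
      laurentEval (perLaurent w (slashFam (w + 2) f) (constTerm (w + 2) f) A) z := by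
  have h := isModFam_slashFam f
  rw [laurentEval_perLaurent, h.perFun_eq A (mem_upperHalf z) (UpperHalfPlane.ne_zero z)]
  change eichler (w + 2) f A z - famSlash (-(w : ℤ)) ModularGroup.S (eichler (w + 2) f) A z = _
  rw [famSlash_S_apply, eichler_eq, eichler_eq, coe_S_smul]
  ring

theorem extPeriodPoly_eq (f : ModularForm (Γ : Subgroup (GL (Fin 2) ℝ)) ((w + 2 : ℕ) : ℤ)) :
    extPeriodPoly (w + 2) f = perLaurent w (slashFam (w + 2) f) (constTerm (w + 2) f) := by
  have hex : ∃ P : SL(2, ℤ) → ℂ[T;T⁻¹],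
      (∀ A, P A ∈ extV (w + 2 - 2)) ∧ ∀ A z, laurentEval (P A) z = periodFun (w + 2) f A z :=
    ⟨_, perLaurent_mem_extV w _ _, fun A z => (periodFun_eq f A z).symm⟩
  rw [extPeriodPoly, dif_pos hex]
  ext1 A
  refine eq_of_laurentEval_eq (hex.choose_spec.1 A) (perLaurent_mem_extV w _ _ A) fun z => ?_
  rw [hex.choose_spec.2, periodFun_eq]

/-- The Eichler integral e is fixed by T and by -1, and the period function is e|(1 - S). So 1 + S
annihilates it because S² = -1, and the U-relation telescopes because e|U = e|S, e|U² = e|SU, and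
e|SU² = e. -/
theorem isExtPeriodPoly_extPeriodPoly
    (f : ModularForm (Γ : Subgroup (GL (Fin 2) ℝ)) ((w + 2 : ℕ) : ℤ)) :
    IsExtPeriodPoly Γ w (extPeriodPoly (w + 2) f) := by
  have h := isModFam_slashFam f
  rw [extPeriodPoly_eq]
  have he : (fun A => laurentEval (perLaurent w (slashFam (w + 2) f) (constTerm (w + 2) f) A)) =
      eichler (w + 2) f - famSlash (-(w : ℤ)) ModularGroup.S (eichler (w + 2) f) := by
    ext A z
    rw [← periodFun_eq]
    rfl
  set e := eichler (w + 2) f with hedef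
  have hT : famSlash (-(w : ℤ)) ModularGroup.T e = e := famSlash_T_eichler f
  have hneg : famSlash (-(w : ℤ)) (-1) e = e := famSlash_neg_one_eichler f
  refine ⟨perLaurent_mem_extV w _ _, fun γ hγ A => h.perLaurent_inv hγ A,
    fun A => h.perLaurent_neg A, ?_, ?_⟩
  · rw [he, famSlash_sub, ← famSlash_mul,
      show ModularGroup.S * ModularGroup.S = (-1 : SL(2, ℤ)) by decide, hneg]
    abel
  · have h1 : famSlash (-(w : ℤ)) (ModularGroup.T * ModularGroup.S) e =
        famSlash (-(w : ℤ)) ModularGroup.S e := by rw [famSlash_mul, hT]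
    have h2 : famSlash (-(w : ℤ)) ((ModularGroup.T * ModularGroup.S) ^ 2) e =
        famSlash (-(w : ℤ)) (ModularGroup.S * (ModularGroup.T * ModularGroup.S)) e := by
      rw [pow_two, mul_assoc, famSlash_mul, hT]
    have h3 : famSlash (-(w : ℤ)) (ModularGroup.S * (ModularGroup.T * ModularGroup.S) ^ 2) e =
        e := by
      -- This is U³ = -1; the leading T is inserted at no cost since e|T = e.
      have : ModularGroup.T * (ModularGroup.S * (ModularGroup.T * ModularGroup.S) ^ 2) =
        (-1 : SL(2, ℤ)) := by decide
      rw [← hT, ← famSlash_mul, this, hneg, hT]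
    rw [he, famSlash_sub, famSlash_sub, ← famSlash_mul, ← famSlash_mul, h1, h2, h3]
    abel

end FromModularForm

/-! ### The extended pairing as an arc integral -/

noncomputable section PairingAsArcIntegral

open Polynomial

variable {Γ : Subgroup SL(2, ℤ)} {w : ℕ}

/-- The extended pairing of `P + c X^{w+1}|(1 - S)` and `P' + c' X^{w+1}|(1 - S)`. -/
def coeffPair (Γ : Subgroup SL(2, ℤ)) (w : ℕ) (P : SL(2, ℤ) → ℂ[X]) (c : SL(2, ℤ) → ℂ)
    (P' : SL(2, ℤ) → ℂ[X]) (c' : SL(2, ℤ) → ℂ) : ℂ :=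
  famPair Γ w (famT 1 P - famT (-1) P) P' -
      2 * famPair Γ w (diffFam w c + famT (-1) (diffFam w c)) P' +
    2 * famPair Γ w P (diffFam w c' + famT (-1) (diffFam w c')) +
    3 * (((w : ℂ) + 1) / (w + 2)) * (1 - (-1) ^ w) * cosetAvg Γ fun A => c A * c' A

theorem famTranslate_monomial {c : SL(2, ℤ) → ℂ} (hc : IsTopCoeff Γ w c) :
    famTranslate 1 (fun A => monomial (w + 1) (c A)) -
        famTranslate (-1) (fun A => monomial (w + 1) (c A)) =
      -(diffFam w c + famT (-1) (diffFam w c)) := by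
  ext1 A
  have h1 : A * ModularGroup.T ^ (-1 : ℤ) = A * ModularGroup.T⁻¹ := by simp
  have h2 : A * ModularGroup.T ^ (- -1 : ℤ) = A * ModularGroup.T := by simp
  simp only [Pi.sub_apply, Pi.neg_apply, Pi.add_apply, famTranslate, famT_apply, diffFam, h1, h2,
    hc.mul_T, hc.mul_T_inv, monomial_comp, neg_comp, diffPoly, sub_comp, pow_comp, add_comp,
    X_comp, C_comp, smul_eq_C_mul, Int.cast_one, Int.cast_neg, C_neg, mul_comp]
  rw [show (X + -C 1 + C 1 : ℂ[X]) = X by ring]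
  ring

/-- By T-invariance of c, the action of T - T⁻¹ on the top term is -(N + N|T⁻¹) with N = c
X^{w+1}|(1 - T), a family of degree at most w to which the invariance of the pairing applies. -/
theorem extPair_eq_coeffPair [Γ.FiniteIndex] {P Q : SL(2, ℤ) → ℂ[T;T⁻¹]}
    (hP : IsTopCoeff Γ w (topCoeff w P)) (hQ : IsTopCoeff Γ w (topCoeff w Q)) :
    extPair Γ (w + 2) P Q =
      coeffPair Γ w (polyPart w P) (topCoeff w P) (polyPart w Q) (topCoeff w Q) := by
  have h1 := famTranslate_monomial hP
  have h2 := famTranslate_monomial hQ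
  have e1 : ∀ (c : ℂ) (P Q : SL(2, ℤ) → ℂ[X]), famPair Γ w (c • P) Q = c * famPair Γ w P Q :=
    fun c P Q => LinearMap.congr_fun ((famBilin Γ w).map_smul c P) Q
  have e2 : ∀ (c : ℂ) (P Q : SL(2, ℤ) → ℂ[X]), famPair Γ w P (c • Q) = c * famPair Γ w P Q :=
    fun c P Q => (famBilin Γ w P).map_smul c Q
  -- The factor 1 - (-1)^w is 0 for even w and 2 for odd w, so it merges the two cases of I_k, with
  -- k - 1 = w + 1 and k = w + 2.
  have e3 : oddTerm Γ (w + 2) P Q = 3 * (((w : ℂ) + 1) / (w + 2)) * (1 - (-1) ^ w) *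
      cosetAvg Γ fun A => topCoeff w P A * topCoeff w Q A := by
    rw [oddTerm, Nat.add_sub_cancel]
    rcases Nat.even_or_odd w with h | h
    · rw [if_pos (h.add even_two), h.neg_one_pow]
      ring
    · rw [if_neg (Nat.not_even_iff_odd.mpr (h.add_even even_two)), h.neg_one_pow]
      push_cast
      ring
  have e4 : (2 : ℂ) • (famTranslate 1 (topPart w P) - famTranslate (-1) (topPart w P)) =
      (-2 : ℂ) • (diffFam w (topCoeff w P) + famT (-1) (diffFam w (topCoeff w P))) := by
    have h3 := congrArg ((2 : ℂ) • ·) h1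
    refine h3.trans ?_
    module
  have e5 : (2 : ℂ) • (famTranslate (-1) (topPart w Q) - famTranslate 1 (topPart w Q)) =
      (2 : ℂ) • (diffFam w (topCoeff w Q) + famT (-1) (diffFam w (topCoeff w Q))) := by
    rw [← neg_neg (diffFam w (topCoeff w Q) + _), ← h2, neg_sub]
    rfl
  rw [extPair, e3, Nat.add_sub_cancel, e4, e5, e1, e2, coeffPair]
  simp only [neg_mul, ← sub_eq_add_neg]
  rfl

/-- The components `P`, `c X^{w+1}` of an extended period polynomial with a potential `β`. -/
structure IsPeriodData (Γ : Subgroup SL(2, ℤ)) (w : ℕ) (P : SL(2, ℤ) → ℂ[X])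
    (c : SL(2, ℤ) → ℂ) : Prop where
  mem : P ∈ polyFam Γ w
  top : IsTopCoeff Γ w c
  famS_eq : famS w P = -P
  potential : ∃ β ∈ polyFam Γ w, famS w β = famT 1 β + P + diffFam w c

namespace IsModFam

variable {G : SL(2, ℤ) → ℂ → ℂ} {b : SL(2, ℤ) → ℂ}

theorem isPeriodData (hG : IsModFam Γ w G b) :
    IsPeriodData Γ w (perPoly w G b) fun A => topC w (b A) where
  mem := hG.perPoly_mem
  top := hG.isTopCoeff
  famS_eq := hG.famS_perPoly
  potential := ⟨_, hG.eichFam_mem _, hG.famS_eichFam_etaPt⟩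

/-- The substitution `z ↦ -1/z` in arc integrals of families. -/
theorem cosetAvg_arcInt_S (hG : IsModFam Γ w G b) {Φ : SL(2, ℤ) → ℂ → ℂ}
    (h1 : ∀ γ ∈ Γ, ∀ A, ∀ z ∈ upperHalf, Φ (γ * A) z = Φ A z)
    (h2 : ∀ A, ∀ z ∈ upperHalf, Φ (-A) z = (-1) ^ w * Φ A z) :
    (cosetAvg Γ fun A => arcInt fun z => Φ (A * ModularGroup.S⁻¹) (-1 / z) * z ^ w * G A z) =
      -cosetAvg Γ fun A => arcInt fun z => Φ A z * G A z := by
  have hinv : CosetInv Γ fun A => arcInt fun z => Φ A z * G A z := by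
    refine ⟨fun γ hγ A => arcInt_congr fun z hz => ?_, fun A => arcInt_congr fun z hz => ?_⟩
    · rw [h1 γ hγ A z hz, hG.inv γ hγ]
    · rw [h2 A z hz, hG.neg, mul_mul_mul_comm, ← mul_pow]
      simp
  rw [← cosetAvg_mul_right hinv ModularGroup.S⁻¹, ← cosetAvg_neg]
  congr 1
  ext1 A
  rw [← arcInt_neg_one_div]
  refine arcInt_congr fun z hz => ?_
  have h0 := ne_zero_of_mem_upperHalf hz
  rw [hG.mul_S_inv A hz]
  field_simp
  ring

/-- The arc integral is a difference of pairings at ρ and η. The S-relation between the two corner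
polynomials, with P|S = -P and invariance of the pairing, expresses the value at ρ by the one at η.
-/
theorem cosetAvg_arcInt_poly [Γ.FiniteIndex] (hG : IsModFam Γ w G b) {P : SL(2, ℤ) → ℂ[X]}
    (hP : P ∈ polyFam Γ w) (hS : famS w P = -P) :
    (cosetAvg Γ fun A => arcInt fun z => (P A).eval z * G A z) =
      -2 * famPair Γ w P (eichFam w G b etaPt) - famPair Γ w P (perPoly w G b) := by
  have h1 : (cosetAvg Γ fun A => arcInt fun z => (P A).eval z * G A z) =
      famPair Γ w P (eichFam w G b rhoPt) - famPair Γ w P (eichFam w G b etaPt) := by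
    rw [famPair, famPair, ← cosetAvg_sub]
    congr 1
    ext1 A
    exact arcInt_eval_mul (hG.diff A) (hG.decay A) (hP.1 A)
  have h2 : -1 / rhoPt = etaPt := by
    rw [← neg_one_div_etaPt]
    field_simp
  have h3 := hG.famS_eichFam rhoPt_mem
  rw [h2] at h3
  have h4 : famPair Γ w P (famS w (eichFam w G b etaPt)) =
      famPair Γ w P (eichFam w G b rhoPt) + famPair Γ w P (perPoly w G b) := by
    rw [h3]
    exact (famBilin Γ w P).map_add _ _
  have h5 : famPair Γ w P (famS w (eichFam w G b etaPt)) =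
      -famPair Γ w P (eichFam w G b etaPt) := by
    rw [← famPair_famS hP (famS_mem (hG.eichFam_mem etaPt)), famS_famS (hG.eichFam_mem etaPt), hS]
    exact LinearMap.congr_fun ((famBilin Γ w).map_neg P) _
  rw [h1]
  linear_combination -h4 + h5

/-- A primitive of c z^{w+1}G is c times the moment of order w + 1. In the average its values at ρ
and at η = ρ + 1 are compared through T, so only the translation defect of the moment survives. -/
theorem cosetAvg_arcInt_top [Γ.FiniteIndex] (hG : IsModFam Γ w G b) {c : SL(2, ℤ) → ℂ}
    (hc : IsTopCoeff Γ w c) :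
    (cosetAvg Γ fun A => arcInt fun z => c A * z ^ (w + 1) * G A z) =
      famPair Γ w (diffFam w c) (eichFam w G b rhoPt) -
        (cosetAvg Γ fun A => c A * b A) / (w + 2) := by
  have h1 : ∀ A, (arcInt fun z => c A * z ^ (w + 1) * G A z) =
      c A * momPrim (G A) (b A) (w + 1) rhoPt - c A * momPrim (G A) (b A) (w + 1) etaPt := by
    intro A
    refine arcInt_eq_sub (K := fun z => c A * momPrim (G A) (b A) (w + 1) z) ?_ fun z hz => ?_
    · exact (continuousOn_const.mul (by fun_prop)).mul (hG.diff A).continuousOn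
    · exact ((hasDerivAt_momPrim (hG.diff A) (hG.decay A) _ hz).const_mul _).congr_deriv (by ring)
  have hinv : CosetInv Γ fun A => c A * momPrim (G A) (b A) (w + 1) rhoPt := by
    refine ⟨fun γ hγ A => ?_, fun A => ?_⟩
    · simp only [hc.inv γ hγ, hG.inv γ hγ, hG.a_inv γ hγ]
    · have h3 : momPrim (G (-A)) (b (-A)) (w + 1) rhoPt =
          (-1) ^ w * momPrim (G A) (b A) (w + 1) rhoPt := by
        rw [momPrim, momPrim, hG.polyPrim_neg, hG.a_neg]
        ring
      simp only [h3]
      rw [hc.neg, mul_mul_mul_comm, ← mul_pow]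
      simp
  have hinv2 := cosetInv_polyPair (diffFam_mem hc) (hG.eichFam_mem rhoPt)
  simp only [h1]
  -- Replacing A by A T only in the ρ term matches G(A T)(t) = G(A)(t + 1), the situation of
  -- `momPrim_add_one_sub`.
  rw [cosetAvg_sub, ← cosetAvg_mul_right hinv ModularGroup.T, ← cosetAvg_sub, famPair,
    ← cosetAvg_mul_right hinv2 ModularGroup.T, div_eq_mul_inv, mul_comm _ (_⁻¹ : ℂ),
    ← cosetAvg_mul_left, ← cosetAvg_sub]
  congr 1
  ext1 A
  have h2 := momPrim_add_one_sub (f := G A) (a := b A) w (hG.diff (A * ModularGroup.T))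
    (by simpa only [hG.a_mul_T] using hG.decay (A * ModularGroup.T))
    (fun t ht => hG.mul_T A t ht) rhoPt_mem
  rw [rhoPt_add_one] at h2
  simp only [hc.mul_T, hG.a_mul_T, diffFam, eichFam, polyPair_smul_left]
  linear_combination (-c A) * h2

/-- The extended pairing with an extended period polynomial, as an integral over the arc. -/
theorem cosetAvg_arcInt_eq_coeffPair [Γ.FiniteIndex] (hG : IsModFam Γ w G b)
    {P : SL(2, ℤ) → ℂ[X]} {c : SL(2, ℤ) → ℂ} (hP : IsPeriodData Γ w P c) :
    (3 * cosetAvg Γ fun A => arcInt fun z => ((P A).eval z + c A * z ^ (w + 1) +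
        (-1) ^ w * c (A * ModularGroup.S⁻¹) * z⁻¹) * G A z) =
      coeffPair Γ w P c (perPoly w G b) fun A => topC w (b A) := by
  obtain ⟨β, mβ, hβ⟩ := hP.potential
  have hc := hP.top
  have h1 : (cosetAvg Γ fun A => arcInt fun z => ((P A).eval z + c A * z ^ (w + 1) +
        (-1) ^ w * c (A * ModularGroup.S⁻¹) * z⁻¹) * G A z) =
      (cosetAvg Γ fun A => arcInt fun z => (P A).eval z * G A z) +
      2 * cosetAvg Γ fun A => arcInt fun z => c A * z ^ (w + 1) * G A z := by
    -- The X^{-1} term is minus the S-image of the top term, and reversing the arc supplies a second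
    -- minus sign; hence it contributes as much as the top term and gives the factor 2.
    have e1 := hG.cosetAvg_arcInt_S (Φ := fun A z => c A * z ^ (w + 1))
      (fun γ hγ A z _ => by rw [hc.inv γ hγ]) (fun A z _ => by rw [hc.neg, mul_assoc])
    rw [two_mul]
    nth_rewrite 2 [← neg_neg (cosetAvg Γ fun A => arcInt fun z => c A * z ^ (w + 1) * G A z)]
    rw [← e1, ← cosetAvg_neg, ← cosetAvg_add, ← cosetAvg_add]
    congr 1
    ext1 A
    have hcont := (hG.diff A).continuousOn
    have hne : ∀ z ∈ upperHalf, z ≠ 0 := fun z hz => ne_zero_of_mem_upperHalf hz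
    have hi : ContinuousOn (fun z : ℂ => z⁻¹) upperHalf := continuousOn_inv₀.mono hne
    have e2 : -(arcInt fun z => c (A * ModularGroup.S⁻¹) * (-1 / z) ^ (w + 1) * z ^ w * G A z) =
        arcInt fun z => (-1) ^ w * c (A * ModularGroup.S⁻¹) * z⁻¹ * G A z := by
      rw [← neg_one_mul, ← arcInt_const_mul]
      refine arcInt_congr fun z hz => ?_
      have h0 := hne z hz
      rw [div_pow, pow_succ z, pow_succ (-1 : ℂ)]
      field_simp
    rw [e2, ← arcInt_add, ← arcInt_add]
    · simp only [add_mul, add_assoc]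
    all_goals fun_prop
  have h2 : -1 / rhoPt = etaPt := by
    rw [← neg_one_div_etaPt]
    field_simp
  have h3 := hG.famS_eichFam rhoPt_mem
  rw [h2, hG.famS_eichFam_etaPt] at h3
  have h4 : eichFam w G b rhoPt =
      famT 1 (eichFam w G b etaPt) + diffFam w (fun A => topC w (b A)) := by
    linear_combination (norm := module) (-1 : ℂ) • h3
  have h5 : famPair Γ w (diffFam w c) (eichFam w G b rhoPt) =
      famPair Γ w (diffFam w c) (famT 1 (eichFam w G b etaPt)) +
        famPair Γ w (diffFam w c) (diffFam w (fun A => topC w (b A))) := by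
    rw [h4]
    exact (famBilin Γ w (diffFam w c)).map_add _ _
  -- The potential β of the first polynomial was needed only for its three-term relation; for the
  -- second one the potential is the corner polynomial at η itself.
  have h6 := famPair_identity hP.mem (diffFam_mem hc) mβ hG.perPoly_mem
    (diffFam_mem hG.isTopCoeff) (hG.eichFam_mem etaPt) hP.famS_eq hβ hG.famS_perPoly
    hG.famS_eichFam_etaPt (famPair_diffFam_swap hc hG.isTopCoeff)
  have h7 := famPair_diffFam (Γ := Γ) (w := w) (c := c) (c' := fun A => topC w (b A))
  have h8 : (cosetAvg Γ fun A => c A * b A) =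
      (-1) ^ w * (w + 1) * cosetAvg Γ fun A => c A * topC w (b A) := by
    rw [← cosetAvg_mul_left]
    congr 1
    ext1 A
    have h3 : (w : ℂ) + 1 ≠ 0 := by exact_mod_cast Nat.succ_ne_zero w
    have hm : (-1 : ℂ) ^ w * (-1 : ℂ) ^ w = 1 := by rw [← mul_pow]; simp
    rw [topC]
    field_simp
    linear_combination (-(c A * b A)) * hm
  -- Besides the identity there remain 3⟪N, N'⟫ and -6(-1)^w(w+1)/(w+2) times the average of the
  -- products of top coefficients. Together they give the factor 1 - (-1)^w of the odd term.
  rw [h1, hG.cosetAvg_arcInt_poly hP.mem hP.famS_eq, hG.cosetAvg_arcInt_top hc, h5, h8, coeffPair,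
    ← h6]
  linear_combination 3 * h7

end IsModFam

end PairingAsArcIntegral

/-! ### Vanishing of the pairing of two period polynomials -/

noncomputable section HolomorphicVanishing

open Polynomial

theorem ExpDecay.mul {h₁ h₂ : ℂ → ℂ} (hh₁ : ExpDecay h₁) (hh₂ : ExpDecay h₂) :
    ExpDecay fun z => h₁ z * h₂ z := by
  intro M
  obtain ⟨c, hc, C, hC, B, hB, hb⟩ := hh₁ M
  obtain ⟨c', hc', C', hC', B', hB', hb'⟩ := hh₂ M
  refine ⟨c + c', add_pos hc hc', C * C', by positivity, max B B', le_max_of_le_left hB,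
    fun z hz hBz => ?_⟩
  have h1 := hb z hz ((le_max_left _ _).trans hBz)
  have h2 := hb' z hz ((le_max_right _ _).trans hBz)
  have h3 : Real.exp (-(c + c') * z.im) = Real.exp (-c * z.im) * Real.exp (-c' * z.im) := by
    rw [← Real.exp_add]
    ring_nf
  rw [norm_mul, h3]
  calc ‖h₁ z‖ * ‖h₂ z‖ ≤ (C * Real.exp (-c * z.im)) * (C' * Real.exp (-c' * z.im)) := by gcongr
    _ = _ := by ring

theorem ExpDecay.sum {ι : Type*} (u : Finset ι) {h : ι → ℂ → ℂ} (hh : ∀ i ∈ u, ExpDecay (h i)) :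
    ExpDecay fun z => ∑ i ∈ u, h i z := by
  classical
  induction u using Finset.induction_on with
  | empty => exact fun M => ⟨1, one_pos, 0, le_rfl, 1, le_rfl, by simp⟩
  | insert i u hi ih =>
    simp only [Finset.sum_insert hi]
    exact (hh i (by simp)).add (ih fun j hj => hh j (by simp [hj]))

section

variable {f : ℂ → ℂ} {a : ℂ}

theorem eichPrim_eq_sum (w : ℕ) (hf : DifferentiableOn ℂ f upperHalf)
    (hd : ExpDecay fun t => f t - a) (x : ℂ) {z : ℂ} (hz : z ∈ upperHalf) :
    eichPrim w f a z x = (∑ n ∈ Finset.range (w + 1), (w.choose n : ℂ) * (-x) ^ n *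
      polyPrim f a (X ^ (w - n)) z) + a * (z - x) ^ (w + 1) / (w + 1) := by
  have h1 : ((X - C x : ℂ[X]) ^ w) = ∑ n ∈ Finset.range (w + 1),
      ((w.choose n : ℂ) * (-x) ^ n) • X ^ (w - n) := by
    rw [sub_eq_add_neg, add_comm, add_pow]
    refine Finset.sum_congr rfl fun n _ => ?_
    rw [smul_eq_C_mul]
    simp only [C_mul, C_pow, C_neg, map_natCast]
    ring
  rw [eichPrim, h1, polyPrim_sum hf hd _ _ hz]
  simp only [polyPrim_smul]

/-- On the diagonal the regularising term vanishes, so the function is a sum of decaying holomorphic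
primitives times powers of z. This gives both holomorphy and decay. -/
theorem eichPrim_self (w : ℕ) (hf : DifferentiableOn ℂ f upperHalf)
    (hd : ExpDecay fun t => f t - a) {z : ℂ} (hz : z ∈ upperHalf) :
    eichPrim w f a z z = ∑ n ∈ Finset.range (w + 1), (w.choose n : ℂ) * (-1) ^ n *
      (polyPrim f a (X ^ (w - n)) z * z ^ n) := by
  rw [eichPrim_eq_sum w hf hd z hz, sub_self, zero_pow (Nat.succ_ne_zero w), mul_zero, zero_div,
    add_zero]
  refine Finset.sum_congr rfl fun n _ => ?_
  rw [neg_pow z]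
  ring

theorem differentiableOn_polyPrim (hf : DifferentiableOn ℂ f upperHalf)
    (hd : ExpDecay fun t => f t - a) (p : ℂ[X]) :
    DifferentiableOn ℂ (polyPrim f a p) upperHalf := fun _ hz =>
  (hasDerivAt_polyPrim hf hd p hz).differentiableAt.differentiableWithinAt

end

namespace IsModFam

variable {Γ : Subgroup SL(2, ℤ)} {w : ℕ} {F G : SL(2, ℤ) → ℂ → ℂ} {a b : SL(2, ℤ) → ℂ}

theorem eichPrim_inv (h : IsModFam Γ w F a) {γ : SL(2, ℤ)} (hγ : γ ∈ Γ) (A : SL(2, ℤ)) (z x : ℂ) :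
    eichPrim w (F (γ * A)) (a (γ * A)) z x = eichPrim w (F A) (a A) z x := by
  rw [h.inv γ hγ, h.a_inv γ hγ]

theorem eichPrim_neg (h : IsModFam Γ w F a) (A : SL(2, ℤ)) (z x : ℂ) :
    eichPrim w (F (-A)) (a (-A)) z x = (-1) ^ w * eichPrim w (F A) (a A) z x := by
  rw [eichPrim, eichPrim, h.polyPrim_neg, h.a_neg]
  ring

/-- The arc integral of a coboundary `Φ|(S - 1)`. -/
theorem cosetAvg_arcInt_coboundary [Γ.FiniteIndex] (hG : IsModFam Γ w G b)
    {Φ r : SL(2, ℤ) → ℂ → ℂ}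
    (h1 : ∀ γ ∈ Γ, ∀ A, ∀ z ∈ upperHalf, Φ (γ * A) z = Φ A z)
    (h2 : ∀ A, ∀ z ∈ upperHalf, Φ (-A) z = (-1) ^ w * Φ A z)
    (hΦ : ∀ A, ContinuousOn (Φ A) upperHalf)
    (hr : ∀ A, ∀ z ∈ upperHalf, r A z = z ^ w * Φ (A * ModularGroup.S⁻¹) (-1 / z) - Φ A z) :
    (cosetAvg Γ fun A => arcInt fun z => r A z * G A z) =
      -2 * cosetAvg Γ fun A => arcInt fun z => Φ A z * G A z := by
  have h3 := hG.cosetAvg_arcInt_S h1 h2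
  have h4 : (cosetAvg Γ fun A => arcInt fun z => r A z * G A z) =
      (cosetAvg Γ fun A => arcInt fun z => Φ (A * ModularGroup.S⁻¹) (-1 / z) * z ^ w * G A z) +
        cosetAvg Γ fun A => -1 * arcInt fun z => Φ A z * G A z := by
    rw [← cosetAvg_add]
    congr 1
    ext1 A
    have hc : ContinuousOn (fun z : ℂ => -1 / z) upperHalf :=
      continuousOn_const.div continuousOn_id fun z hz => ne_zero_of_mem_upperHalf hz
    rw [← arcInt_const_mul, ← arcInt_add]
    · refine arcInt_congr fun z hz => ?_
      rw [hr A z hz]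
      ring
    · exact (((hΦ _).comp hc fun z hz => neg_one_div_mem_upperHalf hz).mul (by fun_prop)).mul
        (hG.diff A).continuousOn
    · exact continuousOn_const.mul ((hΦ A).mul (hG.diff A).continuousOn)
  rw [h4, h3, cosetAvg_mul_left]
  ring

/-- The Eichler integral of one form times another form has vanishing integral over the arc. -/
theorem cosetAvg_arcInt_eichPrim [Γ.FiniteIndex] (hF : IsModFam Γ w F a) (hG : IsModFam Γ w G b) :
    (cosetAvg Γ fun A => arcInt fun z => eichPrim w (F A) (a A) z z * G A z) = 0 := by
  set e : SL(2, ℤ) → ℂ → ℂ := fun A z => ∑ n ∈ Finset.range (w + 1), (w.choose n : ℂ) * (-1) ^ n *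
      (polyPrim (F A) (a A) (X ^ (w - n)) z * z ^ n) with he
  have heq : ∀ A, ∀ z ∈ upperHalf, eichPrim w (F A) (a A) z z = e A z := fun A z hz =>
    eichPrim_self w (hF.diff A) (hF.decay A) hz
  have hed : ∀ A, DifferentiableOn ℂ (e A) upperHalf := fun A =>
    DifferentiableOn.fun_sum fun n _ => ((differentiableOn_polyPrim (hF.diff A)
      (hF.decay A) _).mul (by fun_prop)).const_mul _
  have hee : ∀ A, ExpDecay (e A) := fun A => ExpDecay.sum _ fun n _ =>
    ((polyPrim_expDecay (hF.decay A) _).mul_pow n).const_mul _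
  have hd : ∀ A, DifferentiableOn ℂ (fun z => e A z * G A z) upperHalf := fun A =>
    (hed A).mul (hG.diff A)
  have hdec : ∀ A, ExpDecay fun z => e A z * G A z := fun A => by
    -- G is split as (G - b) + b; only the Eichler factor has to decay.
    convert ((hee A).mul (hG.decay A)).add ((hee A).const_mul (b A)) using 2
    ring
  set K : SL(2, ℤ) → ℂ → ℂ := fun A => vInt fun z => e A z * G A z with hK
  have hKarc : ∀ A, (arcInt fun z => eichPrim w (F A) (a A) z z * G A z) =
      K A rhoPt - K A etaPt := by
    intro A
    rw [← arcInt_eq_sub (hd A).continuousOn fun z hz => hasDerivAt_vInt (hd A) (hdec A) hz]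
    exact arcInt_congr fun z hz => by rw [heq A z hz]
  have hinv : CosetInv Γ fun A => K A etaPt := by
    refine ⟨fun γ hγ A => ?_, fun A => ?_⟩
    · simp only [hK, he, hF.inv γ hγ, hF.a_inv γ hγ, hG.inv γ hγ]
    · simp only [hK, vInt]
      congr 2
      ext1 s
      have h1 : ∀ z, e (-A) z = (-1) ^ w * e A z := fun z => by
        simp only [he, hF.polyPrim_neg, Finset.mul_sum]
        exact Finset.sum_congr rfl fun n _ => by ring
      rw [h1, hG.neg, mul_mul_mul_comm, ← mul_pow]
      simp
  simp only [hKarc]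
  -- Cauchy's theorem for the fundamental domain: the vertical integrals from ρ and from η to i∞
  -- agree after the coset shift by T⁻¹, so their averaged difference, the arc integral, is zero.
  rw [cosetAvg_sub, sub_eq_zero, ← cosetAvg_mul_right hinv ModularGroup.T⁻¹]
  congr 1
  ext1 A
  simp only [hK, vInt]
  congr 1
  refine setIntegral_congr_fun measurableSet_Ioi fun s hs => ?_
  have hz := add_mul_I_mem_upperHalf rhoPt_mem (le_of_lt hs)
  have h1 : etaPt + s * Complex.I = rhoPt + s * Complex.I + 1 := by rw [← rhoPt_add_one]; ring
  have h2 := hF.eichPrim_add_one A (rhoPt + s * Complex.I) hz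
  rw [heq _ _ hz, heq _ _ (add_one_mem_upperHalf hz)] at h2
  simp only [h1, h2]
  rw [← hG.mul_T _ _ hz, inv_mul_cancel_right]

/-- With x = z the period function is a coboundary Φ|(S - 1) of the Eichler integral, whose own
integral against G vanishes. -/
theorem cosetAvg_arcInt_perFun [Γ.FiniteIndex] (hF : IsModFam Γ w F a) (hG : IsModFam Γ w G b) :
    (cosetAvg Γ fun A => arcInt fun z => perFun w F a A z * G A z) = 0 := by
  rw [hG.cosetAvg_arcInt_coboundary (Φ := fun A z => eichPrim w (F A) (a A) z z)
    (fun γ hγ A z _ => hF.eichPrim_inv hγ A z z) (fun A z _ => hF.eichPrim_neg A z z) (fun A => ?_)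
    (fun A z hz => hF.perFun_eq A hz (ne_zero_of_mem_upperHalf hz)),
    hF.cosetAvg_arcInt_eichPrim hG, mul_zero]
  have h1 : ContinuousOn (fun z => ∑ n ∈ Finset.range (w + 1), (w.choose n : ℂ) * (-1) ^ n *
      (polyPrim (F A) (a A) (X ^ (w - n)) z * z ^ n)) upperHalf :=
    (DifferentiableOn.fun_sum fun n _ => ((differentiableOn_polyPrim (hF.diff A)
      (hF.decay A) _).mul (by fun_prop)).const_mul _).continuousOn
  exact h1.congr fun z hz => eichPrim_self w (hF.diff A) (hF.decay A) hz

/-- The extended pairing of two extended period polynomials of modular forms vanishes. -/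
theorem coeffPair_perPoly [Γ.FiniteIndex] (hF : IsModFam Γ w F a) (hG : IsModFam Γ w G b) :
    coeffPair Γ w (perPoly w F a) (fun A => topC w (a A)) (perPoly w G b)
      (fun A => topC w (b A)) = 0 := by
  rw [← hG.cosetAvg_arcInt_eq_coeffPair hF.isPeriodData]
  have := hF.cosetAvg_arcInt_perFun hG
  simp only [perFun] at this
  rw [this, mul_zero]

end IsModFam

end HolomorphicVanishing

/-! ### Stokes' formula in arc coordinates -/

noncomputable section StokesFormula

/-- Real differentiability with the given Wirtinger derivatives. -/
def HasWirtingerAt (H : ℂ → ℂ) (p q z : ℂ) : Prop :=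
  HasFDerivAt H (p • (ContinuousLinearMap.id ℝ ℂ) + q • (Complex.conjCLE : ℂ →L[ℝ] ℂ)) z

theorem HasWirtingerAt.of_hasDerivAt {h : ℂ → ℂ} {h' z : ℂ} (hh : HasDerivAt h h' z) :
    HasWirtingerAt h h' 0 z := by
  refine (hh.hasFDerivAt.restrictScalars ℝ).congr_fderiv ?_
  ext v
  simp [mul_comm]

theorem HasWirtingerAt.conj {h : ℂ → ℂ} {h' z : ℂ} (hh : HasDerivAt h h' z) :
    HasWirtingerAt (fun z => conj (h z)) 0 (conj h') z := by
  have := (Complex.conjCLE : ℂ →L[ℝ] ℂ).hasFDerivAt.comp z (hh.hasFDerivAt.restrictScalars ℝ)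
  refine this.congr_fderiv ?_
  ext v
  simp [mul_comm]

theorem HasWirtingerAt.mul {H K : ℂ → ℂ} {p q p' q' z : ℂ} (hH : HasWirtingerAt H p q z)
    (hK : HasWirtingerAt K p' q' z) :
    HasWirtingerAt (fun z => H z * K z) (p * K z + H z * p') (q * K z + H z * q') z := by
  refine (HasFDerivAt.mul hH hK).congr_fderiv ?_
  ext v
  simp
  ring

theorem HasWirtingerAt.sub {H K : ℂ → ℂ} {p q p' q' z : ℂ} (hH : HasWirtingerAt H p q z)
    (hK : HasWirtingerAt K p' q' z) :
    HasWirtingerAt (fun z => H z - K z) (p - p') (q - q') z := by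
  refine (HasFDerivAt.sub hH hK).congr_fderiv ?_
  ext v
  simp
  ring

theorem HasWirtingerAt.sum {ι : Type*} (u : Finset ι) {H : ι → ℂ → ℂ} {p q : ι → ℂ} {z : ℂ}
    (hH : ∀ i ∈ u, HasWirtingerAt (H i) (p i) (q i) z) :
    HasWirtingerAt (fun z => ∑ i ∈ u, H i z) (∑ i ∈ u, p i) (∑ i ∈ u, q i) z := by
  refine (HasFDerivAt.fun_sum hH).congr_fderiv ?_
  ext v
  simp [Finset.sum_add_distrib, Finset.sum_mul]

theorem HasWirtingerAt.congr {H K : ℂ → ℂ} {p p' q z : ℂ} (hH : HasWirtingerAt H p q z)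
    (h : K =ᶠ[𝓝 z] H) (hp : p = p') : HasWirtingerAt K p' q z :=
  hp ▸ HasFDerivAt.congr_of_eventuallyEq hH h

/-- A parametrisation of the fundamental domain truncated at height `Y`. -/
def domPair (Y : ℝ) (p : ℝ × ℝ) : ℝ × ℝ :=
  (Real.cos p.1, Real.sin p.1 + p.2 * (Y - Real.sin p.1))

/-- The same parametrisation, as a complex number. -/
def domPt (Y : ℝ) (p : ℝ × ℝ) : ℂ := (domPair Y p).1 + (domPair Y p).2 * Complex.I

theorem domPt_mem {Y : ℝ} (hY : 1 < Y) {p : ℝ × ℝ} (h1 : Real.pi / 3 ≤ p.1)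
    (h2 : p.1 ≤ 2 * Real.pi / 3) (h3 : 0 ≤ p.2) : domPt Y p ∈ upperHalf := by
  have hs : 0 < Real.sin p.1 :=
    Real.sin_pos_of_pos_of_lt_pi (by linarith [Real.pi_pos]) (by linarith [Real.pi_pos])
  have h5 : 0 ≤ p.2 * (Y - Real.sin p.1) :=
    mul_nonneg h3 (by linarith [Real.sin_le_one p.1])
  have h4 : (domPt Y p).im = Real.sin p.1 + p.2 * (Y - Real.sin p.1) := by
    simp [domPt, domPair, -Complex.ofReal_sin, -Complex.ofReal_cos]
  rw [upperHalf, Set.mem_ofPred_eq, h4]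
  linarith

theorem continuous_domPt (Y : ℝ) : Continuous (domPt Y) := by
  unfold domPt domPair
  fun_prop

theorem hasFDerivAt_domPt (Y : ℝ) (p : ℝ × ℝ) :
    HasFDerivAt (domPt Y) ((ContinuousLinearMap.fst ℝ ℝ ℝ).smulRight
        (-(Real.sin p.1 : ℂ) + ((1 - p.2) * Real.cos p.1) * Complex.I) +
      (ContinuousLinearMap.snd ℝ ℝ ℝ).smulRight ((Y - Real.sin p.1) * Complex.I)) p := by
  have hf : HasFDerivAt (fun p : ℝ × ℝ => p.1) (ContinuousLinearMap.fst ℝ ℝ ℝ) p := hasFDerivAt_fst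
  have hs : HasFDerivAt (fun p : ℝ × ℝ => p.2) (ContinuousLinearMap.snd ℝ ℝ ℝ) p := hasFDerivAt_snd
  have h2 := hf.sin.add (hs.mul (hf.sin.const_sub Y))
  have h3 := ((Complex.ofRealCLM.hasFDerivAt.comp p hf.cos).add
    ((Complex.ofRealCLM.hasFDerivAt.comp p h2).mul_const Complex.I))
  refine h3.congr_fderiv ?_
  ext
  · simp
    ring
  · simp [mul_comm]

/-- Stokes' formula for `H dz̄` on the truncated fundamental domain. -/
theorem stokes_domPt {H p q : ℂ → ℂ} (hH : ∀ z ∈ upperHalf, HasWirtingerAt H (p z) (q z) z)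
    (hp : ContinuousOn p upperHalf) {Y : ℝ} (hY : 1 < Y) :
    (∫ θ in (Real.pi / 3)..(2 * Real.pi / 3), ∫ s in (0 : ℝ)..1,
        p (domPt Y (θ, s)) * ((Real.sin θ * (Y - Real.sin θ) : ℝ) : ℂ)) * (2 * Complex.I) =
      (∫ θ in (Real.pi / 3)..(2 * Real.pi / 3),
          H (Real.cos θ + Y * Complex.I) * (Real.sin θ : ℂ)) +
        conj (arcInt fun z => conj (H z)) +
        (∫ s in (0 : ℝ)..1, H (rhoPt + (s * (Y - Real.sqrt 3 / 2) : ℝ) * Complex.I) -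
          H (etaPt + (s * (Y - Real.sqrt 3 / 2) : ℝ) * Complex.I)) *
          (-(Y - Real.sqrt 3 / 2) * Complex.I) := by
  have hle : Real.pi / 3 ≤ 2 * Real.pi / 3 := by linarith [Real.pi_pos]
  have hmem : ∀ x ∈ Set.uIcc (Real.pi / 3) (2 * Real.pi / 3) ×ˢ Set.uIcc (0 : ℝ) 1,
      domPt Y x ∈ upperHalf := by
    rintro x ⟨h1, h2⟩
    rw [Set.uIcc_of_le hle] at h1
    rw [Set.uIcc_of_le zero_le_one] at h2
    exact domPt_mem hY h1.1 h1.2 h2.1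
  have hHc : ContinuousOn H upperHalf := fun z hz => (hH z hz).continuousAt.continuousWithinAt
  have hc1 : ContinuousOn (fun x => H (domPt Y x))
      (Set.uIcc (Real.pi / 3) (2 * Real.pi / 3) ×ˢ Set.uIcc (0 : ℝ) 1) :=
    hHc.comp (continuous_domPt Y).continuousOn hmem
  have hc2 : ContinuousOn (fun x => p (domPt Y x))
      (Set.uIcc (Real.pi / 3) (2 * Real.pi / 3) ×ˢ Set.uIcc (0 : ℝ) 1) :=
    hp.comp (continuous_domPt Y).continuousOn hmem
  -- derivatives of the two coefficients of the pulled back form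
  let u : ℝ × ℝ → ℂ := fun x => -(((Y - Real.sin x.1 : ℝ) : ℂ) * Complex.I)
  let v : ℝ × ℝ → ℂ := fun x =>
    -(-((Real.sin x.1 : ℝ) : ℂ) - (((1 - x.2) * Real.cos x.1 : ℝ) : ℂ) * Complex.I)
  have hu : ∀ x : ℝ × ℝ, ∃ D : ℝ × ℝ →L[ℝ] ℂ, HasFDerivAt u D x ∧
      D (1, 0) = ((Real.cos x.1 : ℝ) : ℂ) * Complex.I := by
    intro x
    have hf : HasFDerivAt (fun p : ℝ × ℝ => p.1) (ContinuousLinearMap.fst ℝ ℝ ℝ) x :=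
      hasFDerivAt_fst
    exact ⟨_, ((Complex.ofRealCLM.hasFDerivAt.comp x (hf.sin.const_sub Y)).mul_const
      Complex.I).neg, by simp [mul_comm]⟩
  have hv : ∀ x : ℝ × ℝ, ∃ D : ℝ × ℝ →L[ℝ] ℂ, HasFDerivAt v D x ∧
      D (0, 1) = -(((Real.cos x.1 : ℝ) : ℂ) * Complex.I) := by
    intro x
    have hf : HasFDerivAt (fun p : ℝ × ℝ => p.1) (ContinuousLinearMap.fst ℝ ℝ ℝ) x :=
      hasFDerivAt_fst
    have hs : HasFDerivAt (fun p : ℝ × ℝ => p.2) (ContinuousLinearMap.snd ℝ ℝ ℝ) x :=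
      hasFDerivAt_snd
    exact ⟨_, ((Complex.ofRealCLM.hasFDerivAt.comp x hf.sin).neg.sub
      ((Complex.ofRealCLM.hasFDerivAt.comp x ((hs.const_sub 1).mul hf.cos)).mul_const
      Complex.I)).neg, by simp [mul_comm]⟩
  choose Du hDu hDu1 using hu
  choose Dv hDv hDv1 using hv
  let L : ℝ × ℝ → ℝ × ℝ →L[ℝ] ℂ := fun x =>
    (p (domPt Y x) • (ContinuousLinearMap.id ℝ ℂ) +
      q (domPt Y x) • (Complex.conjCLE : ℂ →L[ℝ] ℂ)).comp
    ((ContinuousLinearMap.fst ℝ ℝ ℝ).smulRight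
        (-(Real.sin x.1 : ℂ) + ((1 - x.2) * Real.cos x.1) * Complex.I) +
      (ContinuousLinearMap.snd ℝ ℝ ℝ).smulRight ((Y - Real.sin x.1) * Complex.I))
  have hL : ∀ x, domPt Y x ∈ upperHalf → HasFDerivAt (fun x => H (domPt Y x)) (L x) x :=
    fun x hx => (hH _ hx).comp x (hasFDerivAt_domPt Y x)
  -- `u` and `-v` are the conjugates of the s- and θ-derivatives of `domPt`, that is, the
  -- coefficients of the pullback of dz̄. Their mixed derivatives cancel, as does the ∂̄-part of H;
  -- what is left is 2i times p times the absolute Jacobian.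
  have hkey : ∀ x, (H (domPt Y x) • Du x + u x • L x) (1, 0) +
      (H (domPt Y x) • Dv x + v x • L x) (0, 1) =
      p (domPt Y x) * ((Real.sin x.1 * (Y - Real.sin x.1) : ℝ) : ℂ) * (2 * Complex.I) := by
    intro x
    simp only [add_apply, smul_apply, hDu1, hDv1, L, u, v,
      ContinuousLinearMap.comp_apply, ContinuousLinearMap.smulRight_apply,
      ContinuousLinearMap.coe_fst', ContinuousLinearMap.coe_snd', smul_eq_mul,
      ContinuousLinearMap.id_apply, one_smul, zero_smul, add_zero, zero_add,
      ContinuousLinearEquiv.coe_coe, Complex.conjCLE_apply, map_add, map_neg, map_mul, map_sub,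
      Complex.conj_ofReal, Complex.conj_I, map_one]
    push_cast
    ring_nf
  have hmem' : ∀ x ∈ Set.Ioo (min (Real.pi / 3) (2 * Real.pi / 3))
      (max (Real.pi / 3) (2 * Real.pi / 3)) ×ˢ Set.Ioo (min (0 : ℝ) 1) (max 0 1),
      domPt Y x ∈ upperHalf := fun x hx =>
    hmem x ⟨Set.Ioo_subset_Icc_self hx.1, Set.Ioo_subset_Icc_self hx.2⟩
  have hdiv := integral2_divergence_prod_of_hasFDerivAt (fun x => H (domPt Y x) * u x)
    (fun x => H (domPt Y x) * v x) (fun x => H (domPt Y x) • Du x + u x • L x)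
    (fun x => H (domPt Y x) • Dv x + v x • L x) (Real.pi / 3) 0 (2 * Real.pi / 3) 1
    (hc1.mul (by fun_prop)) (hc1.mul (by fun_prop))
    (fun x hx => (hL x (hmem' x hx)).mul (hDu x)) (fun x hx => (hL x (hmem' x hx)).mul (hDv x))
    (by
      simp only [hkey]
      refine ContinuousOn.integrableOn_compact (isCompact_uIcc.prod isCompact_uIcc) ?_
      exact (hc2.mul (by fun_prop)).mul continuousOn_const)
  simp only [hkey, intervalIntegral.integral_mul_const] at hdiv
  have hint : ∀ θ ∈ Set.Icc (Real.pi / 3) (2 * Real.pi / 3),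
      IntervalIntegrable (fun s => H (domPt Y (θ, s))) volume 0 1 := fun θ hθ => by
    apply ContinuousOn.intervalIntegrable
    exact hc1.comp (f := fun s => (θ, s)) (by fun_prop) fun s hs =>
      ⟨by rwa [Set.uIcc_of_le hle], hs⟩
  have e1 : ∀ θ : ℝ, H (domPt Y (θ, 1)) * v (θ, 1) =
      H (Real.cos θ + Y * Complex.I) * (Real.sin θ : ℂ) := by
    intro θ
    have h1 : domPt Y (θ, 1) = Real.cos θ + Y * Complex.I := by simp [domPt, domPair]
    rw [h1]
    simp [v]
  -- The edge s = 0 is the arc itself. It carries dz̄ instead of dz, whence the two conjugations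
  -- around `arcInt`.
  have e2 : (∫ θ in (Real.pi / 3)..(2 * Real.pi / 3), H (domPt Y (θ, 0)) * v (θ, 0)) =
      -conj (arcInt fun z => conj (H z)) := by
    rw [arcInt, intervalIntegral.integral_of_le hle, intervalIntegral.integral_of_le hle,
      ← integral_conj, ← integral_neg]
    congr 1
    ext1 θ
    have h1 : domPt Y (θ, 0) = Complex.exp (θ * Complex.I) := by
      simp [domPt, domPair, Complex.exp_mul_I]
    have h2 : v (θ, 0) = -conj (Complex.I * Complex.exp (θ * Complex.I)) := by
      rw [Complex.exp_mul_I, ← Complex.ofReal_cos, ← Complex.ofReal_sin]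
      simp only [v, map_mul, map_add, Complex.conj_ofReal, Complex.conj_I, sub_zero, one_mul]
      linear_combination (Real.sin θ : ℂ) * Complex.I_sq
    rw [h1, h2]
    simp only [map_mul, Complex.conj_conj]
    ring
  have e3 : ∀ s : ℝ, domPt Y (2 * Real.pi / 3, s) =
      rhoPt + (s * (Y - Real.sqrt 3 / 2) : ℝ) * Complex.I := by
    intro s
    have h : (2 * Real.pi / 3 : ℝ) = Real.pi - Real.pi / 3 := by ring
    simp only [domPt, domPair, rhoPt_eq, h, Real.sin_pi_sub, Real.cos_pi_sub,
      Real.cos_pi_div_three, Real.sin_pi_div_three]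
    push_cast
    ring
  have e4 : ∀ s : ℝ, domPt Y (Real.pi / 3, s) =
      etaPt + (s * (Y - Real.sqrt 3 / 2) : ℝ) * Complex.I := by
    intro s
    simp only [domPt, domPair, etaPt_eq, Real.cos_pi_div_three, Real.sin_pi_div_three]
    push_cast
    ring
  have e5 : u (2 * Real.pi / 3, 0) = -(Y - Real.sqrt 3 / 2) * Complex.I := by
    have h : (2 * Real.pi / 3 : ℝ) = Real.pi - Real.pi / 3 := by ring
    simp only [u, h, Real.sin_pi_sub, Real.sin_pi_div_three]
    push_cast
    ring
  have e6 : u (Real.pi / 3, 0) = -(Y - Real.sqrt 3 / 2) * Complex.I := by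
    simp only [u, Real.sin_pi_div_three]
    push_cast
    ring
  have i1 := hint _ (Set.right_mem_Icc.mpr hle)
  have i2 := hint _ (Set.left_mem_Icc.mpr hle)
  simp only [e3] at i1
  simp only [e4] at i2
  have e8 : ∀ s : ℝ, u (2 * Real.pi / 3, s) = -(Y - Real.sqrt 3 / 2) * Complex.I := fun s => e5
  have e9 : ∀ s : ℝ, u (Real.pi / 3, s) = -(Y - Real.sqrt 3 / 2) * Complex.I := fun s => e6
  simp only [intervalIntegral.integral_mul_const]
  rw [hdiv, e2]
  simp only [e1, e3, e4, e8, e9, intervalIntegral.integral_mul_const]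
  rw [intervalIntegral.integral_sub i1 i2]
  ring

end StokesFormula

/-! ### Integration over the truncated fundamental domain -/

noncomputable section TruncatedDomain

/-- The angle is θ = arccos x and s is the relative height above the arc. The interval for s is
half-open because the truncation at height Y is strict. -/
theorem domPair_image {Y : ℝ} (hY : 1 < Y) :
    domPair Y '' (Set.Icc (Real.pi / 3) (2 * Real.pi / 3) ×ˢ Set.Ico 0 1) =
      {p | |p.1| ≤ 1 / 2 ∧ 1 ≤ p.1 ^ 2 + p.2 ^ 2 ∧ 0 < p.2 ∧ p.2 < Y} := by
  have hpi := Real.pi_pos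
  have hc1 : Real.cos (2 * Real.pi / 3) = -(1 / 2) := by
    rw [show (2 * Real.pi / 3 : ℝ) = Real.pi - Real.pi / 3 by ring, Real.cos_pi_sub,
      Real.cos_pi_div_three]
  ext ⟨x, y⟩
  simp only [Set.mem_image, Prod.exists, Set.mem_prod, Set.mem_Icc, Set.mem_Ico, domPair,
    Prod.mk.injEq, Set.mem_ofPred_eq]
  constructor
  · rintro ⟨θ, s, ⟨⟨h1, h2⟩, h3, h4⟩, rfl, rfl⟩
    have hs : 0 < Real.sin θ := Real.sin_pos_of_pos_of_lt_pi (by linarith) (by linarith)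
    have hsY : 0 < Y - Real.sin θ := by linarith [Real.sin_le_one θ]
    have hge : 0 ≤ s * (Y - Real.sin θ) := mul_nonneg h3 hsY.le
    refine ⟨abs_le.mpr ⟨?_, ?_⟩, ?_, by linarith, by nlinarith⟩
    · rw [← hc1]
      exact Real.cos_le_cos_of_nonneg_of_le_pi (by linarith) (by linarith) h2
    · rw [← Real.cos_pi_div_three]
      exact Real.cos_le_cos_of_nonneg_of_le_pi (by linarith) (by linarith) h1
    · have := Real.sin_sq_add_cos_sq θ
      nlinarith
  · rintro ⟨h1, h2, h3, h4⟩
    obtain ⟨h5, h6⟩ := abs_le.mp h1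
    have hcos : Real.cos (Real.arccos x) = x := Real.cos_arccos (by linarith) (by linarith)
    have hsin : Real.sin (Real.arccos x) = Real.sqrt (1 - x ^ 2) := Real.sin_arccos x
    have hle : Real.sin (Real.arccos x) ≤ y := by
      rw [hsin]
      exact Real.sqrt_le_iff.mpr ⟨h3.le, by linarith⟩
    have hsY : 0 < Y - Real.sin (Real.arccos x) := by linarith
    refine ⟨Real.arccos x, (y - Real.sin (Real.arccos x)) / (Y - Real.sin (Real.arccos x)),
      ⟨⟨?_, ?_⟩, div_nonneg (by linarith) hsY.le, ?_⟩, hcos, ?_⟩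
    · rw [← Real.arccos_cos (x := Real.pi / 3) (by linarith) (by linarith), Real.cos_pi_div_three]
      exact Real.arccos_le_arccos h6
    · rw [← Real.arccos_cos (x := 2 * Real.pi / 3) (by linarith) (by linarith), hc1]
      exact Real.arccos_le_arccos h5
    · rw [div_lt_one hsY]
      linarith
    · rw [div_mul_cancel₀ _ hsY.ne']
      ring

theorem domPair_injOn {Y : ℝ} (hY : 1 < Y) :
    Set.InjOn (domPair Y) (Set.Icc (Real.pi / 3) (2 * Real.pi / 3) ×ˢ Set.Ico 0 1) := by
  have hpi := Real.pi_pos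
  rintro ⟨θ, s⟩ ⟨⟨h1, h2⟩, -⟩ ⟨θ', s'⟩ ⟨⟨h1', h2'⟩, -⟩ h
  simp only [domPair, Prod.mk.injEq] at h h1 h2 h1' h2'
  have hθ : θ = θ' := Real.injOn_cos ⟨by linarith, by linarith⟩ ⟨by linarith, by linarith⟩ h.1
  subst hθ
  have hsY : Y - Real.sin θ ≠ 0 := by
    have := Real.sin_le_one θ
    intro h0
    linarith
  have := mul_right_cancel₀ hsY (add_left_cancel h.2)
  rw [this]

/-- The derivative of `domPair`. -/
def fderivDomPair (Y : ℝ) (p : ℝ × ℝ) : ℝ × ℝ →L[ℝ] ℝ × ℝ :=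
  (Matrix.toLin (.finTwoProd ℝ) (.finTwoProd ℝ)
    !![-Real.sin p.1, 0; Real.cos p.1 - p.2 * Real.cos p.1,
      Y - Real.sin p.1]).toContinuousLinearMap

theorem hasFDerivAt_domPair (Y : ℝ) (p : ℝ × ℝ) :
    HasFDerivAt (domPair Y) (fderivDomPair Y p) p := by
  have hf : HasFDerivAt (fun p : ℝ × ℝ => p.1) (ContinuousLinearMap.fst ℝ ℝ ℝ) p := hasFDerivAt_fst
  have hs : HasFDerivAt (fun p : ℝ × ℝ => p.2) (ContinuousLinearMap.snd ℝ ℝ ℝ) p := hasFDerivAt_snd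
  refine (hf.cos.prodMk (hf.sin.add (hs.mul (hf.sin.const_sub Y)))).congr_fderiv ?_
  unfold fderivDomPair
  rw [Matrix.toLin_finTwoProd_toContinuousLinearMap]
  ext <;> simp
  ring

theorem det_fderivDomPair (Y : ℝ) (p : ℝ × ℝ) :
    (fderivDomPair Y p).det = -(Real.sin p.1 * (Y - Real.sin p.1)) := by
  unfold fderivDomPair
  simp only [LinearMap.det_toContinuousLinearMap, LinearMap.det_toLin, Matrix.det_fin_two_of]
  ring

theorem coe_image_truncDomain (Y : ℝ) : ((↑) : ℍ → ℂ) '' truncDomain Y =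
    {z | |z.re| ≤ 1 / 2 ∧ 1 ≤ z.re ^ 2 + z.im ^ 2 ∧ 0 < z.im ∧ z.im < Y} := by
  ext z
  constructor
  · rintro ⟨τ, ⟨⟨h1, h2⟩, h3⟩, rfl⟩
    refine ⟨h2, ?_, τ.im_pos, h3⟩
    rw [Complex.normSq_apply] at h1
    rw [sq, sq]
    exact h1
  · rintro ⟨h1, h2, h3, h4⟩
    refine ⟨⟨z, h3⟩, ⟨⟨?_, h1⟩, h4⟩, rfl⟩
    rw [Complex.normSq_apply, ← sq, ← sq]
    exact h2

theorem measurableSet_truncDomain (Y : ℝ) : MeasurableSet (truncDomain Y) :=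
  (ModularGroup.isClosed_fd.measurableSet).inter
    (isOpen_lt UpperHalfPlane.continuous_im continuous_const).measurableSet

/-- The factor y² cancels the density of the invariant measure and leaves Lebesgue measure on ℂ. -/
theorem setIntegral_truncDomain (ψ : ℂ → ℂ) (Y : ℝ) :
    ∫ z in truncDomain Y, ψ z * (z.im : ℂ) ^ 2 =
      ∫ z in ((↑) : ℍ → ℂ) '' truncDomain Y, ψ z := by
  have hmp : MeasurePreserving UpperHalfPlane.coe (volume.comap UpperHalfPlane.coe)
      (volume.restrict (.range UpperHalfPlane.coe)) :=
    ⟨measurable_coe, by rw [measurableEmbedding_coe.map_comap]⟩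
  have h1 := hmp.setIntegral_image_emb measurableEmbedding_coe ψ (truncDomain Y)
  rw [Measure.restrict_restrict' measurableEmbedding_coe.measurableSet_range,
    Set.inter_eq_self_of_subset_left (Set.image_subset_range _ _)] at h1
  rw [h1, volume_def, setIntegral_withDensity_eq_setIntegral_smul _ _ (measurableSet_truncDomain Y)]
  · refine setIntegral_congr_fun (measurableSet_truncDomain Y) fun z _ => ?_
    have hz : (z.im : ℂ) ≠ 0 := by exact_mod_cast z.im_pos.ne'
    simp only [NNReal.smul_def]
    rw [Complex.real_smul]
    push_cast
    field_simp
  · have : Measurable fun z : ℍ => NNReal.mk z.im z.im_pos.le :=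
      (UpperHalfPlane.continuous_im.measurable).subtype_mk
    exact (measurable_const.div this).pow_const 2

theorem setIntegral_image_truncDomain {ψ : ℂ → ℂ} (hψ : ContinuousOn ψ upperHalf) {Y : ℝ}
    (hY : 1 < Y) : ∫ z in ((↑) : ℍ → ℂ) '' truncDomain Y, ψ z =
      ∫ θ in (Real.pi / 3)..(2 * Real.pi / 3), ∫ s in (0 : ℝ)..1,
        ψ (domPt Y (θ, s)) * ((Real.sin θ * (Y - Real.sin θ) : ℝ) : ℂ) := by
  have hle : Real.pi / 3 ≤ 2 * Real.pi / 3 := by linarith [Real.pi_pos]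
  have h1 := (Complex.volume_preserving_equiv_real_prod.symm).setIntegral_preimage_emb
    (Complex.measurableEquivRealProd.symm.measurableEmbedding) ψ
    (((↑) : ℍ → ℂ) '' truncDomain Y)
  have h2 : Complex.measurableEquivRealProd.symm ⁻¹' (((↑) : ℍ → ℂ) '' truncDomain Y) =
      domPair Y '' (Set.Icc (Real.pi / 3) (2 * Real.pi / 3) ×ˢ Set.Ico 0 1) := by
    rw [domPair_image hY, coe_image_truncDomain]
    rfl
  have h3 : ∀ p, Complex.measurableEquivRealProd.symm (domPair Y p) = domPt Y p := by
    intro p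
    rw [Complex.measurableEquivRealProd_symm_apply]
    apply Complex.ext <;> simp [domPt]
  rw [← h1, h2, integral_image_eq_integral_abs_det_fderiv_smul volume
    (measurableSet_Icc.prod measurableSet_Ico)
    (fun p _ => (hasFDerivAt_domPair Y p).hasFDerivWithinAt) (domPair_injOn hY)]
  have h4 : ∀ p ∈ Set.Icc (Real.pi / 3) (2 * Real.pi / 3) ×ˢ Set.Ico (0 : ℝ) 1,
      |(fderivDomPair Y p).det| • ψ (Complex.measurableEquivRealProd.symm (domPair Y p)) =
      ψ (domPt Y p) * ((Real.sin p.1 * (Y - Real.sin p.1) : ℝ) : ℂ) := by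
    rintro p ⟨hp, -⟩
    have hs : 0 < Real.sin p.1 :=
      Real.sin_pos_of_pos_of_lt_pi (by linarith [hp.1, Real.pi_pos])
        (by linarith [hp.2, Real.pi_pos])
    have hsY : 0 < Y - Real.sin p.1 := by linarith [Real.sin_le_one p.1]
    rw [det_fderivDomPair, abs_neg, abs_of_pos (mul_pos hs hsY), h3, Complex.real_smul, mul_comm]
  rw [setIntegral_congr_fun (measurableSet_Icc.prod measurableSet_Ico) h4]
  have hint : IntegrableOn (fun p : ℝ × ℝ =>
      ψ (domPt Y p) * ((Real.sin p.1 * (Y - Real.sin p.1) : ℝ) : ℂ))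
      (Set.Icc (Real.pi / 3) (2 * Real.pi / 3) ×ˢ Set.Ico 0 1) := by
    -- Passing to the closed rectangle gives compactness; the parametrisation still lands in the
    -- upper half plane there.
    refine IntegrableOn.mono_set (t := Set.Icc (Real.pi / 3) (2 * Real.pi / 3) ×ˢ Set.Icc 0 1) ?_
      (Set.prod_mono_right Set.Ico_subset_Icc_self)
    refine ContinuousOn.integrableOn_compact (isCompact_Icc.prod isCompact_Icc) ?_
    exact (hψ.comp (continuous_domPt Y).continuousOn fun x hx =>
      domPt_mem hY hx.1.1 hx.1.2 hx.2.1).mul (by fun_prop)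
  rw [Measure.volume_eq_prod] at hint ⊢
  rw [setIntegral_prod _ hint, integral_Icc_eq_integral_Ioc, intervalIntegral.integral_of_le hle]
  congr 1
  ext1 θ
  rw [integral_Ico_eq_integral_Ioc, intervalIntegral.integral_of_le zero_le_one]

end TruncatedDomain

/-! ### The renormalised Petersson product as an arc integral -/

noncomputable section PeterssonFormula

theorem ExpDecay.mono {h g : ℂ → ℂ} (hg : ExpDecay g) (hle : ∀ z ∈ upperHalf, ‖h z‖ ≤ ‖g z‖) :
    ExpDecay h := by
  intro M
  obtain ⟨c, hc, C, hC, B, hB, hb⟩ := hg M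
  exact ⟨c, hc, C, hC, B, hB, fun z hz hBz =>
    (hle z (lt_of_lt_of_le (by linarith) hBz)).trans (hb z hz hBz)⟩

/-- The non-holomorphic function `∫_{i∞}^z f(t) (t - z̄)^w dt · conj g(z)`, regularised at `i∞`. -/
def stokesFun (w : ℕ) (f : ℂ → ℂ) (a : ℂ) (g : ℂ → ℂ) (z : ℂ) : ℂ :=
  eichPrim w f a z (conj z) * conj (g z)

section

variable {w : ℕ} {f g : ℂ → ℂ} {a b : ℂ}

/-- Expanding in powers of z̄, the function is a sum of holomorphic moments times antiholomorphic
factors, so ∂ acts on the moments alone and reassembles f(z)(z - z̄)^w. The ∂̄-derivative stays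
unspecified, as Stokes' formula for H dz̄ does not need it. -/
theorem hasWirtingerAt_stokesFun (hf : DifferentiableOn ℂ f upperHalf)
    (hd : ExpDecay fun t => f t - a) (hg : DifferentiableOn ℂ g upperHalf) {z : ℂ}
    (hz : z ∈ upperHalf) :
    ∃ q, HasWirtingerAt (stokesFun w f a g) (f z * (z - conj z) ^ w * conj (g z)) q z := by
  have hgz := (hg.differentiableAt (isOpen_upperHalf.mem_nhds hz)).hasDerivAt
  have h1 := HasWirtingerAt.sum (Finset.range (w + 1)) (z := z) fun n _ =>
    (HasWirtingerAt.of_hasDerivAt ((hasDerivAt_momPrim hf hd (w - n) hz).const_mul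
      ((w.choose n : ℂ) * (-1) ^ n))).mul (HasWirtingerAt.conj (hasDerivAt_pow n z))
  have h2 := (h1.sub ((HasWirtingerAt.of_hasDerivAt (hasDerivAt_const z (topC w a))).mul
    (HasWirtingerAt.conj (hasDerivAt_pow (w + 1) z)))).mul (HasWirtingerAt.conj hgz)
  have heq : stokesFun w f a g =ᶠ[𝓝 z] fun z => ((∑ n ∈ Finset.range (w + 1),
      (w.choose n : ℂ) * (-1) ^ n * momPrim f a (w - n) z * conj (z ^ n)) -
      topC w a * conj (z ^ (w + 1))) * conj (g z) := by
    filter_upwards [isOpen_upperHalf.mem_nhds hz] with u hu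
    have h3 := eval_eichPoly w hf hd (conj u) hu
    rw [stokesFun, eq_sub_of_add_eq h3.symm, eichPoly, Polynomial.eval_finsetSum]
    simp only [Polynomial.eval_monomial, map_pow]
  have h3 : f z * (z - conj z) ^ w = ∑ n ∈ Finset.range (w + 1),
      (w.choose n : ℂ) * (-1) ^ n * (f z * z ^ (w - n)) * conj (z ^ n) := by
    rw [sub_eq_add_neg, add_comm, add_pow, Finset.mul_sum]
    refine Finset.sum_congr rfl fun n _ => ?_
    rw [neg_pow, map_pow]
    ring
  refine ⟨_, h2.congr heq ?_⟩
  rw [h3]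
  simp

theorem continuousOn_stokesFun (hf : DifferentiableOn ℂ f upperHalf)
    (hd : ExpDecay fun t => f t - a) (hg : DifferentiableOn ℂ g upperHalf) :
    ContinuousOn (stokesFun w f a g) upperHalf := fun _ hz =>
  let ⟨_, hq⟩ := hasWirtingerAt_stokesFun hf hd hg hz
  (HasFDerivAt.continuousAt hq).continuousWithinAt

theorem sub_conj_eq (z : ℂ) : z - conj z = 2 * Complex.I * z.im := by
  rw [Complex.sub_conj]
  push_cast
  ring

/-- Every part involving f - a or g - b decays, even after multiplication by powers of the height;
only the product of the constant terms survives. That main term is what the renormalisation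
subtracts. -/
theorem expDecay_stokesFun (hf : DifferentiableOn ℂ f upperHalf)
    (hd : ExpDecay fun t => f t - a) (hdg : ExpDecay fun t => g t - b) :
    ExpDecay fun z => stokesFun w f a g z -
      a * conj b * (2 * Complex.I * z.im) ^ (w + 1) / (w + 1) := by
  have h1 : ExpDecay fun z => ∑ n ∈ Finset.range (w + 1), (w.choose n : ℂ) *
      (polyPrim f a (Polynomial.X ^ (w - n)) z * (-conj z) ^ n) :=
    ExpDecay.sum _ fun n _ => (((polyPrim_expDecay hd (Polynomial.X ^ (w - n))).mul_pow n).mono fun z _ => by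
      simp).const_mul _
  have h2 : ExpDecay fun z => conj (g z) - conj b := hdg.mono fun z _ => by
    rw [← map_sub, RCLike.norm_conj]
  have h3 : ExpDecay fun z => (2 : ℂ) ^ (w + 1) * (a / (w + 1)) *
      ((conj (g z) - conj b) * (Complex.I * z.im) ^ (w + 1)) :=
    ((h2.mul_pow (w + 1)).mono fun z _ => by
      rw [norm_mul, norm_mul, norm_pow, norm_pow]
      gcongr
      simpa using Complex.abs_im_le_norm z).const_mul _
  refine ExpDecay.mono (((h1.mul h2).add (h1.const_mul (conj b))).add h3) fun z hz => le_of_eq ?_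
  rw [stokesFun, eichPrim_eq_sum w hf hd _ hz, sub_conj_eq]
  congr 1
  rw [mul_assoc 2, mul_pow 2]
  have h4 : ∑ n ∈ Finset.range (w + 1), (w.choose n : ℂ) * (-conj z) ^ n *
      polyPrim f a (Polynomial.X ^ (w - n)) z = ∑ n ∈ Finset.range (w + 1), (w.choose n : ℂ) *
      (polyPrim f a (Polynomial.X ^ (w - n)) z * (-conj z) ^ n) :=
    Finset.sum_congr rfl fun n _ => by ring
  rw [h4]
  ring

theorem cos_add_mem {Y : ℝ} (hY : 0 < Y) (θ : ℝ) :
    (Real.cos θ : ℂ) + Y * Complex.I ∈ upperHalf := by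
  simpa [upperHalf, -Complex.ofReal_cos] using hY

/-- The contribution of the top side, after regularisation. -/
theorem tendsto_top_side (hf : DifferentiableOn ℂ f upperHalf)
    (hd : ExpDecay fun t => f t - a) (hg : DifferentiableOn ℂ g upperHalf)
    (hdg : ExpDecay fun t => g t - b) :
    Tendsto (fun Y : ℝ => (∫ θ in (Real.pi / 3)..(2 * Real.pi / 3),
        stokesFun w f a g (Real.cos θ + Y * Complex.I) * (Real.sin θ : ℂ)) -
      a * conj b * (2 * Complex.I * Y) ^ (w + 1) / (w + 1)) atTop (𝓝 0) := by
  have hpi := Real.pi_pos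
  obtain ⟨c, hc, C, hC, B, hB, hb⟩ := expDecay_stokesFun (w := w) hf hd hdg 1
  have hlim : Tendsto (fun Y : ℝ => C * Real.exp (-c * Y) *
      |2 * Real.pi / 3 - Real.pi / 3|) atTop (𝓝 0) := by
    have : Tendsto (fun y : ℝ => Real.exp (-c * y)) atTop (𝓝 0) :=
      Real.tendsto_exp_atBot.comp (tendsto_id.const_mul_atTop_of_neg (neg_lt_zero.mpr hc))
    simpa using (this.const_mul C).mul_const |2 * Real.pi / 3 - Real.pi / 3|
  refine squeeze_zero_norm' ?_ hlim
  filter_upwards [eventually_ge_atTop B] with Y hY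
  have hY0 : 0 < Y := by linarith
  -- On the horizontal side dx becomes sin θ dθ up to orientation, so this is the unit width of the
  -- domain; it lets the main term be moved inside the integral.
  have hsin : ∫ θ in (Real.pi / 3)..(2 * Real.pi / 3), (Real.sin θ : ℂ) = 1 := by
    rw [intervalIntegral.integral_ofReal, integral_sin,
      show (2 * Real.pi / 3 : ℝ) = Real.pi - Real.pi / 3 by ring, Real.cos_pi_sub,
      Real.cos_pi_div_three]
    norm_num
  have hcont : Continuous fun θ : ℝ => stokesFun w f a g (Real.cos θ + Y * Complex.I) :=
    (continuousOn_stokesFun hf hd hg).comp_continuous (by fun_prop) fun θ => cos_add_mem hY0 θ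
  have h1 : (∫ θ in (Real.pi / 3)..(2 * Real.pi / 3),
        stokesFun w f a g (Real.cos θ + Y * Complex.I) * (Real.sin θ : ℂ)) -
      a * conj b * (2 * Complex.I * Y) ^ (w + 1) / (w + 1) =
      ∫ θ in (Real.pi / 3)..(2 * Real.pi / 3),
        (stokesFun w f a g (Real.cos θ + Y * Complex.I) -
          a * conj b * (2 * Complex.I * Y) ^ (w + 1) / (w + 1)) * (Real.sin θ : ℂ) := by
    simp only [sub_mul]
    rw [intervalIntegral.integral_sub, intervalIntegral.integral_const_mul, hsin, mul_one]
    · exact (hcont.mul (by fun_prop)).intervalIntegrable _ _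
    · exact (continuous_const.mul (by fun_prop)).intervalIntegrable _ _
  rw [h1]
  refine intervalIntegral.norm_integral_le_of_norm_le_const fun θ _ => ?_
  have h2 := hb (Real.cos θ + Y * Complex.I)
    (by simpa [-Complex.ofReal_cos] using Real.abs_cos_le_one θ)
    (by simpa [-Complex.ofReal_cos] using hY)
  have h3 : ((Real.cos θ : ℂ) + Y * Complex.I).im = Y := by simp [-Complex.ofReal_cos]
  simp only [h3] at h2
  rw [norm_mul, Complex.norm_real, Real.norm_eq_abs]
  calc _ ≤ C * Real.exp (-c * Y) * 1 := by
        gcongr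
        exact Real.abs_sin_le_one θ
    _ = _ := mul_one _

/-- Stokes' formula for the truncated Petersson integral. -/
theorem setIntegral_truncDomain_eq (hf : DifferentiableOn ℂ f upperHalf)
    (hd : ExpDecay fun t => f t - a) (hg : DifferentiableOn ℂ g upperHalf) {Y : ℝ} (hY : 1 < Y) :
    (2 * Complex.I) ^ (w + 1) *
        ∫ z in truncDomain Y, f z * conj (g z) * (z.im : ℂ) ^ (w + 2) =
      (∫ θ in (Real.pi / 3)..(2 * Real.pi / 3),
          stokesFun w f a g (Real.cos θ + Y * Complex.I) * (Real.sin θ : ℂ)) +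
        conj (arcInt fun z => conj (stokesFun w f a g z)) +
        (∫ s in (0 : ℝ)..1, stokesFun w f a g
            (rhoPt + (s * (Y - Real.sqrt 3 / 2) : ℝ) * Complex.I) -
          stokesFun w f a g (etaPt + (s * (Y - Real.sqrt 3 / 2) : ℝ) * Complex.I)) *
          (-(Y - Real.sqrt 3 / 2) * Complex.I) := by
  have hW : ∀ z, ∃ q, z ∈ upperHalf →
      HasWirtingerAt (stokesFun w f a g) (f z * (z - conj z) ^ w * conj (g z)) q z := fun z => by
    by_cases hz : z ∈ upperHalf
    · obtain ⟨q, hq⟩ := hasWirtingerAt_stokesFun (w := w) hf hd hg hz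
      exact ⟨q, fun _ => hq⟩
    · exact ⟨0, fun h => absurd h hz⟩
  choose q hq using hW
  have hcont : ContinuousOn (fun z => f z * (z - conj z) ^ w * conj (g z)) upperHalf := by
    have := hf.continuousOn
    have := Complex.continuous_conj.comp_continuousOn hg.continuousOn
    have := Complex.continuous_conj
    exact (ContinuousOn.mul ‹_› (by fun_prop)).mul ‹_›
  rw [← stokes_domPt hq hcont hY, ← setIntegral_image_truncDomain hcont hY,
    ← setIntegral_truncDomain, ← integral_const_mul, ← integral_mul_const]
  congr 1
  ext1 z
  rw [sub_conj_eq, UpperHalfPlane.coe_im]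
  ring

end

namespace IsModFam

variable {Γ : Subgroup SL(2, ℤ)} {w : ℕ} {F G : SL(2, ℤ) → ℂ → ℂ} {a b : SL(2, ℤ) → ℂ}

theorem stokesFun_add_one (hF : IsModFam Γ w F a) (hG : IsModFam Γ w G b) (A : SL(2, ℤ)) {z : ℂ}
    (hz : z ∈ upperHalf) :
    stokesFun w (F (A * ModularGroup.T⁻¹)) (a (A * ModularGroup.T⁻¹))
      (G (A * ModularGroup.T⁻¹)) (z + 1) = stokesFun w (F A) (a A) (G A) z := by
  have h1 := hF.eichPrim_add_one A (conj z) hz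
  rw [stokesFun, stokesFun, map_add, map_one, h1, ← hG.mul_T _ z hz, inv_mul_cancel_right]

theorem stokesFun_inv (hF : IsModFam Γ w F a) (hG : IsModFam Γ w G b) {γ : SL(2, ℤ)} (hγ : γ ∈ Γ)
    (A : SL(2, ℤ)) : stokesFun w (F (γ * A)) (a (γ * A)) (G (γ * A)) =
      stokesFun w (F A) (a A) (G A) := by
  rw [hF.inv γ hγ, hF.a_inv γ hγ, hG.inv γ hγ]

theorem stokesFun_neg (hF : IsModFam Γ w F a) (hG : IsModFam Γ w G b) (A : SL(2, ℤ)) :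
    stokesFun w (F (-A)) (a (-A)) (G (-A)) = stokesFun w (F A) (a A) (G A) := by
  ext1 z
  rw [stokesFun, stokesFun, hF.eichPrim_neg, hG.neg, map_mul, map_pow, map_neg, map_one,
    mul_mul_mul_comm, ← mul_pow]
  simp

/-- The sides are exchanged by z ↦ z + 1, under which the integrand changes only by a shift of the
coset; the average does not see that shift. -/
theorem cosetAvg_sides [Γ.FiniteIndex] (hF : IsModFam Γ w F a) (hG : IsModFam Γ w G b) {Y : ℝ}
    (hY : 1 < Y) :
    (cosetAvg Γ fun A => (∫ s in (0 : ℝ)..1, stokesFun w (F A) (a A) (G A)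
            (rhoPt + (s * (Y - Real.sqrt 3 / 2) : ℝ) * Complex.I) -
          stokesFun w (F A) (a A) (G A)
            (etaPt + (s * (Y - Real.sqrt 3 / 2) : ℝ) * Complex.I)) *
          (-(Y - Real.sqrt 3 / 2) * Complex.I)) = 0 := by
  have hpos : 0 ≤ Y - Real.sqrt 3 / 2 := by
    have : Real.sqrt 3 ≤ 2 := Real.sqrt_le_iff.mpr ⟨by norm_num, by norm_num⟩
    linarith
  have hmem : ∀ u ∈ upperHalf, ∀ s ∈ Set.uIcc (0 : ℝ) 1,
      u + (s * (Y - Real.sqrt 3 / 2) : ℝ) * Complex.I ∈ upperHalf := fun u hu s hs => by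
    rw [Set.uIcc_of_le zero_le_one] at hs
    exact add_mul_I_mem_upperHalf hu (mul_nonneg hs.1 hpos)
  have hint : ∀ u ∈ upperHalf, ∀ A, IntervalIntegrable (fun s : ℝ => stokesFun w (F A) (a A) (G A)
      (u + (s * (Y - Real.sqrt 3 / 2) : ℝ) * Complex.I)) volume 0 1 := fun u hu A =>
    ((continuousOn_stokesFun (hF.diff A) (hF.decay A) (hG.diff A)).comp (by fun_prop)
      (hmem u hu)).intervalIntegrable
  have hinv : CosetInv Γ fun A => ∫ s in (0 : ℝ)..1, stokesFun w (F A) (a A) (G A)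
      (etaPt + (s * (Y - Real.sqrt 3 / 2) : ℝ) * Complex.I) :=
    ⟨fun γ hγ A => by simp only [hF.stokesFun_inv hG hγ],
      fun A => by simp only [hF.stokesFun_neg hG]⟩
  simp only [mul_comm _ (-((Y : ℂ) - Real.sqrt 3 / 2) * Complex.I)]
  rw [cosetAvg_mul_left]
  simp only [intervalIntegral.integral_sub (hint _ rhoPt_mem _) (hint _ etaPt_mem _)]
  rw [cosetAvg_sub, ← cosetAvg_mul_right hinv ModularGroup.T⁻¹, ← cosetAvg_sub]
  have h0 : ∀ A, (∫ s in (0 : ℝ)..1, stokesFun w (F A) (a A) (G A)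
        (rhoPt + (s * (Y - Real.sqrt 3 / 2) : ℝ) * Complex.I)) =
      ∫ s in (0 : ℝ)..1, stokesFun w (F (A * ModularGroup.T⁻¹)) (a (A * ModularGroup.T⁻¹))
        (G (A * ModularGroup.T⁻¹)) (etaPt + (s * (Y - Real.sqrt 3 / 2) : ℝ) * Complex.I) := by
    intro A
    refine intervalIntegral.integral_congr fun s hs => ?_
    have h1 := hF.stokesFun_add_one hG A (hmem _ rhoPt_mem s hs)
    rw [add_right_comm, rhoPt_add_one] at h1
    exact h1.symm
  simp only [h0, sub_self]
  simp [cosetAvg]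

/-- The regularised truncated integrals converge, to an arc integral. -/
theorem tendsto_truncated [Γ.FiniteIndex] (hF : IsModFam Γ w F a) (hG : IsModFam Γ w G b) :
    Tendsto (fun Y : ℝ => (2 * Complex.I) ^ (w + 1) * cosetAvg Γ fun A =>
      (∫ z in truncDomain Y, F A z * conj (G A z) * (z.im : ℂ) ^ (w + 2)) -
        (Y : ℂ) ^ (w + 1) / (w + 1) * a A * conj (b A)) atTop
      (𝓝 (cosetAvg Γ fun A => conj (arcInt fun z => conj (stokesFun w (F A) (a A) (G A) z)))) := by
  have h1 : Tendsto (fun Y : ℝ => cosetAvg Γ fun A =>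
      ((∫ θ in (Real.pi / 3)..(2 * Real.pi / 3),
        stokesFun w (F A) (a A) (G A) (Real.cos θ + Y * Complex.I) * (Real.sin θ : ℂ)) -
      a A * conj (b A) * (2 * Complex.I * Y) ^ (w + 1) / (w + 1)) +
      conj (arcInt fun z => conj (stokesFun w (F A) (a A) (G A) z))) atTop
      (𝓝 (cosetAvg Γ fun A => conj (arcInt fun z => conj (stokesFun w (F A) (a A) (G A) z)))) := by
    refine tendsto_cosetAvg fun A => ?_
    simpa using (tendsto_top_side (w := w) (hF.diff A) (hF.decay A) (hG.diff A)
      (hG.decay A)).add_const (conj (arcInt fun z => conj (stokesFun w (F A) (a A) (G A) z)))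
  refine h1.congr' ?_
  filter_upwards [eventually_gt_atTop 1] with Y hY
  have h2 := hF.cosetAvg_sides hG hY
  rw [← cosetAvg_mul_left, ← add_zero (cosetAvg Γ _), ← h2, ← cosetAvg_add]
  congr 1
  ext1 A
  rw [mul_sub, setIntegral_truncDomain_eq (hF.diff A) (hF.decay A) (hG.diff A) hY]
  ring

/-- The regularised Petersson product as an arc integral of the conjugate period polynomial. -/
theorem cosetAvg_stokesFun [Γ.FiniteIndex] (hF : IsModFam Γ w F a) (hG : IsModFam Γ w G b) :
    (cosetAvg Γ fun A => arcInt fun z => conj (perFun w F a A (conj z)) * G A z) =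
      -2 * cosetAvg Γ fun A => arcInt fun z => conj (stokesFun w (F A) (a A) (G A) z) := by
  -- With x = z̄ and a conjugation, the period function becomes a coboundary of the conjugate of
  -- E(z, z̄), which has the weight needed for the arc argument although it is not holomorphic.
  rw [hG.cosetAvg_arcInt_coboundary (Φ := fun A z => conj (eichPrim w (F A) (a A) z (conj z)))]
  · simp only [stokesFun, map_mul, Complex.conj_conj]
  · exact fun γ hγ A z _ => by rw [hF.eichPrim_inv hγ]
  · exact fun A z _ => by simp [hF.eichPrim_neg]
  · intro A
    have h1 := continuousOn_stokesFun (w := w) (g := fun _ => 1) (hF.diff A) (hF.decay A)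
      (differentiableOn_const 1)
    simpa [stokesFun, Function.comp_def] using Complex.continuous_conj.comp_continuousOn h1
  · intro A z hz
    have h0 := ne_zero_of_mem_upperHalf hz
    have h1 : conj z ≠ 0 := by simpa using h0
    have h2 : conj (-1 / z) = -1 / conj z := by simp
    rw [hF.perFun_eq A hz h1, h2]
    simp

end IsModFam

end PeterssonFormula

/-! ### Complex conjugation and the action of ε -/

noncomputable section Conjugations

open Polynomial

variable {Γ : Subgroup SL(2, ℤ)} {w : ℕ}

/-! ### Complex conjugation -/

/-- Complex conjugation of the coefficients of a family of polynomials. -/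
def conjPoly (P : SL(2, ℤ) → ℂ[X]) : SL(2, ℤ) → ℂ[X] := fun A => (P A).map (starRingEnd ℂ)

theorem conjPoly_conjPoly (P : SL(2, ℤ) → ℂ[X]) : conjPoly (conjPoly P) = P := by
  ext A n
  simp [conjPoly]

theorem conjPoly_add (P Q : SL(2, ℤ) → ℂ[X]) : conjPoly (P + Q) = conjPoly P + conjPoly Q := by
  ext A n
  simp [conjPoly]

theorem conjPoly_neg (P : SL(2, ℤ) → ℂ[X]) : conjPoly (-P) = -conjPoly P := by
  ext A n
  simp [conjPoly]

theorem conjPoly_sub (P Q : SL(2, ℤ) → ℂ[X]) : conjPoly (P - Q) = conjPoly P - conjPoly Q := by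
  rw [sub_eq_add_neg, conjPoly_add, conjPoly_neg, ← sub_eq_add_neg]

theorem conjPoly_famS (P : SL(2, ℤ) → ℂ[X]) : conjPoly (famS w P) = famS w (conjPoly P) := by
  ext A n
  rw [conjPoly, coeff_map, famS_apply, famS_apply, coeff_polyS, coeff_polyS, conjPoly]
  split_ifs <;> simp

theorem conjPoly_famT (n : ℤ) (P : SL(2, ℤ) → ℂ[X]) :
    conjPoly (famT n P) = famT n (conjPoly P) := by
  ext1 A
  rw [conjPoly, famT_apply, famT_apply, Polynomial.map_comp]
  simp [conjPoly]

theorem conjPoly_diffFam (c : SL(2, ℤ) → ℂ) :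
    conjPoly (diffFam w c) = diffFam w fun A => conj (c A) := by
  ext A n
  rw [conjPoly, coeff_map, diffFam, diffFam, coeff_smul, coeff_smul, coeff_diffPoly]
  split_ifs <;> simp

theorem conjPoly_mem {P : SL(2, ℤ) → ℂ[X]} (hP : P ∈ polyFam Γ w) : conjPoly P ∈ polyFam Γ w := by
  obtain ⟨h1, h2, h3⟩ := hP
  refine ⟨fun A => natDegree_map_le.trans (h1 A), fun γ hγ A => ?_, fun A => ?_⟩
  · rw [conjPoly, conjPoly, h2 γ hγ]
  · ext n
    simp [conjPoly, h3]

/-- Conjugation of coefficients commutes with the actions of S and T, since these have real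
coefficients. The conjugate need not come from a modular form for Γ, which is why the pairing
formula is stated for this weaker structure. -/
theorem IsPeriodData.conj {P : SL(2, ℤ) → ℂ[X]} {c : SL(2, ℤ) → ℂ} (h : IsPeriodData Γ w P c) :
    IsPeriodData Γ w (conjPoly P) fun A => conj (c A) where
  mem := conjPoly_mem h.mem
  top := ⟨fun γ hγ A => by rw [h.top.inv γ hγ], fun A => by simp [h.top.neg],
    fun A => by rw [h.top.mul_T]⟩
  famS_eq := by rw [← conjPoly_famS, h.famS_eq, conjPoly_neg]
  potential := by
    obtain ⟨β, mβ, hβ⟩ := h.potential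
    refine ⟨conjPoly β, conjPoly_mem mβ, ?_⟩
    rw [← conjPoly_famS, hβ, conjPoly_add, conjPoly_add, conjPoly_famT, conjPoly_diffFam]

theorem conj_famPair [Γ.FiniteIndex] (P Q : SL(2, ℤ) → ℂ[X]) :
    conj (famPair Γ w P Q) = famPair Γ w (conjPoly P) (conjPoly Q) := by
  rw [famPair, famPair, conj_cosetAvg]
  congr 1
  ext1 A
  simp [polyPair, conjPoly]

theorem conj_coeffPair [Γ.FiniteIndex] (P Q : SL(2, ℤ) → ℂ[X]) (c d : SL(2, ℤ) → ℂ) :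
    conj (coeffPair Γ w P c Q d) =
      coeffPair Γ w (conjPoly P) (fun A => conj (c A)) (conjPoly Q) fun A => conj (d A) := by
  simp only [coeffPair, map_add, map_sub, map_mul, conj_famPair, conj_cosetAvg, conjPoly_add,
    conjPoly_sub, conjPoly_famT, conjPoly_diffFam, map_div₀, map_pow, map_neg, map_one,
    Complex.conj_ofNat, Complex.conj_natCast]

/-- The extended pairing as a bilinear map. -/
def coeffBilin (Γ : Subgroup SL(2, ℤ)) [Γ.FiniteIndex] (w : ℕ) :
    ((SL(2, ℤ) → ℂ[X]) × (SL(2, ℤ) → ℂ)) →ₗ[ℂ]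
      ((SL(2, ℤ) → ℂ[X]) × (SL(2, ℤ) → ℂ)) →ₗ[ℂ] ℂ :=
  have hadd : ∀ c d : SL(2, ℤ) → ℂ, diffFam w (c + d) = diffFam w c + diffFam w d := fun c d => by
    ext1 A
    simp only [diffFam, Pi.add_apply, ← add_smul, neg_add]
  have hsmul : ∀ (r : ℂ) (c : SL(2, ℤ) → ℂ), diffFam w (r • c) = r • diffFam w c := fun r c => by
    ext1 A
    simp only [diffFam, Pi.smul_apply, smul_smul, smul_eq_mul, mul_neg]
  have hB : ∀ P Q, famPair Γ w P Q = famBilin Γ w P Q := fun _ _ => rfl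
  LinearMap.mk₂ ℂ (fun x y => coeffPair Γ w x.1 x.2 y.1 y.2)
    (fun x x' y => by
      simp only [coeffPair, Prod.fst_add, Prod.snd_add, hadd, hB, map_add, map_sub,
        LinearMap.add_apply, LinearMap.sub_apply, Pi.add_apply, add_mul, cosetAvg_add]
      ring)
    (fun r x y => by
      simp only [coeffPair, Prod.smul_fst, Prod.smul_snd, hsmul, hB, map_add, map_sub, map_smul,
        LinearMap.add_apply, LinearMap.sub_apply, LinearMap.smul_apply, Pi.smul_apply, smul_eq_mul,
        mul_assoc, cosetAvg_mul_left]
      ring)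
    (fun x y y' => by
      simp only [coeffPair, Prod.fst_add, Prod.snd_add, hadd, hB, map_add, map_sub,
        LinearMap.add_apply, LinearMap.sub_apply, Pi.add_apply, mul_add, cosetAvg_add]
      ring)
    (fun r x y => by
      simp only [coeffPair, Prod.smul_fst, Prod.smul_snd, hsmul, hB, map_add, map_sub, map_smul,
        LinearMap.add_apply, LinearMap.sub_apply, Pi.smul_apply, smul_eq_mul,
        mul_left_comm _ r, cosetAvg_mul_left]
      ring)

theorem coeffBilin_apply [Γ.FiniteIndex] (x y : (SL(2, ℤ) → ℂ[X]) × (SL(2, ℤ) → ℂ)) :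
    coeffBilin Γ w x y = coeffPair Γ w x.1 x.2 y.1 y.2 := rfl

/-! ### The action of `ε` -/

theorem coe_epsConj (A : SL(2, ℤ)) :
    (epsConj A : Matrix (Fin 2) (Fin 2) ℤ) = !![A 0 0, -A 0 1; -A 1 0, A 1 1] := rfl

theorem epsConj_mul (A B : SL(2, ℤ)) : epsConj (A * B) = epsConj A * epsConj B := by
  apply Subtype.ext
  rw [Matrix.SpecialLinearGroup.coe_mul, coe_epsConj, coe_epsConj, coe_epsConj,
    Matrix.SpecialLinearGroup.coe_mul]
  ext i j
  fin_cases i <;> fin_cases j <;> simp [Matrix.mul_apply, Fin.sum_univ_two] <;> ring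

theorem epsConj_epsConj (A : SL(2, ℤ)) : epsConj (epsConj A) = A := by
  ext i j
  fin_cases i <;> fin_cases j <;> simp [coe_epsConj]

theorem epsConj_neg (A : SL(2, ℤ)) : epsConj (-A) = -epsConj A := by
  apply Subtype.ext
  rw [Matrix.SpecialLinearGroup.coe_neg, coe_epsConj, coe_epsConj,
    Matrix.SpecialLinearGroup.coe_neg]
  ext i j
  fin_cases i <;> fin_cases j <;> simp

theorem epsConj_one : epsConj 1 = 1 := by decide

theorem epsConj_T : epsConj ModularGroup.T = ModularGroup.T⁻¹ := by decide

theorem epsConj_S : epsConj ModularGroup.S = ModularGroup.S⁻¹ := by decide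

/-- Conjugation by `ε` as a group homomorphism. -/
def epsHom : SL(2, ℤ) →* SL(2, ℤ) where
  toFun := epsConj
  map_one' := epsConj_one
  map_mul' := epsConj_mul

theorem epsConj_mem_projHull (hΓ : ∀ γ ∈ Γ, epsConj γ ∈ Γ) {γ : SL(2, ℤ)}
    (hγ : γ ∈ projHull Γ) : epsConj γ ∈ projHull Γ := by
  have : projHull Γ ≤ (projHull Γ).comap epsHom := by
    refine sup_le (fun γ hγ => Subgroup.mem_sup_left (hΓ γ hγ)) ?_
    rw [Subgroup.zpowers_le]
    have h1 : epsHom (-1) = -1 := by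
      change epsConj (-1) = -1
      rw [epsConj_neg, epsConj_one]
    rw [Subgroup.mem_comap, h1]
    exact Subgroup.mem_sup_right (Subgroup.mem_zpowers _)
  exact this hγ

theorem cosetAvg_epsConj (hΓ : ∀ γ ∈ Γ, epsConj γ ∈ Γ) {F : SL(2, ℤ) → ℂ}
    (hF : CosetInv Γ F) : cosetAvg Γ (fun A => F (epsConj A)) = cosetAvg Γ F := by
  have h : ∀ A B, B * A⁻¹ ∈ projHull Γ → epsConj B * (epsConj A)⁻¹ ∈ projHull Γ := by
    intro A B hAB
    have := epsConj_mem_projHull hΓ hAB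
    rwa [epsConj_mul, show epsConj A⁻¹ = (epsConj A)⁻¹ from map_inv epsHom A] at this
  exact cosetAvg_comp hF (Function.Involutive.toPerm epsConj epsConj_epsConj) h h

/-- The action of `ε` on families of polynomials. -/
def epsPoly : (SL(2, ℤ) → ℂ[X]) →ₗ[ℂ] (SL(2, ℤ) → ℂ[X]) where
  toFun P A := (P (epsConj A)).comp (-X)
  map_add' P Q := by ext1 A; simp
  map_smul' c P := by ext1 A; simp

theorem epsPoly_apply (P : SL(2, ℤ) → ℂ[X]) (A : SL(2, ℤ)) :
    epsPoly P A = (P (epsConj A)).comp (-X) := rfl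

theorem coeff_epsPoly (P : SL(2, ℤ) → ℂ[X]) (A : SL(2, ℤ)) (n : ℕ) :
    (epsPoly P A).coeff n = (-1) ^ n * (P (epsConj A)).coeff n := by
  rw [epsPoly_apply, comp_neg_X_coeff]

theorem epsPoly_epsPoly (P : SL(2, ℤ) → ℂ[X]) : epsPoly (epsPoly P) = P := by
  ext A n
  rw [coeff_epsPoly, coeff_epsPoly, epsConj_epsConj, ← mul_assoc, ← mul_pow]
  simp

theorem famT_epsPoly (n : ℤ) (P : SL(2, ℤ) → ℂ[X]) :
    famT n (epsPoly P) = epsPoly (famT (-n) P) := by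
  ext1 A
  have h1 : epsConj (A * ModularGroup.T ^ (-n)) = epsConj A * ModularGroup.T ^ (- -n) := by
    rw [epsConj_mul, show epsConj (ModularGroup.T ^ (-n)) = epsConj ModularGroup.T ^ (-n) from
      map_zpow epsHom _ _, epsConj_T, inv_zpow']
  rw [famT_apply, epsPoly_apply, epsPoly_apply, famT_apply, h1, comp_assoc, comp_assoc]
  congr 1
  simp only [neg_comp, X_comp, add_comp, C_comp, Int.cast_neg, C_neg]
  ring

theorem famS_epsPoly {P : SL(2, ℤ) → ℂ[X]} (hP : P ∈ polyFam Γ w) :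
    famS w (epsPoly P) = epsPoly (famS w P) := by
  ext1 A
  have h1 : epsConj (A * ModularGroup.S⁻¹) = -(epsConj A * ModularGroup.S⁻¹) := by
    rw [epsConj_mul, show epsConj ModularGroup.S⁻¹ = (epsConj ModularGroup.S)⁻¹ from
      map_inv epsHom _, epsConj_S, ← mul_neg]
    congr 1
    decide
  rw [famS_apply, epsPoly_apply, epsPoly_apply, famS_apply, h1, hP.2.2, smul_comp, map_smul,
    polyS_comp_neg_X, smul_smul, ← mul_pow]
  simp

theorem famPair_epsPoly (hΓ : ∀ γ ∈ Γ, epsConj γ ∈ Γ) {P Q : SL(2, ℤ) → ℂ[X]}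
    (hP : P ∈ polyFam Γ w) (hQ : Q ∈ polyFam Γ w) :
    famPair Γ w (epsPoly P) (epsPoly Q) = (-1) ^ w * famPair Γ w P Q := by
  simp only [famPair, epsPoly_apply, polyPair_neg_X]
  rw [cosetAvg_mul_left, cosetAvg_epsConj hΓ (cosetInv_polyPair hP hQ)]

/-- The action of `ε` on the coefficients of `X^{w+1}`. -/
def epsTop (w : ℕ) : (SL(2, ℤ) → ℂ) →ₗ[ℂ] (SL(2, ℤ) → ℂ) where
  toFun c A := (-1) ^ (w + 1) * c (epsConj A)
  map_add' c d := by ext1 A; simp [mul_add]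
  map_smul' r c := by ext1 A; simp [mul_left_comm]

theorem epsTop_apply (c : SL(2, ℤ) → ℂ) (A : SL(2, ℤ)) :
    epsTop w c A = (-1) ^ (w + 1) * c (epsConj A) := rfl

theorem epsTop_epsTop (c : SL(2, ℤ) → ℂ) : epsTop w (epsTop w c) = c := by
  ext1 A
  rw [epsTop_apply, epsTop_apply, epsConj_epsConj, ← mul_assoc, ← mul_pow]
  simp

theorem IsTopCoeff.epsTop (hΓ : ∀ γ ∈ Γ, epsConj γ ∈ Γ) {c : SL(2, ℤ) → ℂ}
    (hc : IsTopCoeff Γ w c) : IsTopCoeff Γ w (epsTop w c) where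
  inv γ hγ A := by rw [epsTop_apply, epsTop_apply, epsConj_mul, hc.inv _ (hΓ γ hγ)]
  neg A := by rw [epsTop_apply, epsTop_apply, epsConj_neg, hc.neg]; ring
  mul_T A := by rw [epsTop_apply, epsTop_apply, epsConj_mul, epsConj_T, hc.mul_T_inv]

/-- Conjugation by ε inverts T, and the combination N + N|T⁻¹ is, up to sign, the action of T - T⁻¹
on the top term; hence it changes sign. -/
theorem diffFam_epsTop {c : SL(2, ℤ) → ℂ} (hc : IsTopCoeff Γ w c) :
    diffFam w (epsTop w c) + famT (-1) (diffFam w (epsTop w c)) =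
      -epsPoly (diffFam w c + famT (-1) (diffFam w c)) := by
  ext1 A
  have h1 : A * ModularGroup.T ^ (- -1 : ℤ) = A * ModularGroup.T := by simp
  have h2 : epsConj A * ModularGroup.T ^ (- -1 : ℤ) = epsConj A * ModularGroup.T := by simp
  simp only [Pi.add_apply, Pi.neg_apply, epsPoly_apply, famT_apply, diffFam, h1, h2, hc.mul_T,
    epsTop_apply, epsConj_mul, epsConj_T, hc.mul_T_inv, smul_comp, add_comp, comp_assoc]
  have h3 : (diffPoly w).comp (X.comp (-X) + (C ((-1 : ℤ) : ℂ)).comp (-X)) =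
      (-1 : ℂ) ^ w • diffPoly w := by
    have : (-X + C (-1) : ℂ[X]) = (-X : ℂ[X]).comp (X + C 1) := by simp; ring
    rw [X_comp, C_comp, Int.cast_neg, Int.cast_one, this, ← comp_assoc]
    have h := diffPoly_comp_sub_one (w := w)
    have h4 := congrArg (fun p : ℂ[X] => (-1 : ℂ) ^ w • p.comp (X + C 1)) h
    simp only [smul_comp, comp_assoc, smul_smul, ← mul_pow] at h4
    simp only [comp_assoc]
    simpa using h4.symm
  have h5 := diffPoly_comp_sub_one (w := w)
  rw [h3]
  simp only [Int.cast_neg, Int.cast_one]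
  rw [h5, smul_smul, smul_smul, pow_succ]
  have hm : (-1 : ℂ) ^ w * (-1 : ℂ) ^ w = 1 := by rw [← mul_pow]; simp
  rw [show -((-1 : ℂ) ^ w * -1 * c (epsConj A)) * (-1) ^ w =
    ((-1 : ℂ) ^ w * (-1) ^ w) * c (epsConj A) by ring, hm]
  module

/-- The action of `ε` on the components of extended period polynomials. -/
def epsData (w : ℕ) : ((SL(2, ℤ) → ℂ[X]) × (SL(2, ℤ) → ℂ)) →ₗ[ℂ]
    ((SL(2, ℤ) → ℂ[X]) × (SL(2, ℤ) → ℂ)) :=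
  epsPoly.prodMap (epsTop w)

theorem epsData_epsData (x : (SL(2, ℤ) → ℂ[X]) × (SL(2, ℤ) → ℂ)) :
    epsData w (epsData w x) = x :=
  Prod.ext (epsPoly_epsPoly x.1) (epsTop_epsTop x.2)

/-- The behaviour of the extended pairing under `ε`. -/
theorem coeffBilin_epsData [Γ.FiniteIndex] (hΓ : ∀ γ ∈ Γ, epsConj γ ∈ Γ)
    {x y : (SL(2, ℤ) → ℂ[X]) × (SL(2, ℤ) → ℂ)} (hx : x.1 ∈ polyFam Γ w)
    (hx' : IsTopCoeff Γ w x.2) (hy : y.1 ∈ polyFam Γ w) (hy' : IsTopCoeff Γ w y.2) :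
    coeffBilin Γ w (epsData w x) (epsData w y) = (-1) ^ (w + 1) * coeffBilin Γ w x y := by
  have hB : ∀ P Q, famPair Γ w P Q = famBilin Γ w P Q := fun _ _ => rfl
  -- Since ε inverts T, the operator T - T⁻¹ changes sign. This is the extra factor -1 beyond the
  -- (-1)^w of the invariant pairing.
  have e1 : famT 1 (epsPoly x.1) - famT (-1) (epsPoly x.1) =
      -epsPoly (famT 1 x.1 - famT (-1) x.1) := by
    rw [famT_epsPoly, famT_epsPoly, map_sub, neg_neg, neg_sub]
  have m1 : famT 1 x.1 - famT (-1) x.1 ∈ polyFam Γ w := sub_mem (famT_mem _ hx) (famT_mem _ hx)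
  have m2 : ∀ {c}, IsTopCoeff Γ w c → diffFam w c + famT (-1) (diffFam w c) ∈ polyFam Γ w :=
    fun hc => add_mem (diffFam_mem hc) (famT_mem _ (diffFam_mem hc))
  have e2 : (cosetAvg Γ fun A => epsTop w x.2 A * epsTop w y.2 A) =
      cosetAvg Γ fun A => x.2 A * y.2 A := by
    have hinv : CosetInv Γ fun A => x.2 A * y.2 A := by
      refine ⟨fun γ hγ A => by simp only [hx'.inv γ hγ, hy'.inv γ hγ], fun A => ?_⟩
      simp only [hx'.neg, hy'.neg]
      rw [mul_mul_mul_comm, ← mul_pow]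
      simp
    rw [← cosetAvg_epsConj hΓ hinv]
    congr 1
    ext1 A
    rw [epsTop_apply, epsTop_apply, mul_mul_mul_comm, ← mul_pow]
    simp
  have hm : (-1 : ℂ) ^ w * (-1 : ℂ) ^ w = 1 := by rw [← mul_pow]; simp
  rw [coeffBilin_apply, coeffBilin_apply, coeffPair, coeffPair]
  change famPair Γ w (famT 1 (epsPoly x.1) - famT (-1) (epsPoly x.1)) (epsPoly y.1) -
      2 * famPair Γ w (diffFam w (epsTop w x.2) + famT (-1) (diffFam w (epsTop w x.2)))
        (epsPoly y.1) + 2 * famPair Γ w (epsPoly x.1)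
        (diffFam w (epsTop w y.2) + famT (-1) (diffFam w (epsTop w y.2))) +
      3 * (((w : ℂ) + 1) / (w + 2)) * (1 - (-1) ^ w) *
        (cosetAvg Γ fun A => epsTop w x.2 A * epsTop w y.2 A) = _
  have f1 := famPair_epsPoly hΓ m1 hy
  have f2 := famPair_epsPoly hΓ (m2 hx') hy
  have f3 := famPair_epsPoly hΓ hx (m2 hy')
  rw [e1, e2, diffFam_epsTop hx', diffFam_epsTop hy']
  simp only [hB, map_neg, LinearMap.neg_apply] at f1 f2 f3 ⊢
  rw [f1, f2, f3, pow_succ]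
  linear_combination (-3 * (((w : ℂ) + 1) / (w + 2)) * cosetAvg Γ fun A => x.2 A * y.2 A) * hm

end Conjugations

/-! ### Haberland's formula and its refinement for the signed parts -/

noncomputable section HaberlandFormula

open Polynomial

variable {Γ : Subgroup SL(2, ℤ)} {w : ℕ}

/-! ### The complex conjugate of a modular family -/

/-- The family `A ↦ conj (G(εAε)(-conj z))`. -/
def starFam (G : SL(2, ℤ) → ℂ → ℂ) (A : SL(2, ℤ)) (z : ℂ) : ℂ := conj (G (epsConj A) (-conj z))

/-- The constant terms of `starFam`. -/
def starTop (b : SL(2, ℤ) → ℂ) (A : SL(2, ℤ)) : ℂ := conj (b (epsConj A))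

theorem neg_conj_mem_upperHalf {z : ℂ} (hz : z ∈ upperHalf) : -conj z ∈ upperHalf := by
  simpa [upperHalf] using hz

theorem polyPrim_star (f : ℂ → ℂ) (a : ℂ) (n : ℕ) (z : ℂ) :
    polyPrim (fun z => conj (f (-conj z))) (conj a) (X ^ n) z =
      (-1) ^ (n + 1) * conj (polyPrim f a (X ^ n) (-conj z)) := by
  rw [polyPrim, polyPrim, vInt, vInt, map_neg, ← integral_conj, mul_neg, ← integral_const_mul]
  congr 2
  ext1 s
  have h1 : -conj (z + s * Complex.I) = -conj z + s * Complex.I := by simp; ring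
  have h2 : z + s * Complex.I = -conj (-conj z + s * Complex.I) := by simp [add_comm]
  simp only [h1, map_mul, map_sub, eval_pow, eval_X, Complex.conj_I, map_pow]
  rw [h2, neg_pow, pow_succ]
  ring

theorem momPrim_star (f : ℂ → ℂ) (a : ℂ) (n : ℕ) (z : ℂ) :
    momPrim (fun z => conj (f (-conj z))) (conj a) n z =
      (-1) ^ (n + 1) * conj (momPrim f a n (-conj z)) := by
  have hm : (-1 : ℂ) ^ (n + 1) * (-1 : ℂ) ^ (n + 1) = 1 := by rw [← mul_pow]; simp
  rw [momPrim, momPrim, polyPrim_star]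
  simp only [map_add, map_div₀, map_mul, map_pow, map_neg, Complex.conj_conj, map_one,
    Complex.conj_natCast]
  rw [neg_pow z (n + 1)]
  linear_combination (-(conj a * z ^ (n + 1) / (n + 1))) * hm

/-- Reflection z ↦ -z̄ composed with conjugation is holomorphic, and conjugation by ε inverts S and
T exactly as the reflection does. Stability of Γ under ε gives the invariance. -/
theorem IsModFam.star (hΓ : ∀ γ ∈ Γ, epsConj γ ∈ Γ) {G : SL(2, ℤ) → ℂ → ℂ} {b : SL(2, ℤ) → ℂ}
    (hG : IsModFam Γ w G b) : IsModFam Γ w (starFam G) (starTop b) where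
  diff A z hz := by
    have h1 : DifferentiableAt ℂ (fun z => G (epsConj A) (-z)) (conj z) :=
      ((hG.diff (epsConj A)).differentiableAt
        (isOpen_upperHalf.mem_nhds (neg_conj_mem_upperHalf hz))).comp (conj z)
        differentiableAt_id.neg
    have h2 := h1.conj_conj
    rw [Complex.conj_conj] at h2
    exact h2.differentiableWithinAt
  inv γ hγ A := by
    ext1 z
    rw [starFam, starFam, epsConj_mul, hG.inv _ (hΓ γ hγ)]
  neg A z := by
    rw [starFam, starFam, epsConj_neg, hG.neg]
    simp
  mul_T A z hz := by
    have h1 : -conj (z + 1) ∈ upperHalf := neg_conj_mem_upperHalf (by simpa [upperHalf] using hz)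
    have h2 := hG.mul_T (epsConj A * ModularGroup.T⁻¹) _ h1
    rw [inv_mul_cancel_right] at h2
    rw [starFam, starFam, epsConj_mul, epsConj_T, h2]
    congr 2
    simp
  mul_S A z hz := by
    have h1 := hG.mul_S (epsConj A) _ (neg_conj_mem_upperHalf hz)
    have h2 : epsConj (A * ModularGroup.S) = -(epsConj A * ModularGroup.S) := by
      rw [epsConj_mul, epsConj_S, ← mul_neg]
      congr 1
      decide
    have h3 : -conj (-1 / z) = -1 / -conj z := by simp [neg_div, div_neg]
    rw [starFam, starFam, h3, ← h1, h2, hG.neg]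
    simp only [map_mul, map_pow, map_neg, Complex.conj_conj, map_one]
    rw [neg_pow z]
    ring
  decay A := by
    intro M
    obtain ⟨c, hc, C, hC, B, hB, hb⟩ := hG.decay (epsConj A) M
    refine ⟨c, hc, C, hC, B, hB, fun z hz hBz => ?_⟩
    have h1 := hb (-conj z) (by simpa using hz) (by simpa using hBz)
    change ‖conj (G (epsConj A) (-conj z)) - conj (b (epsConj A))‖ ≤ _
    rw [← map_sub, Complex.norm_conj]
    simpa using h1

theorem eichFam_star (G : SL(2, ℤ) → ℂ → ℂ) (b : SL(2, ℤ) → ℂ) :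
    eichFam w (starFam G) (starTop b) Complex.I =
      (-1 : ℂ) ^ (w + 1) • epsPoly (conjPoly (eichFam w G b Complex.I)) := by
  ext A n
  have h1 := momPrim_star (G (epsConj A)) (b (epsConj A)) (w - n) Complex.I
  have h2 : -conj Complex.I = Complex.I := by simp
  rw [h2] at h1
  rw [Pi.smul_apply, coeff_smul, coeff_epsPoly, conjPoly, coeff_map, eichFam, eichFam,
    coeff_eichPoly, coeff_eichPoly, smul_eq_mul]
  split_ifs with hn
  · refine (congrArg _ h1).trans ?_
    have h3 : (-1 : ℂ) ^ (w + 1) = (-1) ^ (w - n + 1) * (-1) ^ n := by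
      rw [← pow_add]
      congr 1
      omega
    have hm : (-1 : ℂ) ^ n * (-1 : ℂ) ^ n = 1 := by rw [← mul_pow]; simp
    simp only [map_mul, map_pow, map_neg, map_one, Complex.conj_natCast]
    rw [h3]
    linear_combination (-(w.choose n : ℂ) * (-1) ^ n * (-1) ^ (w - n + 1) *
      conj (momPrim (G (epsConj A)) (b (epsConj A)) (w - n) Complex.I)) * hm
  · simp

/-- The base point i is fixed by z ↦ -z̄, so at the level of corner polynomials the star operation
is conjugation followed by ε and a sign; these commute with the action of S. -/
theorem IsModFam.perPoly_star {G : SL(2, ℤ) → ℂ → ℂ} {b : SL(2, ℤ) → ℂ}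
    (hG : IsModFam Γ w G b) : perPoly w (starFam G) (starTop b) =
      (-1 : ℂ) ^ (w + 1) • epsPoly (conjPoly (perPoly w G b)) := by
  rw [perPoly, perPoly, eichFam_star, map_smul,
    famS_epsPoly (conjPoly_mem (hG.eichFam_mem Complex.I)), ← conjPoly_famS, conjPoly_sub, map_sub,
    smul_sub]

theorem topC_star (b : SL(2, ℤ) → ℂ) :
    (fun A => topC w (starTop b A)) =
      (-1 : ℂ) ^ (w + 1) • epsTop w fun A => conj (topC w (b A)) := by
  ext1 A
  have hm : (-1 : ℂ) ^ (w + 1) * (-1 : ℂ) ^ (w + 1) = 1 := by rw [← mul_pow]; simp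
  rw [Pi.smul_apply, epsTop_apply, smul_eq_mul, ← mul_assoc, hm, one_mul, starTop, topC, topC]
  simp

/-! ### The components of extended period polynomials -/

/-- The components of a family of Laurent polynomials. -/
def laurentData (w : ℕ) (P : SL(2, ℤ) → ℂ[T;T⁻¹]) : (SL(2, ℤ) → ℂ[X]) × (SL(2, ℤ) → ℂ) :=
  (polyPart w P, topCoeff w P)

theorem coeff_polyPart (P : SL(2, ℤ) → ℂ[T;T⁻¹]) (A : SL(2, ℤ)) (n : ℕ) :
    (polyPart w P A).coeff n = if n ≤ w then (P A).coeff (n : ℤ) else 0 := by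
  simp [polyPart, coeff_monomial]

theorem coeff_conjFam (P : SL(2, ℤ) → ℂ[T;T⁻¹]) (A : SL(2, ℤ)) (m : ℤ) :
    (conjFam P A).coeff m = conj ((P A).coeff m) := by
  rw [conjFam, AddMonoidAlgebra.coeff_map, Finsupp.mapRange_apply]
  rfl

theorem coeff_famEps (P : SL(2, ℤ) → ℂ[T;T⁻¹]) (A : SL(2, ℤ)) (m : ℤ) :
    (famEps P A).coeff m = (-1) ^ m * (P (epsConj A)).coeff m := by
  rw [famEps, Finsupp.sum, AddMonoidAlgebra.coeff_sum, Finsupp.finsetSum_apply]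
  simp only [AddMonoidAlgebra.coeff_single, Finsupp.single_apply]
  rw [Finset.sum_ite_eq']
  split_ifs with h
  · rfl
  · rw [Finsupp.notMem_support_iff.mp h, mul_zero]

theorem laurentData_conjFam (P : SL(2, ℤ) → ℂ[T;T⁻¹]) :
    laurentData w (conjFam P) =
      (conjPoly (polyPart w P), fun A => conj (topCoeff w P A)) := by
  refine Prod.ext ?_ ?_
  · ext A n
    change (polyPart w (conjFam P) A).coeff n = ((polyPart w P A).map _).coeff n
    rw [coeff_map, coeff_polyPart, coeff_polyPart, coeff_conjFam]
    split_ifs <;> simp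
  · ext1 A
    exact coeff_conjFam P A _

theorem laurentData_famEps (P : SL(2, ℤ) → ℂ[T;T⁻¹]) :
    laurentData w (famEps P) = epsData w (laurentData w P) := by
  refine Prod.ext ?_ ?_
  · ext A n
    change (polyPart w (famEps P) A).coeff n = (epsPoly (polyPart w P) A).coeff n
    rw [coeff_epsPoly, coeff_polyPart, coeff_polyPart, coeff_famEps, zpow_natCast]
    split_ifs <;> simp
  · ext1 A
    refine (coeff_famEps P A _).trans ?_
    rw [← Nat.cast_succ, zpow_natCast]
    rfl

theorem laurentData_add (P Q : SL(2, ℤ) → ℂ[T;T⁻¹]) :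
    laurentData w (P + Q) = laurentData w P + laurentData w Q := by
  refine Prod.ext ?_ ?_
  · ext A n
    change (polyPart w (P + Q) A).coeff n = (polyPart w P A + polyPart w Q A).coeff n
    rw [coeff_add, coeff_polyPart, coeff_polyPart, coeff_polyPart]
    split_ifs <;> simp
  · rfl

theorem laurentData_smul (c : ℂ) (P : SL(2, ℤ) → ℂ[T;T⁻¹]) :
    laurentData w (c • P) = c • laurentData w P := by
  refine Prod.ext ?_ ?_
  · ext A n
    change (polyPart w (c • P) A).coeff n = (c • polyPart w P A).coeff n
    rw [coeff_smul, coeff_polyPart, coeff_polyPart]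
    split_ifs <;> simp
  · rfl

theorem laurentData_signPart (κ : ℤˣ) (P : SL(2, ℤ) → ℂ[T;T⁻¹]) :
    laurentData w (signPart κ P) =
      (1 / 2 : ℂ) • (laurentData w P + ((κ : ℤ) : ℂ) • epsData w (laurentData w P)) := by
  rw [signPart, laurentData_smul, laurentData_add, laurentData_smul, laurentData_famEps]

theorem conjFam_signPart (κ : ℤˣ) (P : SL(2, ℤ) → ℂ[T;T⁻¹]) :
    conjFam (signPart κ P) = signPart κ (conjFam P) := by
  ext A m
  simp only [signPart, coeff_conjFam, Pi.smul_apply, Pi.add_apply, AddMonoidAlgebra.coeff_smul,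
    AddMonoidAlgebra.coeff_add, Finsupp.smul_apply, Finsupp.add_apply, coeff_famEps, smul_eq_mul,
    map_mul, map_add, map_zpow₀, map_neg, map_one, map_div₀, Complex.conj_ofNat, map_intCast]

theorem extPair_eq_coeffBilin [Γ.FiniteIndex] {P Q : SL(2, ℤ) → ℂ[T;T⁻¹]}
    (hP : IsTopCoeff Γ w (laurentData w P).2) (hQ : IsTopCoeff Γ w (laurentData w Q).2) :
    extPair Γ (w + 2) P Q = coeffBilin Γ w (laurentData w P) (laurentData w Q) :=
  extPair_eq_coeffPair hP hQ

theorem IsTopCoeff.add {c d : SL(2, ℤ) → ℂ} (hc : IsTopCoeff Γ w c) (hd : IsTopCoeff Γ w d) :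
    IsTopCoeff Γ w (c + d) where
  inv γ hγ A := by rw [Pi.add_apply, Pi.add_apply, hc.inv γ hγ, hd.inv γ hγ]
  neg A := by rw [Pi.add_apply, Pi.add_apply, hc.neg, hd.neg, mul_add]
  mul_T A := by rw [Pi.add_apply, Pi.add_apply, hc.mul_T, hd.mul_T]

theorem IsTopCoeff.smul (r : ℂ) {c : SL(2, ℤ) → ℂ} (hc : IsTopCoeff Γ w c) :
    IsTopCoeff Γ w (r • c) where
  inv γ hγ A := by rw [Pi.smul_apply, Pi.smul_apply, hc.inv γ hγ]
  neg A := by rw [Pi.smul_apply, Pi.smul_apply, hc.neg, smul_eq_mul, smul_eq_mul, mul_left_comm]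
  mul_T A := by rw [Pi.smul_apply, Pi.smul_apply, hc.mul_T]

theorem epsPoly_mem (hΓ : ∀ γ ∈ Γ, epsConj γ ∈ Γ) {P : SL(2, ℤ) → ℂ[X]} (hP : P ∈ polyFam Γ w) :
    epsPoly P ∈ polyFam Γ w := by
  obtain ⟨h1, h2, h3⟩ := hP
  refine ⟨fun A => ?_, fun γ hγ A => ?_, fun A => ?_⟩
  · rw [epsPoly_apply, natDegree_comp, natDegree_neg, natDegree_X, mul_one]
    exact h1 _
  · rw [epsPoly_apply, epsPoly_apply, epsConj_mul, h2 _ (hΓ γ hγ)]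
  · rw [epsPoly_apply, epsPoly_apply, epsConj_neg, h3, smul_comp]

/-- The extended pairing of the `±`-parts. -/
theorem extPair_signPart [Γ.FiniteIndex] (hΓ : ∀ γ ∈ Γ, epsConj γ ∈ Γ)
    {P Q : SL(2, ℤ) → ℂ[T;T⁻¹]} (hP : (laurentData w P).1 ∈ polyFam Γ w)
    (hP' : IsTopCoeff Γ w (laurentData w P).2) (hQ : (laurentData w Q).1 ∈ polyFam Γ w)
    (hQ' : IsTopCoeff Γ w (laurentData w Q).2)
    (h0 : coeffBilin Γ w (laurentData w P) (epsData w (laurentData w Q)) = 0) (κ₁ κ₂ : ℤˣ) :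
    extPair Γ (w + 2) (signPart κ₁ P) (signPart κ₂ Q) =
      (1 + ((κ₁ : ℤ) : ℂ) * ((κ₂ : ℤ) : ℂ) * (-1) ^ (w + 1)) / 4 * extPair Γ (w + 2) P Q := by
  have h1 : ∀ (κ : ℤˣ) (R : SL(2, ℤ) → ℂ[T;T⁻¹]), IsTopCoeff Γ w (laurentData w R).2 →
      IsTopCoeff Γ w (laurentData w (signPart κ R)).2 := fun κ R hR => by
    rw [laurentData_signPart]
    exact (hR.add ((hR.epsTop hΓ).smul _)).smul _
  -- The other cross term follows from `h0`, because ε is an involution and the pairing is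
  -- ε-equivariant up to sign.
  have h2 : coeffBilin Γ w (epsData w (laurentData w P)) (laurentData w Q) = 0 := by
    have hm : (-1 : ℂ) ^ (w + 1) * (-1 : ℂ) ^ (w + 1) = 1 := by rw [← mul_pow]; simp
    have h3 := coeffBilin_epsData hΓ (x := epsData w (laurentData w P)) (y := laurentData w Q)
      (epsPoly_mem hΓ hP) (hP'.epsTop hΓ) hQ hQ'
    rw [epsData_epsData, h0] at h3
    linear_combination (-(-1) ^ (w + 1)) * h3 -
      coeffBilin Γ w (epsData w (laurentData w P)) (laurentData w Q) * hm
  rw [extPair_eq_coeffBilin (h1 _ _ hP') (h1 _ _ hQ'), extPair_eq_coeffBilin hP' hQ',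
    laurentData_signPart, laurentData_signPart]
  simp only [map_smul, map_add, LinearMap.smul_apply, LinearMap.add_apply, smul_eq_mul, h0, h2,
    coeffBilin_epsData hΓ hP hP' hQ hQ']
  ring

/-! ### Haberland's formula -/

/-- The integrand of the Petersson product. -/
theorem integrableOn_truncDomain {k : ℕ}
    (f g : ModularForm (Γ : Subgroup (GL (Fin 2) ℝ)) (k : ℤ)) (A : SL(2, ℤ)) (Y : ℝ) :
    IntegrableOn (fun z : ℍ => (⇑f ∣[(k : ℤ)] A) z * conj ((⇑g ∣[(k : ℤ)] A) z) *
      (z.im : ℂ) ^ k) (truncDomain Y) := by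
  have h1 : ∀ h : ModularForm (Γ : Subgroup (GL (Fin 2) ℝ)) (k : ℤ),
      Continuous (⇑h ∣[(k : ℤ)] A) := fun h => (mdiff_slash h A).continuous
  have h2 : Continuous (fun z : ℍ => (⇑f ∣[(k : ℤ)] A) z * conj ((⇑g ∣[(k : ℤ)] A) z) *
      (z.im : ℂ) ^ k) :=
    ((h1 f).mul (Complex.continuous_conj.comp (h1 g))).mul
      ((Complex.continuous_ofReal.comp UpperHalfPlane.continuous_im).pow k)
  exact (h2.continuousOn.integrableOn_compact
    (ModularGroup.isCompact_truncatedFundamentalDomain Y)).mono_set fun z hz => ⟨hz.1, hz.2.le⟩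

variable [Γ.FiniteIndex] (f g : ModularForm (Γ : Subgroup (GL (Fin 2) ℝ)) ((w + 2 : ℕ) : ℤ))

theorem laurentData_extPeriodPoly : laurentData w (extPeriodPoly (w + 2) f) =
    (perPoly w (slashFam (w + 2) f) (constTerm (w + 2) f),
      fun A => topC w (constTerm (w + 2) f A)) := by
  rw [extPeriodPoly_eq]
  exact Prod.ext (polyPart_perLaurent _ _ _) (funext (topCoeff_perLaurent _ _ _))

theorem laurentData_conjFam_extPeriodPoly : laurentData w (conjFam (extPeriodPoly (w + 2) f)) =
    (conjPoly (perPoly w (slashFam (w + 2) f) (constTerm (w + 2) f)),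
      fun A => conj (topC w (constTerm (w + 2) f A))) := by
  have h := laurentData_extPeriodPoly f
  rw [laurentData_conjFam]
  rw [laurentData, Prod.mk.injEq] at h
  rw [h.1, h.2]

theorem isTopCoeff_laurentData :
    IsTopCoeff Γ w (laurentData w (extPeriodPoly (w + 2) f)).2 := by
  rw [laurentData_extPeriodPoly]
  exact (isModFam_slashFam f).isTopCoeff

theorem isTopCoeff_laurentData_conjFam :
    IsTopCoeff Γ w (laurentData w (conjFam (extPeriodPoly (w + 2) f))).2 := by
  rw [laurentData_conjFam_extPeriodPoly]
  exact (isModFam_slashFam f).isPeriodData.conj.top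

theorem extPair_extPeriodPoly :
    extPair Γ (w + 2) (extPeriodPoly (w + 2) f) (extPeriodPoly (w + 2) g) = 0 := by
  rw [extPair_eq_coeffBilin (isTopCoeff_laurentData f) (isTopCoeff_laurentData g),
    laurentData_extPeriodPoly, laurentData_extPeriodPoly]
  exact (isModFam_slashFam f).coeffPair_perPoly (isModFam_slashFam g)

/-- The vanishing in (b) is applied to f and the star of g: the period data of that star are ± the
ε-transform of the conjugated data of g. -/
theorem coeffBilin_epsData_conjFam (hΓ : ∀ γ ∈ Γ, epsConj γ ∈ Γ) :
    coeffBilin Γ w (laurentData w (extPeriodPoly (w + 2) f))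
      (epsData w (laurentData w (conjFam (extPeriodPoly (w + 2) g)))) = 0 := by
  have hG := isModFam_slashFam g
  have h1 := (isModFam_slashFam f).coeffPair_perPoly (hG.star hΓ)
  rw [hG.perPoly_star, topC_star] at h1
  have h2 : coeffBilin Γ w (laurentData w (extPeriodPoly (w + 2) f)) ((-1 : ℂ) ^ (w + 1) •
      epsData w (laurentData w (conjFam (extPeriodPoly (w + 2) g)))) = 0 := by
    rw [laurentData_extPeriodPoly, laurentData_conjFam_extPeriodPoly]
    exact h1
  rw [map_smul, smul_eq_mul] at h2
  exact (mul_eq_zero.mp h2).resolve_left (pow_ne_zero _ (by norm_num))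

theorem tendsto_truncPetersson :
    Tendsto (truncPetersson Γ (w + 2) f g) atTop (𝓝 (((2 * Complex.I) ^ (w + 1))⁻¹ *
      cosetAvg Γ fun A => conj (arcInt fun z => conj (stokesFun w (slashFam (w + 2) f A)
        (constTerm (w + 2) f A) (slashFam (w + 2) g A) z)))) := by
  have h1 := ((isModFam_slashFam f).tendsto_truncated (isModFam_slashFam g)).const_mul
    ((2 * Complex.I) ^ (w + 1))⁻¹
  have h0 : (2 * Complex.I) ^ (w + 1) ≠ 0 := pow_ne_zero _ (by simp)
  refine h1.congr fun Y => ?_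
  rw [inv_mul_cancel_left₀ h0, truncPetersson]
  have h2 : ((w + 2 : ℕ) : ℂ) - 1 = w + 1 := by push_cast; ring
  simp only [slashFam_coe, h2, show w + 2 - 1 = w + 1 from rfl]

/-- The pairing formula with the conjugated polynomial of f in the first slot and g in the second
gives -6 times an arc integral of the conjugated Stokes function. A final conjugation turns this
into (a), the constant being -6(2i)^{w+1} = 6 C_k. -/
theorem haberlandConst_mul_extPetersson :
    6 * haberlandConst (w + 2) * extPetersson Γ (w + 2) f g =
      extPair Γ (w + 2) (extPeriodPoly (w + 2) f) (conjFam (extPeriodPoly (w + 2) g)) := by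
  have hF := isModFam_slashFam f
  have hG := isModFam_slashFam g
  have h0 : (2 * Complex.I) ^ (w + 1) ≠ 0 := pow_ne_zero _ (by simp)
  rw [extPetersson, (tendsto_truncPetersson f g).limUnder_eq, haberlandConst,
    show w + 2 - 1 = w + 1 from rfl,
    extPair_eq_coeffBilin (isTopCoeff_laurentData f) (isTopCoeff_laurentData_conjFam g),
    laurentData_extPeriodPoly, laurentData_conjFam_extPeriodPoly, coeffBilin_apply]
  have h1 := hG.cosetAvg_arcInt_eq_coeffPair hF.isPeriodData.conj
  have h2 : ∀ A z, (conjPoly (perPoly w (slashFam (w + 2) f) (constTerm (w + 2) f)) A).eval z +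
      conj (topC w (constTerm (w + 2) f A)) * z ^ (w + 1) +
      (-1) ^ w * conj (topC w (constTerm (w + 2) f (A * ModularGroup.S⁻¹))) * z⁻¹ =
      conj (perFun w (slashFam (w + 2) f) (constTerm (w + 2) f) A (conj z)) := by
    intro A z
    have h3 := eval_map_apply (f := starRingEnd ℂ)
      (p := perPoly w (slashFam (w + 2) f) (constTerm (w + 2) f) A) (conj z)
    rw [Complex.conj_conj] at h3
    simp only [perFun, conjPoly, h3, map_add, map_mul, map_pow, map_neg, map_one, map_inv₀,
      Complex.conj_conj]
  simp only [h2] at h1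
  rw [hF.cosetAvg_stokesFun hG] at h1
  have h4 := congrArg (starRingEnd ℂ) h1
  rw [conj_coeffPair, conjPoly_conjPoly] at h4
  simp only [Complex.conj_conj, map_mul, conj_cosetAvg, map_neg, Complex.conj_ofNat] at h4
  rw [← h4]
  field_simp
  ring

theorem haberlandConst_mul_extPetersson_signPart (hΓ : ∀ γ ∈ Γ, epsConj γ ∈ Γ) (κ₁ κ₂ : ℤˣ)
    (he : Even (w + 2) → κ₁ ≠ κ₂) (ho : Odd (w + 2) → κ₁ = κ₂) :
    3 * haberlandConst (w + 2) * extPetersson Γ (w + 2) f g =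
      extPair Γ (w + 2) (signPart κ₁ (extPeriodPoly (w + 2) f))
        (conjFam (signPart κ₂ (extPeriodPoly (w + 2) g))) := by
  have h1 : (laurentData w (extPeriodPoly (w + 2) f)).1 ∈ polyFam Γ w := by
    rw [laurentData_extPeriodPoly]
    exact (isModFam_slashFam f).perPoly_mem
  have h2 : (laurentData w (conjFam (extPeriodPoly (w + 2) g))).1 ∈ polyFam Γ w := by
    rw [laurentData_conjFam_extPeriodPoly]
    exact conjPoly_mem (isModFam_slashFam g).perPoly_mem
  -- The sign conditions are exactly those for which the two diagonal terms add up, giving the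
  -- factor (1 + 1)/4 = 1/2 that turns 6 into 3.
  have h3 : ((κ₁ : ℤ) : ℂ) * ((κ₂ : ℤ) : ℂ) * (-1) ^ (w + 1) = 1 := by
    rcases Nat.even_or_odd w with hw | hw
    · have h4 := he (hw.add even_two)
      rw [pow_succ, hw.neg_one_pow]
      rcases Int.units_eq_one_or κ₁ with rfl | rfl <;>
        rcases Int.units_eq_one_or κ₂ with rfl | rfl <;> simp at h4 ⊢
    · have h4 := ho (hw.add_even even_two)
      rw [pow_succ, hw.neg_one_pow, h4]
      rcases Int.units_eq_one_or κ₂ with rfl | rfl <;> simp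
  rw [conjFam_signPart, extPair_signPart hΓ h1 (isTopCoeff_laurentData f) h2
    (isTopCoeff_laurentData_conjFam g) (coeffBilin_epsData_conjFam f g hΓ), h3,
    ← haberlandConst_mul_extPetersson]
  ring

end HaberlandFormula

/-- Haberland's formula for arbitrary modular forms. The first two conjuncts say that the objects in
the formulas are well defined: constant terms and Eichler integrals exist, `f̃ | (1 - S)` is given by
an extended period polynomial, and the limit defining the extended Petersson product exists. -/
theorem theorem8p5 (Γ : Subgroup SL(2, ℤ)) [Γ.FiniteIndex] (k : ℕ) (hk : 2 ≤ k)
    (f g : ModularForm (Γ : Subgroup (GL (Fin 2) ℝ)) (k : ℤ)) :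
    (∀ h : ModularForm (Γ : Subgroup (GL (Fin 2) ℝ)) (k : ℤ),
      (∀ A : SL(2, ℤ), Tendsto (⇑h ∣[(k : ℤ)] A) atImInfty (𝓝 (constTerm k h A))) ∧
      (∀ (A : SL(2, ℤ)) (z : ℍ), IntegrableOn (eichlerIntegrand k h A z) (Set.Ioi 0)) ∧
      IsExtPeriodPoly Γ (k - 2) (extPeriodPoly k h) ∧
      ∀ (A : SL(2, ℤ)) (z : ℍ), laurentEval (extPeriodPoly k h A) z = periodFun k h A z) ∧
    ((∀ (A : SL(2, ℤ)) (Y : ℝ), IntegrableOn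
        (fun z : ℍ => (⇑f ∣[(k : ℤ)] A) z * conj ((⇑g ∣[(k : ℤ)] A) z) * (z.im : ℂ) ^ k)
        (truncDomain Y)) ∧
      Tendsto (truncPetersson Γ k f g) atTop (𝓝 (extPetersson Γ k f g))) ∧
    6 * haberlandConst k * extPetersson Γ k f g =
      extPair Γ k (extPeriodPoly k f) (conjFam (extPeriodPoly k g)) ∧
    extPair Γ k (extPeriodPoly k f) (extPeriodPoly k g) = 0 ∧
    ((∀ γ ∈ Γ, epsConj γ ∈ Γ) →
      ∀ κ₁ κ₂ : ℤˣ, (Even k → κ₁ ≠ κ₂) → (Odd k → κ₁ = κ₂) →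
        3 * haberlandConst k * extPetersson Γ k f g =
          extPair Γ k (signPart κ₁ (extPeriodPoly k f))
            (conjFam (signPart κ₂ (extPeriodPoly k g)))) := by
  obtain ⟨w, rfl⟩ : ∃ w, k = w + 2 := ⟨k - 2, by omega⟩
  refine ⟨fun h => ⟨tendsto_constTerm h, integrableOn_eichlerIntegrand h,
    isExtPeriodPoly_extPeriodPoly h, fun A z => ?_⟩,
    ⟨integrableOn_truncDomain f g, ?_⟩, haberlandConst_mul_extPetersson f g,
    extPair_extPeriodPoly f g, haberlandConst_mul_extPetersson_signPart f g⟩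
  · rw [extPeriodPoly_eq, periodFun_eq]
  · have h := tendsto_truncPetersson f g
    rwa [extPetersson, h.limUnder_eq]
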